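/- Let $n\ge 1$ and let $X,Y,Z$ be the Pauli matrices; write $\sigma^x_s,\sigma^y_s,\sigma^z_s$ for the Pauli matrices acting on qubit $s\in\{1,\dots,n\}$, and $\bm\sigma_s=(\sigma^x_s,\sigma^y_s,\sigma^z_s)$. The Majorana operators on $n$ qubits are $c_{2k-1}=Z_1\cdots Z_{k-1}X_k$ and $c_{2k}=Z_1\cdots Z_{k-1}Y_k$ ($1\le k\le n$). For $\vec\alpha=(\alpha_1<\dots<\alpha_m)$ with entries in $[2n]=\{1,\dots,2n\}$ let $|\vec\alpha|=m$ and $C_{\vec\alpha}=c_{\alpha_1}\cdots c_{\alpha_m}$. Let $\|A\|^2=\operatorname{tr}(A^\dagger A)$. For a matrix $\mathbf u$ let $\mathbf u_{\vec\alpha\vec\beta}$ be the submatrix with rows $\vec\alpha$ and columns $\vec\beta$; $\mathbf u^{\mathrm T}_{\vec\beta\vec\alpha}$ is its transpose; $\mathbf P_{\vec\eta}$ is the diagonal projector onto the modes in $\vec\eta$; $\overline{\vec\eta}$ is the complement in $[2n]$. A matchgate circuit is a product of gates $G(V,W)$, $V,W\in SU(2)$, each acting on two neighbouring qubits, where $G(V,W)$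 acts as $V$ on $\operatorname{span}(|00\rangle,|11\rangle)$ and as $W$ on $\operatorname{span}(|01\rangle,|10\rangle)$. (1) Every matchgate circuit $U$ is unitary, and there is exactly one real matrix $\mathbf u$ with $$U^\dagger c_\mu U=\sum_{\nu=1}^{2n}u_{\mu\nu}c_\nu\qquad(1\le\mu\le 2n);\tag{$*$}$$ moreover $\mathbf u\in SO(2n)$. (2) Let $U$ be a matchgate circuit or, more generally, any unitary that satisfies $(*)$ with a real matrix $\mathbf u$. For every $\vec\alpha$ and every $s$ there is exactly one complex $3\times3$ matrix $\mathbf M_s$ such that $$\frac1{2^{n+2}}\big\|[\mathbf n\cdot\bm\sigma_s,\,U^\dagger C_{\vec\alpha}U]\big\|^2=\mathbf n^*\cdot\mathbf M_s\cdot\mathbf n\qquad\text{for all }\mathbf n\in\mathbb C^3,$$ and its entries are $$M_{xx}=\tfrac12\{1-(-1)^{|\vec\alpha|}\det[\mathbf u_{\vec\alpha[2n]}(\mathbf I-2\mathbf P_{[2s-1]})\mathbf u^{\mathrm T}_{[2n]\vec\alpha}]\},$$ $$M_{yy}=\tfrac12\{1-(-1)^{|\vec\alpha|}\det[\mathbf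 u_{\vec\alpha[2n]}(\mathbf I-2\mathbf P_{[2(s-1)]\cup(2s)})\mathbf u^{\mathrm T}_{[2n]\vec\alpha}]\},$$ $$M_{zz}=\tfrac12\{1-\det[\mathbf u_{\vec\alpha[2n]}(\mathbf I-2\mathbf P_{(2s-1,2s)})\mathbf u^{\mathrm T}_{[2n]\vec\alpha}]\},$$ $$M_{xy}=M_{yx}=\det\begin{pmatrix}0&\mathbf u^{\mathrm T}_{(2s)\vec\alpha}\\ \mathbf u_{\vec\alpha(2s-1)}&\mathbf u_{\vec\alpha R}\,(\mathbf I-2\mathbf P_{\overline{[2s]}})_{RR}\,\mathbf u^{\mathrm T}_{R\vec\alpha}\end{pmatrix},\qquad R=\overline{(2s-1,2s)},$$ $$M_{xz}=M_{zx}=M_{yz}=M_{zy}=0.$$ (3) The form is efficiently computable classically, in the model of random-access programs over exact complex arithmetic ($+,-,\times,\div$, conjugation, test for zero; additions, subtractions and comparisons of natural-number indices; bounded loops) with unit cost per step. There is one program that, from $n$, $s$, $\vec\alpha$, $\mathbf n$ and a real $2n\times 2n$ matrix $\mathbf u$, computes the matrix $\mathbf M_s$ given by the formulas in (2) and the value $\mathbf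 n^*\cdot\mathbf M_s\cdot\mathbf n$ in a number of steps polynomial in $n$; and there is one program that, from $n$, $s$, $\vec\alpha$, $\mathbf n$ and the list of $N$ gates (positions and entries of $V,W$) of a matchgate circuit $U$, computes $\mathbf M_s$ and $\frac1{2^{n+2}}\|[\mathbf n\cdot\bm\sigma_s,U^\dagger C_{\vec\alpha}U]\|^2$ in a number of steps polynomial in $n+N$. -/

import Mathlib

namespace MatchgateOTO

noncomputable section

open Matrix

/-! ### Operators on `n` qubits -/

/-- Operators on `n` qubits, as matrices in the computational basis `{0,1}^n`. -/
abbrev Op (n : ℕ) : Type := Matrix (Fin n → Fin 2) (Fin n → Fin 2) ℂ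

/-- The tensor product `A 0 ⊗ ⋯ ⊗ A (n-1)` of single-qubit operators. -/
def tensor {n : ℕ} (A : Fin n → Matrix (Fin 2) (Fin 2) ℂ) : Op n :=
  Matrix.of fun x y => ∏ j, A j (x j) (y j)

/-- The Pauli matrices; the labels `x, y, z` are `0, 1, 2`. -/
def pauli : Fin 3 → Matrix (Fin 2) (Fin 2) ℂ :=
  ![!![0, 1; 1, 0], !![0, -Complex.I; Complex.I, 0], !![1, 0; 0, -1]]

/-- The Pauli matrix `σ^a` acting on qubit `s`. -/
def pauliAt {n : ℕ} (s : Fin n) (a : Fin 3) : Op n :=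
  tensor (Function.update (fun _ => 1) s (pauli a))

/-- The single-site operator `v · σ_s`. -/
def siteOp {n : ℕ} (s : Fin n) (v : Fin 3 → ℂ) : Op n :=
  ∑ a, v a • pauliAt s a

/-- The Jordan-Wigner Majorana operators, numbered from `0`:
`c (2 k) = Z ⊗ ⋯ ⊗ Z ⊗ X_k ⊗ 1 ⊗ ⋯` and `c (2 k + 1) = Z ⊗ ⋯ ⊗ Z ⊗ Y_k ⊗ 1 ⊗ ⋯`
(qubits are numbered from `0` too). -/
def majorana {n : ℕ} (μ : Fin (2 * n)) : Op n :=
  tensor fun j =>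
    if (j : ℕ) < (μ : ℕ) / 2 then pauli 2
    else if (j : ℕ) = (μ : ℕ) / 2 then (if (μ : ℕ) % 2 = 0 then pauli 0 else pauli 1)
    else 1

/-- The Majorana configuration operator `C_α = c_{α_1} ⋯ c_{α_k}` of an increasing tuple `α`. -/
def configOp {n k : ℕ} (α : Fin k ↪o Fin (2 * n)) : Op n :=
  (List.ofFn fun t => majorana (α t)).prod

/-! ### Matchgate circuits -/

/-- The two-qubit matchgate `G(V, W)`: `V` acts on the span of `|00⟩, |11⟩`, and `W` on the span
of `|01⟩, |10⟩`. -/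
def matchgateMatrix (V W : Matrix (Fin 2) (Fin 2) ℂ) :
    Matrix (Fin 2 × Fin 2) (Fin 2 × Fin 2) ℂ :=
  Matrix.of fun p q =>
    if p.1 = p.2 ∧ q.1 = q.2 then V p.1 q.1
    else if p.1 ≠ p.2 ∧ q.1 ≠ q.2 then W p.1 q.1
    else 0

/-- A matchgate `G(V, W)` with `V, W ∈ SU(2)`, placed on the neighbouring qubits
`pos, pos + 1`. -/
structure Matchgate (n : ℕ) where
  pos : ℕ
  pos_lt : pos + 1 < n
  V : Matrix.specialUnitaryGroup (Fin 2) ℂ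
  W : Matrix.specialUnitaryGroup (Fin 2) ℂ

/-- The action of a placed matchgate on all `n` qubits. -/
def Matchgate.toOp {n : ℕ} (g : Matchgate n) : Op n :=
  Matrix.of fun x y =>
    let i : Fin n := ⟨g.pos, by have := g.pos_lt; omega⟩
    let j : Fin n := ⟨g.pos + 1, g.pos_lt⟩
    if ∀ l : Fin n, l ≠ i → l ≠ j → x l = y l then
      matchgateMatrix g.V.1 g.W.1 (x i, x j) (y i, y j)
    else 0

/-- The unitary of a circuit of nearest-neighbour matchgates. -/
def circuitOp {n : ℕ} (L : List (Matchgate n)) : Op n :=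
  (L.map Matchgate.toOp).prod

/-- `U† c_μ U = ∑_ν u_{μν} c_ν` for every mode `μ`. -/
def IsModeTransition {n : ℕ} (U : Op n) (u : Matrix (Fin (2 * n)) (Fin (2 * n)) ℝ) : Prop :=
  ∀ μ, Uᴴ * majorana μ * U = ∑ ν, (u μ ν : ℂ) • majorana ν

/-! ### The out-of-time-ordered correlator and its quadratic form -/

/-- `2^{-(n+2)} ‖[v · σ_s, U† C_α U]‖²` with the Frobenius norm `‖A‖² = tr (A† A)`. -/
def oto {n k : ℕ} (U : Op n) (α : Fin k ↪o Fin (2 * n)) (s : Fin n) (v : Fin 3 → ℂ) : ℂ :=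
  let K : Op n := ⁅siteOp s v, Uᴴ * configOp α * U⁆
  1 / 2 ^ (n + 2) * Matrix.trace (Kᴴ * K)

/-- The first Majorana mode of qubit `s`. -/
def modeX {n : ℕ} (s : Fin n) : Fin (2 * n) := ⟨2 * s, by omega⟩

/-- The second Majorana mode of qubit `s`. -/
def modeY {n : ℕ} (s : Fin n) : Fin (2 * n) := ⟨2 * s + 1, by omega⟩

/-- The matrix `I - 2 P_η`, where `P_η` is the projector onto the modes in `η`. -/
def reflection {m : ℕ} (η : Finset (Fin m)) : Matrix (Fin m) (Fin m) ℝ :=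
  1 - 2 • Matrix.diagonal fun μ => if μ ∈ η then 1 else 0

/-- `det [u_{α,[2n]} (I - 2 P_η) (u_{α,[2n]})ᵀ]`. -/
def reflDet {m k : ℕ} (u : Matrix (Fin m) (Fin m) ℝ) (α : Fin k ↪o Fin m)
    (η : Finset (Fin m)) : ℝ :=
  (u.submatrix α id * reflection η * (u.submatrix α id)ᵀ).det

/-- The modes other than the two modes of qubit `s`. -/
abbrev OtherMode {n : ℕ} (s : Fin n) : Type :=
  {μ : Fin (2 * n) // μ ≠ modeX s ∧ μ ≠ modeY s}

/-- The bordered determinant with first row `(0, u_{α, 2s}ᵀ)` and first column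
`(0, u_{α, 2s-1})` (modes and qubits counted from `1` here), and remaining block
`u_{α,R} (I - 2 P)_{R,R} (u_{α,R})ᵀ`, where `R` are the modes of the other qubits and `P`
projects onto the modes of the qubits to the right of `s`. -/
def borderedDet {n k : ℕ} (u : Matrix (Fin (2 * n)) (Fin (2 * n)) ℝ)
    (α : Fin k ↪o Fin (2 * n)) (s : Fin n) : ℝ :=
  let uR : Matrix (Fin k) (OtherMode s) ℝ := u.submatrix α Subtype.val
  let D : Matrix (OtherMode s) (OtherMode s) ℝ :=
    (reflection (Finset.univ.filter fun μ => modeY s < μ)).submatrix Subtype.val Subtype.val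
  (Matrix.fromBlocks (0 : Matrix (Fin 1) (Fin 1) ℝ)
    (Matrix.of fun _ t => u (α t) (modeY s))
    (Matrix.of fun t _ => u (α t) (modeX s))
    (uR * D * uRᵀ)).det

/-- The explicit matrix `M_s` (rows and columns in the order `x, y, z`). -/
def otoMatrix {n k : ℕ} (u : Matrix (Fin (2 * n)) (Fin (2 * n)) ℝ)
    (α : Fin k ↪o Fin (2 * n)) (s : Fin n) : Matrix (Fin 3) (Fin 3) ℝ :=
  let Mxx := 1 / 2 * (1 - (-1) ^ k * reflDet u α (Finset.univ.filter fun μ => μ ≤ modeX s))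
  let Myy := 1 / 2 * (1 - (-1) ^ k *
    reflDet u α (Finset.univ.filter fun μ => μ < modeX s ∨ μ = modeY s))
  let Mzz := 1 / 2 * (1 - reflDet u α {modeX s, modeY s})
  let Mxy := borderedDet u α s
  !![Mxx, Mxy, 0; Mxy, Myy, 0; 0, 0, Mzz]

/-! ### A uniform machine model with a step count

Random access programs over exact complex arithmetic. The memory consists of natural-number
registers, which serve as loop counters and addresses, and of two-dimensional arrays of complex
numbers. Naturals can only be added and subtracted, so their bit length grows at most linearly in
the number of steps. -/

/-- A memory: natural registers `idx r`, and complex arrays `val a` with entries `val a i j`. -/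
structure Memory where
  idx : ℕ → ℕ
  val : ℕ → ℕ → ℕ → ℂ

/-- The operand `arr[idx row, idx col]`. -/
structure Cell where
  arr : ℕ
  row : ℕ
  col : ℕ

def Memory.get (m : Memory) (c : Cell) : ℂ := m.val c.arr (m.idx c.row) (m.idx c.col)

def Memory.setIdx (m : Memory) (r x : ℕ) : Memory :=
  { m with idx := Function.update m.idx r x }

def Memory.set (m : Memory) (c : Cell) (z : ℂ) : Memory :=
  { m with
    val := fun a i j =>
      if a = c.arr ∧ i = m.idx c.row ∧ j = m.idx c.col then z else m.val a i j }

/-- Programs. The constants available are natural numbers for registers, and `0`, `1`, and the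
imaginary unit for cells. `loop r b p` executes `p` with register `r` set to `0, 1, …, B - 1`,
where `B` is the content of register `b` when the loop is entered. -/
inductive Program : Type
  | skip : Program
  | putIdx (r x : ℕ) : Program
  | addIdx (r a b : ℕ) : Program
  | subIdx (r a b : ℕ) : Program
  | putZero (d : Cell) : Program
  | putOne (d : Cell) : Program
  | putI (d : Cell) : Program
  | add (d a b : Cell) : Program
  | sub (d a b : Cell) : Program
  | mul (d a b : Cell) : Program
  | div (d a b : Cell) : Program
  | conj (d a : Cell) : Program
  | seq (p q : Program) : Program
  | ifLe (a b : ℕ) (p q : Program) : Program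
  | ifZero (a : Cell) (p q : Program) : Program
  | loop (r b : ℕ) (p : Program) : Program

open Classical in
/-- The memory after running a program, and the number of steps: every elementary instruction,
every test and every loop entry and loop round costs one step. -/
def Program.run : Program → Memory → Memory × ℕ
  | skip, m => (m, 1)
  | putIdx r x, m => (m.setIdx r x, 1)
  | addIdx r a b, m => (m.setIdx r (m.idx a + m.idx b), 1)
  | subIdx r a b, m => (m.setIdx r (m.idx a - m.idx b), 1)
  | putZero d, m => (m.set d 0, 1)
  | putOne d, m => (m.set d 1, 1)
  | putI d, m => (m.set d Complex.I, 1)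
  | add d a b, m => (m.set d (m.get a + m.get b), 1)
  | sub d a b, m => (m.set d (m.get a - m.get b), 1)
  | mul d a b, m => (m.set d (m.get a * m.get b), 1)
  | div d a b, m => (m.set d (m.get a / m.get b), 1)
  | conj d a, m => (m.set d (star (m.get a)), 1)
  | seq p q, m =>
      let r₁ := p.run m
      let r₂ := q.run r₁.1
      (r₂.1, r₁.2 + r₂.2)
  | ifLe a b p q, m =>
      let r := if m.idx a ≤ m.idx b then p.run m else q.run m
      (r.1, r.2 + 1)
  | ifZero a p q, m =>
      let r := if m.get a = 0 then p.run m else q.run m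
      (r.1, r.2 + 1)
  | loop r b p, m =>
      (List.range (m.idx b)).foldl
        (fun st t =>
          let res := p.run (st.1.setIdx r t)
          (res.1, st.2 + res.2 + 1))
        (m, 1)

/-- The characteristic vector of the configuration `α`. -/
def configVec {m k : ℕ} (α : Fin k ↪o Fin m) (j : ℕ) : ℂ :=
  if ∃ t, (α t : ℕ) = j then 1 else 0

/-- The vector `v`, followed by zeros. -/
def padVec (v : Fin 3 → ℂ) (j : ℕ) : ℂ :=
  if h : j < 3 then v ⟨j, h⟩ else 0

/-- A real square matrix, followed by zeros. -/
def padMatrix {m : ℕ} (u : Matrix (Fin m) (Fin m) ℝ) (i j : ℕ) : ℂ :=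
  if h : i < m ∧ j < m then (u ⟨i, h.1⟩ ⟨j, h.2⟩ : ℂ) else 0

/-- The four entries `A 00, A 01, A 10, A 11` of a two by two matrix, followed by zeros. -/
def flatten (A : Matrix (Fin 2) (Fin 2) ℂ) (j : ℕ) : ℂ :=
  if h : j < 4 then A ⟨j / 2, by omega⟩ ⟨j % 2, by omega⟩ else 0

/-- Input given by the transition matrix: registers `0, 1` hold `n, s`, array `0` holds `u`,
row `0` of array `1` marks the modes of `α`, row `0` of array `2` holds `v`. -/
def matrixInput {n k : ℕ} (u : Matrix (Fin (2 * n)) (Fin (2 * n)) ℝ)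
    (α : Fin k ↪o Fin (2 * n)) (s : Fin n) (v : Fin 3 → ℂ) : Memory where
  idx
    | 0 => n
    | 1 => s
    | _ => 0
  val
    | 0, i, j => padMatrix u i j
    | 1, 0, j => configVec α j
    | 2, 0, j => padVec v j
    | _, _, _ => 0

/-- Input given by the circuit: registers `0, 1, 2` hold `n, s` and the number of gates; row `t` of
array `0` marks the position of the gate number `t`, rows `t` of the arrays `3, 4` hold the
entries of its matrices `V, W`; row `0` of array `1` marks the modes of `α`, row `0` of
array `2` holds `v`. -/
def circuitInput {n k : ℕ} (L : List (Matchgate n))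
    (α : Fin k ↪o Fin (2 * n)) (s : Fin n) (v : Fin 3 → ℂ) : Memory where
  idx
    | 0 => n
    | 1 => s
    | 2 => L.length
    | _ => 0
  val
    | 0, t, j => if h : t < L.length then (if (L[t]).pos = j then 1 else 0) else 0
    | 1, 0, j => configVec α j
    | 2, 0, j => padVec v j
    | 3, t, j => if h : t < L.length then flatten (L[t]).V.1 j else 0
    | 4, t, j => if h : t < L.length then flatten (L[t]).W.1 j else 0
    | _, _, _ => 0

/-- The output three by three matrix is read from array `5`. -/
def outMatrix (m : Memory) : Matrix (Fin 3) (Fin 3) ℂ :=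
  Matrix.of fun a b => m.val 5 a b

/-- The output number is read from array `6`. -/
def outValue (m : Memory) : ℂ := m.val 6 0 0

/-- The form `v* · M · v`. -/
def quadForm (M : Matrix (Fin 3) (Fin 3) ℂ) (v : Fin 3 → ℂ) : ℂ :=
  star v ⬝ᵥ (M *ᵥ v)

end

end MatchgateOTO

/-!
Conjugating a product of Majorana operators by `U` replaces each factor by the linear combination
given by the corresponding row of `u`. Hence, if a Hermitian involution `A` acts on the span of the
Majorana operators by a matrix `F`, the trace of `OᴴAOA` with `O = UᴴC_αU` is, up to the factor
`2 ^ n`, the determinant of `u_α F u_αᵀ`. Expanding the squared commutator leaves the traces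
`tr (OᴴσᵃOσᵇ)`. For `a = b` the Pauli matrix acts on the modes by a reflection, up to sign. For
`{a, b} = {x, y}` one polarizes: the unit combinations `(σˣ ± σʸ) / √2` act linearly on the modes
too, and the difference of their determinants is a bordered determinant. If exactly one of `a, b`
is `z`, conjugation by the parity operator `Z ⊗ ⋯ ⊗ Z` changes the sign of the trace.

The Majorana operators of two neighbouring qubits exchange the even states `|00⟩, |11⟩` with the
odd states `|01⟩, |10⟩`, with blocks `X, Y, Z, i`. The real span of these blocks consists of the `B`
with `adj B = -Bᴴ` and is therefore invariant under `B ↦ Wᴴ B V` for `V, W` in `SU(2)`, which is how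
`G(V, W)` acts.

All determinants are read off the characteristic polynomial, which the Faddeev–LeVerrier iteration
computes in polynomially many steps. It divides by positive integers only, so that, unlike Gaussian
elimination, it needs no pivoting.
-/

namespace MatchgateOTO

noncomputable section

open Matrix

section FaddeevLeVerrier

open Polynomial

variable {ι : Type*} [Fintype ι] [DecidableEq ι]

section CommRing

variable {R : Type*} [CommRing R]

theorem derivative_det (M : Matrix ι ι R[X]) :
    derivative M.det = ∑ i, (M.updateRow i fun j => derivative (M i j)).det := by
  rw [← det_transpose M]
  simp_rw [← det_transpose (M.updateRow _ _), det_apply, derivative_sum]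
  rw [Finset.sum_comm]
  refine Finset.sum_congr rfl fun σ _ => ?_
  rw [Units.smul_def, derivative_smul, derivative_prod_finset, Finset.smul_sum]
  refine Finset.sum_congr rfl fun i _ => ?_
  rw [Units.smul_def, ← Finset.mul_prod_erase _ _ (Finset.mem_univ i), mul_comm]
  have herase : ∀ j ∈ Finset.univ.erase i,
      M.updateRow i (fun l => derivative (M i l)) j = M j :=
    fun j hj => updateRow_ne (Finset.ne_of_mem_erase hj)
  simp only [transpose_apply, updateRow_self]
  rw [Finset.prod_congr rfl fun j hj => congrFun (herase j hj) (σ j)]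

theorem derivative_charpoly (A : Matrix ι ι R) :
    derivative A.charpoly = A.charmatrix.adjugate.trace := by
  rw [charpoly, derivative_det, trace]
  refine Finset.sum_congr rfl fun i _ => ?_
  rw [diag_apply, adjugate_apply]
  congr 2
  ext j : 1
  obtain rfl | hij := eq_or_ne i j
  · simp
  · simp [hij, hij.symm]

/-- The coefficient of `X ^ k` in the adjugate of the characteristic matrix `X - A`; these are the
matrices that the Faddeev–LeVerrier iteration runs through. -/
def adjugateCoeff (A : Matrix ι ι R) (k : ℕ) : Matrix ι ι R :=
  (matPolyEquiv A.charmatrix.adjugate).coeff k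

theorem X_sub_C_mul_matPolyEquiv_adjugate (A : Matrix ι ι R) :
    (X - C A) * matPolyEquiv A.charmatrix.adjugate =
      A.charpoly.map (algebraMap R (Matrix ι ι R)) := by
  rw [← matPolyEquiv_charmatrix, ← map_mul, mul_adjugate, ← charpoly, matPolyEquiv_smul_one]

theorem adjugateCoeff_eq_mul_add (A : Matrix ι ι R) (k : ℕ) :
    adjugateCoeff A k = A * adjugateCoeff A (k + 1) + A.charpoly.coeff (k + 1) • 1 := by
  have h := congrArg (coeff · (k + 1)) (X_sub_C_mul_matPolyEquiv_adjugate A)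
  simp only [sub_mul, coeff_sub, coeff_X_mul, coeff_C_mul, coeff_map] at h
  rw [← Algebra.algebraMap_eq_smul_one]
  exact sub_eq_iff_eq_add'.1 h

theorem mul_adjugateCoeff_zero (A : Matrix ι ι R) :
    A * adjugateCoeff A 0 = -(A.charpoly.coeff 0 • 1) := by
  have h := congrArg (coeff · 0) (X_sub_C_mul_matPolyEquiv_adjugate A)
  simp only [sub_mul, coeff_sub, coeff_X_mul_zero, coeff_C_mul, coeff_map, zero_sub] at h
  rw [← Algebra.algebraMap_eq_smul_one, ← h, neg_neg]
  rfl

theorem adjugateCoeff_card (A : Matrix ι ι R) : adjugateCoeff A (Fintype.card ι) = 0 := by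
  cases subsingleton_or_nontrivial (Matrix ι ι R)
  · exact Subsingleton.elim _ _
  have : Nontrivial R := Module.nontrivial R (Matrix ι ι R)
  by_cases hadj : matPolyEquiv A.charmatrix.adjugate = 0
  · rw [adjugateCoeff, hadj, coeff_zero]
  refine coeff_eq_zero_of_natDegree_lt ?_
  have hdeg := congrArg natDegree (X_sub_C_mul_matPolyEquiv_adjugate A)
  rw [(monic_X_sub_C A).natDegree_mul' hadj, natDegree_X_sub_C,
    A.charpoly_monic.natDegree_map, charpoly_natDegree_eq_dim] at hdeg
  omega

theorem trace_adjugateCoeff (A : Matrix ι ι R) (k : ℕ) :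
    (adjugateCoeff A k).trace = (k + 1) * A.charpoly.coeff (k + 1) := by
  have h := congrArg (coeff · k) (derivative_charpoly A)
  simp only [coeff_derivative, trace, finsetSum_coeff, diag_apply] at h
  simp only [trace, diag_apply, adjugateCoeff, matPolyEquiv_coeff_apply]
  rw [← h, mul_comm]

theorem trace_mul_adjugateCoeff (A : Matrix ι ι R) (k : ℕ) :
    (A * adjugateCoeff A k).trace = (k - Fintype.card ι) * A.charpoly.coeff k := by
  cases k with
  | zero => simp [mul_adjugateCoeff_zero, trace_one, mul_comm]
  | succ k =>
    have h := congrArg trace (adjugateCoeff_eq_mul_add A k)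
    rw [trace_adjugateCoeff, trace_add, trace_smul, trace_one, smul_eq_mul] at h
    push_cast
    linear_combination -h

end CommRing

section Field

variable {K : Type*} [Field K]

/-- The Faddeev–LeVerrier iteration: after `t` rounds it holds the coefficient of
`X ^ (N - t)` in the adjugate of `X - A` and in the characteristic polynomial of `A`, where `N` is
the size of `A`. It uses no pivoting, so it runs as a loop without tests. -/
def faddeevLeVerrier (A : Matrix ι ι K) : ℕ → Matrix ι ι K × K
  | 0 => (0, 1)
  | t + 1 =>
    let M := A * (faddeevLeVerrier A t).1 + (faddeevLeVerrier A t).2 • 1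
    (M, -(A * M).trace / (t + 1))

theorem faddeevLeVerrier_eq [CharZero K] (A : Matrix ι ι K) {t k : ℕ}
    (h : k + t = Fintype.card ι) :
    faddeevLeVerrier A t = (adjugateCoeff A k, A.charpoly.coeff k) := by
  induction t generalizing k with
  | zero =>
    obtain rfl : k = Fintype.card ι := h
    have hlead := A.charpoly_monic.coeff_natDegree
    rw [charpoly_natDegree_eq_dim] at hlead
    rw [faddeevLeVerrier, adjugateCoeff_card, hlead]
  | succ t ih =>
    have ht : (t + 1 : K) ≠ 0 := Nat.cast_add_one_ne_zero t
    have hcard : (Fintype.card ι : K) = k + (t + 1) := by rw [← h]; push_cast; rfl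
    simp only [faddeevLeVerrier, ih (k := k + 1) (by omega), ← adjugateCoeff_eq_mul_add,
      Prod.mk.injEq, true_and]
    rw [trace_mul_adjugateCoeff, hcard, div_eq_iff ht]
    ring

theorem faddeevLeVerrier_neg_card [CharZero K] (A : Matrix ι ι K) :
    (faddeevLeVerrier (-A) (Fintype.card ι)).2 = A.det := by
  rw [faddeevLeVerrier_eq (-A) (zero_add _)]
  have h := det_eq_sign_charpoly_coeff (-A)
  rw [det_neg] at h
  exact (mul_left_cancel₀ (pow_ne_zero _ (neg_ne_zero.2 one_ne_zero)) h).symm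

end Field

end FaddeevLeVerrier

section BorderedDeterminants

variable {R : Type*} [CommRing R] {ι κ : Type*} [Fintype ι] [DecidableEq ι] [Fintype κ]
  [DecidableEq κ]

theorem det_eq_det_submatrix_of_row_eq_one (M : Matrix ι ι R) {f : κ → ι}
    (hf : Function.Injective f) (h : ∀ i ∉ Set.range f, M i = (1 : Matrix ι ι R) i) :
    M.det = (M.submatrix f f).det := by
  classical
  rw [twoBlockTriangular_det M (fun i => i ∈ Set.range f)]
  · have hone : (M.toSquareBlockProp fun i => i ∉ Set.range f) = 1 := by
      ext ⟨i, hi⟩ ⟨j, hj⟩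
      simp [toSquareBlockProp, h i hi, one_apply]
    rw [hone, det_one, mul_one]
    convert (det_submatrix_equiv_self (Equiv.ofInjective f hf)
      (M.toSquareBlockProp fun i => i ∈ Set.range f)).symm
    rfl
  · intro i hi j hj
    rw [h i hi, one_apply_ne]
    rintro rfl
    exact hi hj

/-- The matrix `B` bordered by the column `a`, the row `b` and the corner entry `0`. -/
def bordered (a b : ι → R) (B : Matrix ι ι R) : Matrix (Fin 1 ⊕ ι) (Fin 1 ⊕ ι) R :=
  fromBlocks 0 (of fun _ => b) (of fun i _ => a i) B

theorem det_bordered_neg_right (a b : ι → R) (B : Matrix ι ι R) :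
    (bordered a (-b) B).det = -(bordered a b B).det := by
  have hrow : bordered a (-b) B =
      (bordered a b B).updateRow (Sum.inl 0) (-(bordered a b B (Sum.inl 0))) := by
    ext (i | i) (j | j) <;> simp [bordered, updateRow_apply, Fin.fin_one_eq_zero]
  rw [hrow, ← neg_one_smul R, det_updateRow_smul, updateRow_eq_self, neg_one_mul]

theorem det_bordered_swap {B : Matrix ι ι R} (hB : Bᵀ = B) (a b : ι → R) :
    (bordered b a B).det = (bordered a b B).det := by
  rw [← det_transpose]
  congr 1
  rw [bordered, bordered, fromBlocks_transpose, hB, transpose_zero]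
  rfl

theorem det_add_vecMulVec (a b : ι → R) (B : Matrix ι ι R) :
    (B + vecMulVec a b).det = B.det - (bordered a b B).det := by
  set E : Matrix (Fin 1 ⊕ ι) (Fin 1 ⊕ ι) R :=
    fromBlocks 1 (of fun _ => -b) (of fun i _ => a i) B with hE
  have hschur : E.det = (B + vecMulVec a b).det := by
    rw [hE, det_fromBlocks_one₁₁]
    congr 1
    ext i j
    simp [mul_apply, vecMulVec_apply]
  have hsplit : E.det = (fromBlocks 1 0 (of fun i (_ : Fin 1) => a i) B).det +
      (bordered a (-b) B).det := by
    have hrow : E =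
        E.updateRow (Sum.inl 0)
          (Sum.elim (fun _ => 1) (fun _ => 0) + Sum.elim (fun _ => 0) (-b)) := by
      ext (i | i) (j | j) <;> simp [E, updateRow_apply, Fin.fin_one_eq_zero]
    rw [hrow, det_updateRow_add]
    congr 2 <;> ext (i | i) (j | j) <;>
      simp [E, bordered, updateRow_apply, one_apply, Fin.fin_one_eq_zero]
  rw [← hschur, hsplit, det_fromBlocks_zero₁₂, det_one, one_mul, det_bordered_neg_right]
  ring

theorem det_sub_vecMulVec (a b : ι → R) (B : Matrix ι ι R) :
    (B - vecMulVec a b).det = B.det + (bordered a b B).det := by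
  have h := det_add_vecMulVec a (-b) B
  rw [vecMulVec_neg, ← sub_eq_add_neg, det_bordered_neg_right] at h
  rw [h, sub_neg_eq_add]

theorem det_add_sub_det_sub_eq_bordered {B : Matrix ι ι R} (hB : Bᵀ = B) (a b : ι → R) :
    (B + (vecMulVec a b + vecMulVec b a)).det - (B - (vecMulVec a b + vecMulVec b a)).det =
      -4 * (bordered a b B).det := by
  have hplus : bordered b a (B + vecMulVec a b) =
      bordered b a B + vecMulVec (Sum.elim 0 a) (Sum.elim 0 b) := by
    ext (i | i) (j | j) <;> simp [bordered, vecMulVec_apply]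
  have hminus : bordered b a (B - vecMulVec a b) =
      bordered b a B - vecMulVec (Sum.elim 0 a) (Sum.elim 0 b) := by
    ext (i | i) (j | j) <;> simp [bordered, vecMulVec_apply]
  rw [← add_assoc, ← sub_sub, det_add_vecMulVec b a, det_sub_vecMulVec b a, hplus, hminus,
    det_add_vecMulVec, det_add_vecMulVec, det_sub_vecMulVec, det_sub_vecMulVec,
    det_bordered_swap hB]
  ring

end BorderedDeterminants

section Tensor

variable {n : ℕ}

theorem tensor_mul (A B : Fin n → Matrix (Fin 2) (Fin 2) ℂ) :
    tensor A * tensor B = tensor fun j => A j * B j := by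
  ext x y
  simp only [tensor, mul_apply, of_apply, ← Finset.prod_mul_distrib]
  rw [Finset.prod_univ_sum, Fintype.piFinset_univ]

theorem tensor_one : tensor (fun _ : Fin n => (1 : Matrix (Fin 2) (Fin 2) ℂ)) = 1 := by
  ext x y
  simp only [tensor, of_apply, one_apply, Finset.prod_ite_zero, Finset.prod_const_one,
    Finset.mem_univ, true_imp_iff, funext_iff]

theorem conjTranspose_tensor (A : Fin n → Matrix (Fin 2) (Fin 2) ℂ) :
    (tensor A)ᴴ = tensor fun j => (A j)ᴴ := by
  ext x y
  simp only [tensor, conjTranspose_apply, of_apply, star_prod]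

theorem tensor_update_apply (A : Fin n → Matrix (Fin 2) (Fin 2) ℂ) (i : Fin n)
    (B : Matrix (Fin 2) (Fin 2) ℂ) (x y : Fin n → Fin 2) :
    tensor (Function.update A i B) x y =
      B (x i) (y i) * ∏ j ∈ Finset.univ.erase i, A j (x j) (y j) := by
  rw [tensor, of_apply, ← Finset.mul_prod_erase _ _ (Finset.mem_univ i), Function.update_self]
  congr 1
  refine Finset.prod_congr rfl fun j hj => ?_
  rw [Function.update_of_ne (Finset.ne_of_mem_erase hj)]

theorem tensor_update_add (A : Fin n → Matrix (Fin 2) (Fin 2) ℂ) (i : Fin n)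
    (B C : Matrix (Fin 2) (Fin 2) ℂ) :
    tensor (Function.update A i (B + C)) =
      tensor (Function.update A i B) + tensor (Function.update A i C) := by
  ext x y
  simp only [Matrix.add_apply, tensor_update_apply, add_mul]

theorem tensor_update_smul (A : Fin n → Matrix (Fin 2) (Fin 2) ℂ) (i : Fin n) (z : ℂ)
    (B : Matrix (Fin 2) (Fin 2) ℂ) :
    tensor (Function.update A i (z • B)) = z • tensor (Function.update A i B) := by
  ext x y
  simp only [Matrix.smul_apply, tensor_update_apply, smul_eq_mul, mul_assoc]

theorem tensor_mul_eq_neg_of_anticomm_at {A B : Fin n → Matrix (Fin 2) (Fin 2) ℂ} (i : Fin n)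
    (hcomm : ∀ j ≠ i, A j * B j = B j * A j) (hanti : A i * B i = -(B i * A i)) :
    tensor A * tensor B = -(tensor B * tensor A) := by
  have hfactors : (fun j => A j * B j) =
      Function.update (fun j => B j * A j) i ((-1 : ℂ) • (B i * A i)) := by
    funext j
    obtain rfl | hj := eq_or_ne j i
    · rw [Function.update_self, hanti, neg_one_smul]
    · rw [Function.update_of_ne hj, hcomm j hj]
  rw [tensor_mul, tensor_mul, hfactors, tensor_update_smul, Function.update_eq_self, neg_one_smul]

end Tensor

section Majorana

variable {n : ℕ}

theorem pauli_mul_self (a : Fin 3) : pauli a * pauli a = 1 := by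
  fin_cases a <;> ext i j <;> fin_cases i <;> fin_cases j <;> simp [pauli, mul_apply]

theorem pauli_anticomm {a b : Fin 3} (h : a ≠ b) : pauli a * pauli b = -(pauli b * pauli a) := by
  fin_cases a <;> fin_cases b <;> first
    | exact absurd rfl h
    | (ext i j; fin_cases i <;> fin_cases j <;> simp [pauli, mul_apply])

theorem conjTranspose_pauli (a : Fin 3) : (pauli a)ᴴ = pauli a := by
  fin_cases a <;> ext i j <;> fin_cases i <;> fin_cases j <;> simp [pauli]

/-- The tensor factor at qubit `j` of the Majorana operator number `μ`. -/
def majoranaFactor (μ j : ℕ) : Matrix (Fin 2) (Fin 2) ℂ :=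
  if j < μ / 2 then pauli 2
  else if j = μ / 2 then (if μ % 2 = 0 then pauli 0 else pauli 1)
  else 1

theorem majorana_eq_tensor (μ : Fin (2 * n)) :
    majorana μ = tensor fun j : Fin n => majoranaFactor μ j := rfl

theorem majoranaFactor_of_lt {μ j : ℕ} (h : j < μ / 2) : majoranaFactor μ j = pauli 2 := by
  rw [majoranaFactor, if_pos h]

theorem majoranaFactor_of_gt {μ j : ℕ} (h : μ / 2 < j) : majoranaFactor μ j = 1 := by
  rw [majoranaFactor, if_neg (by omega), if_neg (by omega)]

theorem majoranaFactor_even (j : ℕ) : majoranaFactor (2 * j) j = pauli 0 := by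
  rw [majoranaFactor, if_neg (by omega), if_pos (by omega), if_pos (by omega)]

theorem majoranaFactor_odd (j : ℕ) : majoranaFactor (2 * j + 1) j = pauli 1 := by
  rw [majoranaFactor, if_neg (by omega), if_pos (by omega), if_neg (by omega)]

theorem majorana_mul_self (μ : Fin (2 * n)) : majorana μ * majorana μ = 1 := by
  rw [majorana_eq_tensor, tensor_mul, ← tensor_one]
  congr 1
  funext j
  unfold majoranaFactor
  split_ifs
  exacts [pauli_mul_self 2, pauli_mul_self 0, pauli_mul_self 1, one_mul 1]

theorem conjTranspose_majorana (μ : Fin (2 * n)) : (majorana μ)ᴴ = majorana μ := by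
  rw [majorana_eq_tensor, conjTranspose_tensor]
  congr 1
  funext j
  unfold majoranaFactor
  split_ifs
  exacts [conjTranspose_pauli 2, conjTranspose_pauli 0, conjTranspose_pauli 1,
    conjTranspose_one]

theorem majorana_anticomm_of_lt {μ ν : Fin (2 * n)} (h : (μ : ℕ) < ν) :
    majorana μ * majorana ν = -(majorana ν * majorana μ) := by
  -- the two operators differ by a sign exactly at the qubit that carries the mode `μ`
  refine tensor_mul_eq_neg_of_anticomm_at ⟨μ / 2, by omega⟩ (fun j hj => ?_) ?_
  · change majoranaFactor μ j * majoranaFactor ν j = majoranaFactor ν j * majoranaFactor μ j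
    rcases lt_or_gt_of_ne (fun hj' => hj (Fin.ext hj') : (j : ℕ) ≠ μ / 2) with hlt | hgt
    · rw [majoranaFactor_of_lt hlt, majoranaFactor_of_lt (by omega)]
    · rw [majoranaFactor_of_gt hgt, one_mul, mul_one]
  · change majoranaFactor μ (μ / 2) * majoranaFactor ν (μ / 2) =
      -(majoranaFactor ν (μ / 2) * majoranaFactor μ (μ / 2))
    rcases (show (μ : ℕ) / 2 ≤ ν / 2 by omega).lt_or_eq with hlt | heq
    · rw [majoranaFactor_of_lt hlt]
      rcases Nat.even_or_odd' (μ : ℕ) with ⟨j, hj | hj⟩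
      · rw [hj, Nat.mul_div_cancel_left j two_pos, majoranaFactor_even]
        exact pauli_anticomm (by decide)
      · rw [hj, show (2 * j + 1) / 2 = j by omega, majoranaFactor_odd]
        exact pauli_anticomm (by decide)
    · have hμ : (μ : ℕ) = 2 * (μ / 2) := by omega
      have hν : (ν : ℕ) = 2 * (μ / 2) + 1 := by omega
      generalize (μ : ℕ) / 2 = j at hμ hν ⊢
      rw [hμ, hν, majoranaFactor_even, majoranaFactor_odd]
      exact pauli_anticomm (by decide)

theorem majorana_anticomm {μ ν : Fin (2 * n)} (h : μ ≠ ν) :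
    majorana μ * majorana ν = -(majorana ν * majorana μ) := by
  rcases lt_or_gt_of_ne h with h | h
  · exact majorana_anticomm_of_lt h
  · rw [majorana_anticomm_of_lt h, neg_neg]

theorem trace_mul_eq_zero_of_anticomm {ι : Type*} [Fintype ι] {A B : Matrix ι ι ℂ}
    (h : A * B = -(B * A)) : trace (A * B) = 0 := by
  have hneg : trace (A * B) = -trace (A * B) := by
    conv_lhs => rw [h, trace_neg, trace_mul_comm]
  exact self_eq_neg.1 hneg

theorem trace_one_op : trace (1 : Op n) = 2 ^ n := by
  simp [trace_one]

theorem trace_majorana_mul (μ ν : Fin (2 * n)) :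
    trace (majorana μ * majorana ν) = if μ = ν then (2 : ℂ) ^ n else 0 := by
  split_ifs with h
  · rw [h, majorana_mul_self, trace_one_op]
  · exact trace_mul_eq_zero_of_anticomm (majorana_anticomm h)

/-- The real linear combination of the Majorana operators with coefficient vector `w`. -/
def modeComb (w : Fin (2 * n) → ℝ) : Op n := ∑ μ, (w μ : ℂ) • majorana μ

theorem modeComb_add (v w : Fin (2 * n) → ℝ) : modeComb (v + w) = modeComb v + modeComb w := by
  simp only [modeComb, Pi.add_apply, Complex.ofReal_add, add_smul, Finset.sum_add_distrib]

theorem modeComb_single (μ : Fin (2 * n)) (x : ℝ) :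
    modeComb (Pi.single μ x) = (x : ℂ) • majorana μ := by
  rw [modeComb, Finset.sum_eq_single μ _ (by simp)]
  · rw [Pi.single_eq_same]
  · intro ν _ hν
    rw [Pi.single_eq_of_ne hν, Complex.ofReal_zero, zero_smul]

theorem trace_modeComb_mul_modeComb (v w : Fin (2 * n) → ℝ) :
    trace (modeComb v * modeComb w) = 2 ^ n * ((v ⬝ᵥ w : ℝ) : ℂ) := by
  simp only [modeComb, Finset.sum_mul, Finset.mul_sum, trace_sum, Matrix.smul_mul,
    Matrix.mul_smul, trace_smul, trace_majorana_mul, smul_eq_mul, mul_ite, mul_zero,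
    Finset.sum_ite_eq', Finset.mem_univ, if_true, dotProduct,
    Complex.ofReal_sum, Complex.ofReal_mul]
  exact Finset.sum_congr rfl fun μ _ => by ring

theorem modeComb_injective : Function.Injective (modeComb (n := n)) := by
  intro v w h
  funext μ
  have htrace := congrArg (fun A => trace (modeComb (Pi.single μ 1) * A)) h
  simp only [trace_modeComb_mul_modeComb, single_one_dotProduct] at htrace
  exact_mod_cast mul_left_cancel₀ (pow_ne_zero n two_ne_zero) htrace

end Majorana

section AnticommutingProducts

variable {R : Type*} [Ring R] {k : ℕ}

theorem mul_prod_ofFn_of_forall_mul_eq_zsmul {c : R} {a : Fin k → R} {ε : Fin k → ℤ}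
    (h : ∀ t, c * a t = ε t • (a t * c)) :
    c * (List.ofFn a).prod = (∏ t, ε t) • ((List.ofFn a).prod * c) := by
  induction k with
  | zero => simp
  | succ k ih =>
    rw [List.ofFn_succ, List.prod_cons, Fin.prod_univ_succ, ← mul_assoc, h, smul_mul_assoc,
      mul_assoc, ih fun t => h t.succ]
    simp only [mul_smul_comm, mul_smul, mul_assoc]

theorem conj_prod_ofFn {A B : R} (hAB : A * B = 1) (hBA : B * A = 1) (a : Fin k → R) :
    A * (List.ofFn a).prod * B = (List.ofFn fun t => A * a t * B).prod := by
  induction k with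
  | zero => simpa using hAB
  | succ k ih =>
    rw [List.ofFn_succ, List.ofFn_succ, List.prod_cons, List.prod_cons, ← ih]
    simp only [mul_assoc]
    rw [← mul_assoc B A, hBA, one_mul]

theorem prod_ofFn_comp_swap_castSucc_succ (i : Fin k) {a : Fin (k + 1) → R}
    (h : a i.succ * a i.castSucc = -(a i.castSucc * a i.succ)) :
    (List.ofFn (a ∘ Equiv.swap i.castSucc i.succ)).prod = -(List.ofFn a).prod := by
  induction k with
  | zero => exact i.elim0
  | succ k ih =>
    cases i using Fin.cases with
    | zero =>
      have hfix (t : Fin k) : Equiv.swap (0 : Fin (k + 2)) 1 t.succ.succ = t.succ.succ :=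
        Equiv.swap_apply_of_ne_of_ne (Fin.succ_ne_zero _)
          fun h => Fin.succ_ne_zero _ (Fin.succ_injective _ h)
      simp only [Fin.castSucc_zero, Fin.succ_zero_eq_one, List.ofFn_succ, Function.comp_apply,
        Equiv.swap_apply_left, Equiv.swap_apply_right, hfix, List.prod_cons, ← mul_assoc] at h ⊢
      rw [h, neg_mul]
    | succ i =>
      have hzero : Equiv.swap i.succ.castSucc i.succ.succ 0 = 0 :=
        Equiv.swap_apply_of_ne_of_ne (Fin.succ_ne_zero i.castSucc).symm
          (Fin.succ_ne_zero i.succ).symm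
      have htail : (fun t => (a ∘ Equiv.swap i.succ.castSucc i.succ.succ) t.succ) =
          (fun t => a t.succ) ∘ Equiv.swap i.castSucc i.succ :=
        funext fun t => congrArg a ((Fin.succ_injective _).swap_apply i.castSucc i.succ t)
      rw [List.ofFn_succ, List.ofFn_succ (f := a), List.prod_cons, List.prod_cons, htail,
        Function.comp_apply, hzero, ih i (a := fun t => a t.succ) h, mul_neg]

theorem prod_ofFn_comp_perm (σ : Equiv.Perm (Fin k)) {a : Fin k → R}
    (ha : Pairwise fun s t => a s * a t = -(a t * a s)) :
    (List.ofFn (a ∘ σ)).prod = (Equiv.Perm.sign σ : ℤ) • (List.ofFn a).prod := by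
  cases k with
  | zero => simp [Subsingleton.elim σ 1]
  | succ k =>
    have hσ : σ ∈ Submonoid.closure
        (Set.range fun i : Fin k => Equiv.swap i.castSucc i.succ) := by
      rw [Equiv.Perm.mclosure_swap_castSucc_succ]
      trivial
    induction hσ using Submonoid.closure_induction generalizing a with
    | one => simp
    | mem σ hσ =>
      obtain ⟨i, rfl⟩ := hσ
      rw [prod_ofFn_comp_swap_castSucc_succ i (ha (Fin.castSucc_lt_succ (i := i)).ne'),
        Equiv.Perm.sign_swap (Fin.castSucc_lt_succ).ne, Units.val_neg, Units.val_one,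
        neg_one_zsmul]
    | mul σ τ _ _ hσ hτ =>
      rw [Equiv.Perm.coe_mul, ← Function.comp_assoc,
        hτ (a := a ∘ σ) fun s t hst => ha (σ.injective.ne hst), hσ ha, smul_smul,
        Equiv.Perm.sign_mul, mul_comm, Units.val_mul]

theorem prod_ofFn_sum_smul {S ι : Type*} [CommSemiring S] [Algebra S R] [Fintype ι]
    (G : Fin k → ι → S) (c : ι → R) :
    (List.ofFn fun t => ∑ ν, G t ν • c ν).prod =
      ∑ f : Fin k → ι, (∏ t, G t (f t)) • (List.ofFn (c ∘ f)).prod := by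
  classical
  have h := (MultilinearMap.mkPiAlgebraFin S k R).map_sum fun t ν => G t ν • c ν
  simp only [MultilinearMap.map_smul_univ, MultilinearMap.mkPiAlgebraFin_apply] at h
  exact h

end AnticommutingProducts

section ConfigOp

variable {n k : ℕ}

theorem conjTranspose_configOp_mul_self (α : Fin k ↪o Fin (2 * n)) :
    (configOp α)ᴴ * configOp α = 1 := by
  have h : configOp α ∈ unitary (Op n) := by
    refine Submonoid.list_prod_mem _ fun x hx => ?_
    obtain ⟨t, rfl⟩ := (List.mem_ofFn' _ _).1 hx
    rw [Unitary.mem_iff, star_eq_conjTranspose, conjTranspose_majorana, majorana_mul_self]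
    exact ⟨rfl, rfl⟩
  exact (Unitary.mem_iff.1 h).1

theorem majorana_mul_prod_ofFn (μ : Fin (2 * n)) (f : Fin k → Fin (2 * n)) :
    majorana μ * (List.ofFn (majorana ∘ f)).prod =
      (∏ t, if f t = μ then 1 else -1 : ℤ) • ((List.ofFn (majorana ∘ f)).prod * majorana μ) := by
  refine mul_prod_ofFn_of_forall_mul_eq_zsmul fun t => ?_
  rw [Function.comp_apply]
  split_ifs with h
  · rw [h, one_smul]
  · rw [majorana_anticomm (Ne.symm h), neg_one_zsmul]

theorem majorana_mul_configOp (α : Fin k ↪o Fin (2 * n)) (s : Fin k) :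
    majorana (α s) * configOp α = (-(-1) ^ k : ℤ) • (configOp α * majorana (α s)) := by
  have hsign (t : Fin k) : (if α t = α s then 1 else -1 : ℤ) = -1 * if t = s then -1 else 1 := by
    by_cases h : t = s <;> simp [h]
  refine (majorana_mul_prod_ofFn (α s) α).trans ?_
  simp only [hsign, Finset.prod_mul_distrib, Finset.prod_ite_eq', Finset.prod_const,
    Finset.mem_univ, if_true, Finset.card_univ, Fintype.card_fin, mul_neg_one]
  rfl

theorem conjTranspose_configOp_mul_majorana (α : Fin k ↪o Fin (2 * n)) (s : Fin k) :
    (configOp α)ᴴ * majorana (α s) = (-(-1) ^ k : ℤ) • (majorana (α s) * (configOp α)ᴴ) := by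
  have h := congrArg conjTranspose (majorana_mul_configOp α s)
  simpa only [conjTranspose_smul, conjTranspose_mul, conjTranspose_majorana, star_trivial] using h

theorem trace_configOp_mul_prod_of_forall_ne (α : Fin k ↪o Fin (2 * n)) (s : Fin k)
    {f : Fin k → Fin (2 * n)} (hf : ∀ t, f t ≠ α s) :
    trace ((configOp α)ᴴ * (List.ofFn (majorana ∘ f)).prod) = 0 := by
  set P := (List.ofFn (majorana ∘ f)).prod
  set c := majorana (α s)
  have hc : c * c = 1 := majorana_mul_self _
  have hP : c * P = ((-1) ^ k : ℤ) • (P * c) := by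
    rw [majorana_mul_prod_ofFn]
    simp only [hf, if_false, Finset.prod_const, Finset.card_univ, Fintype.card_fin, P, c]
  have hanti : c * ((configOp α)ᴴ * P * c) = -((configOp α)ᴴ * P * c * c) := by
    have hC : (configOp α)ᴴ * c = (-(-1) ^ k : ℤ) • (c * (configOp α)ᴴ) :=
      conjTranspose_configOp_mul_majorana α s
    rcases neg_one_pow_eq_or ℤ k with hk | hk <;>
      simp only [hk, neg_neg, one_zsmul, neg_one_zsmul] at hP hC
    · rw [← mul_assoc, ← mul_assoc, neg_eq_iff_eq_neg.1 hC.symm, neg_mul, mul_assoc _ c P, hP]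
      simp only [mul_assoc, neg_mul]
    · rw [← mul_assoc, ← mul_assoc, ← hC, mul_assoc _ c P, hP]
      simp only [mul_assoc, neg_mul, mul_neg]
  have htrace := trace_mul_eq_zero_of_anticomm hanti
  rwa [trace_mul_comm, mul_assoc, hc, mul_one] at htrace

theorem exists_forall_ne_of_forall_ne_comp_perm {ι κ : Type*} [Finite ι] {a f : ι → κ}
    (hf : ∀ σ : Equiv.Perm ι, f ≠ a ∘ σ) (ha : Function.Injective a) : ∃ s, ∀ t, f t ≠ a s := by
  by_contra! h
  choose g hg using h
  have hginj : Function.Injective g := fun s t hst => ha <| by rw [← hg s, ← hg t, hst]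
  let τ : Equiv.Perm ι := Equiv.ofBijective g (Finite.injective_iff_bijective.1 hginj)
  exact hf τ.symm <| funext fun t => by
    have := hg (τ.symm t)
    rwa [show g (τ.symm t) = t from τ.apply_symm_apply t] at this

theorem trace_configOp_mul_prod_comp_perm (α : Fin k ↪o Fin (2 * n)) (σ : Equiv.Perm (Fin k)) :
    trace ((configOp α)ᴴ * (List.ofFn (majorana ∘ α ∘ σ)).prod) =
      2 ^ n * ((Equiv.Perm.sign σ : ℤ) : ℂ) := by
  have hprod : (List.ofFn (majorana ∘ α ∘ σ)).prod =
      (Equiv.Perm.sign σ : ℤ) • configOp α :=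
    prod_ofFn_comp_perm σ (a := majorana ∘ α) fun s t hst =>
      majorana_anticomm (α.injective.ne hst)
  rw [hprod, mul_smul_comm, conjTranspose_configOp_mul_self, trace_smul, trace_one_op,
    zsmul_eq_mul, mul_comm]

theorem trace_configOp_mul_prod_modeComb (α : Fin k ↪o Fin (2 * n))
    (G : Fin k → Fin (2 * n) → ℝ) :
    trace ((configOp α)ᴴ * (List.ofFn fun t => modeComb (G t)).prod) =
      2 ^ n * ((of fun t s => G t (α s)).det : ℝ) := by
  have hexpand := prod_ofFn_sum_smul (fun t ν => (G t ν : ℂ)) (majorana (n := n))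
  simp only [modeComb]
  rw [hexpand, Finset.mul_sum, trace_sum, ← det_transpose, det_apply', Complex.ofReal_sum,
    Finset.mul_sum]
  refine (Fintype.sum_of_injective (fun σ : Equiv.Perm (Fin k) => α ∘ σ)
    (fun σ τ h => Equiv.ext fun t => α.injective (congrFun h t)) _ _ (fun f hf => ?_)
    fun σ => ?_).symm
  · obtain ⟨s, hs⟩ := exists_forall_ne_of_forall_ne_comp_perm
      (fun σ hσ => hf ⟨σ, hσ.symm⟩) α.injective
    rw [mul_smul_comm, trace_smul, trace_configOp_mul_prod_of_forall_ne α s hs, smul_zero]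
  · rw [mul_smul_comm, trace_smul, trace_configOp_mul_prod_comp_perm]
    simp only [Function.comp_apply, transpose_apply, of_apply, smul_eq_mul, Complex.ofReal_mul,
      Complex.ofReal_prod, Complex.ofReal_intCast]
    ring

end ConfigOp

section ModeTransition

variable {n k : ℕ} {A B A' B' U : Op n} {F F' u : Matrix (Fin (2 * n)) (Fin (2 * n)) ℝ}

/-- The map `X ↦ A X B` sends each Majorana operator `c_ν` to the real combination `∑ μ, F ν μ c_μ`.
For `A = Uᴴ` and `B = U` this is `IsModeTransition U F`. -/
def ConjModes (A B : Op n) (F : Matrix (Fin (2 * n)) (Fin (2 * n)) ℝ) : Prop :=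
  ∀ ν, A * majorana ν * B = modeComb (F.row ν)

theorem conjModes_diagonal {d : Fin (2 * n) → ℝ}
    (h : ∀ ν, A * majorana ν * B = (d ν : ℂ) • majorana ν) : ConjModes A B (diagonal d) := by
  intro ν
  rw [h, row_diagonal, modeComb_single]

theorem conjModes_one : ConjModes (1 : Op n) 1 1 := by
  rw [← diagonal_one]
  exact conjModes_diagonal fun ν => by simp

theorem ConjModes.mul_modeComb_mul (h : ConjModes A B F) (w : Fin (2 * n) → ℝ) :
    A * modeComb w * B = modeComb (w ᵥ* F) := by
  simp only [ConjModes, modeComb, row_apply] at h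
  simp only [modeComb, Finset.mul_sum, Finset.sum_mul, Matrix.mul_smul, Matrix.smul_mul, h,
    vecMul, dotProduct, Finset.smul_sum, smul_smul, Complex.ofReal_sum, Complex.ofReal_mul,
    Finset.sum_smul]
  exact Finset.sum_comm

theorem ConjModes.comp (h' : ConjModes A' B' F') (h : ConjModes A B F) :
    ConjModes (A' * A) (B * B') (F * F') := by
  intro ν
  calc A' * A * majorana ν * (B * B') = A' * (A * majorana ν * B) * B' := by
        simp only [mul_assoc]
    _ = modeComb ((F * F').row ν) := by
        rw [h ν, h'.mul_modeComb_mul]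
        rfl

theorem ConjModes.symm (h : ConjModes A B F) (hBA : B * A = 1)
    {G : Matrix (Fin (2 * n)) (Fin (2 * n)) ℝ} (hGF : G * F = 1) : ConjModes B A G := by
  intro ν
  calc B * majorana ν * A = B * modeComb ((G * F).row ν) * A := by
        rw [hGF, ← conjModes_one ν, one_mul, mul_one]
    _ = B * (A * modeComb (G.row ν) * B) * A := by
        rw [h.mul_modeComb_mul]
        rfl
    _ = B * A * modeComb (G.row ν) * (B * A) := by simp only [mul_assoc]
    _ = modeComb (G.row ν) := by rw [hBA, one_mul, mul_one]

theorem IsModeTransition.conjModes (h : IsModeTransition U u) : ConjModes Uᴴ U u := h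

theorem ConjModes.isModeTransition (h : ConjModes Uᴴ U u) : IsModeTransition U u := h

theorem IsModeTransition.unique {u' : Matrix (Fin (2 * n)) (Fin (2 * n)) ℝ}
    (h : IsModeTransition U u) (h' : IsModeTransition U u') : u' = u :=
  funext fun μ => modeComb_injective ((h'.conjModes μ).symm.trans (h.conjModes μ))

theorem IsModeTransition.mul {U' : Op n} {u' : Matrix (Fin (2 * n)) (Fin (2 * n)) ℝ}
    (h : IsModeTransition U u) (h' : IsModeTransition U' u') :
    IsModeTransition (U * U') (u * u') := by
  refine ConjModes.isModeTransition ?_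
  rw [conjTranspose_mul]
  exact h'.conjModes.comp h.conjModes

theorem IsModeTransition.one : IsModeTransition (1 : Op n) 1 := by
  refine ConjModes.isModeTransition ?_
  rw [conjTranspose_one]
  exact conjModes_one

theorem IsModeTransition.mul_transpose (h : IsModeTransition U u)
    (hU : U ∈ unitaryGroup (Fin n → Fin 2) ℂ) : u * uᵀ = 1 := by
  have hUU : U * Uᴴ = 1 := mem_unitaryGroup_iff.1 hU
  ext μ ν
  have htrace : (2 : ℂ) ^ n * ((u * uᵀ) μ ν : ℝ) = 2 ^ n * ((1 : Matrix _ _ ℝ) μ ν : ℝ) := by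
    calc (2 : ℂ) ^ n * ((u * uᵀ) μ ν : ℝ)
        = trace (Uᴴ * majorana μ * U * (Uᴴ * majorana ν * U)) := by
          rw [h.conjModes, h.conjModes, trace_modeComb_mul_modeComb]
          rfl
      _ = trace (Uᴴ * (majorana μ * (U * Uᴴ) * majorana ν * U)) := by simp only [mul_assoc]
      _ = trace (majorana μ * majorana ν) := by
          rw [hUU, mul_one, trace_mul_comm, mul_assoc, hUU, mul_one]
      _ = 2 ^ n * ((1 : Matrix _ _ ℝ) μ ν : ℝ) := by
          rw [trace_majorana_mul, one_apply]
          split_ifs <;> simp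
  exact_mod_cast mul_left_cancel₀ (pow_ne_zero n two_ne_zero) htrace

theorem IsModeTransition.conjModes_inv (h : IsModeTransition U u)
    (hU : U ∈ unitaryGroup (Fin n → Fin 2) ℂ) : ConjModes U Uᴴ uᵀ :=
  h.conjModes.symm (mem_unitaryGroup_iff.1 hU) (mul_eq_one_comm.1 (h.mul_transpose hU))

theorem IsModeTransition.conj_configOp (h : IsModeTransition U u)
    (hU : U ∈ unitaryGroup (Fin n → Fin 2) ℂ) (α : Fin k ↪o Fin (2 * n)) :
    Uᴴ * configOp α * U = (List.ofFn fun t => modeComb (u.row (α t))).prod := by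
  have hUU : Uᴴ * U = 1 := mem_unitaryGroup_iff'.1 hU
  rw [configOp, conj_prod_ofFn hUU (mem_unitaryGroup_iff.1 hU)]
  simp only [h.conjModes _]

/-- The four-point function `tr (O† A O B)` of the evolved configuration operator
`O = U† C_α U`. -/
def otoTrace (U : Op n) (α : Fin k ↪o Fin (2 * n)) (A B : Op n) : ℂ :=
  trace ((Uᴴ * configOp α * U)ᴴ * A * (Uᴴ * configOp α * U) * B)

theorem otoTrace_add_left (α : Fin k ↪o Fin (2 * n)) (A A' B : Op n) :
    otoTrace U α (A + A') B = otoTrace U α A B + otoTrace U α A' B := by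
  simp only [otoTrace, mul_add, add_mul, trace_add]

theorem otoTrace_add_right (α : Fin k ↪o Fin (2 * n)) (A B B' : Op n) :
    otoTrace U α A (B + B') = otoTrace U α A B + otoTrace U α A B' := by
  simp only [otoTrace, mul_add, trace_add]

theorem otoTrace_smul_smul (α : Fin k ↪o Fin (2 * n)) (z w : ℂ) (A B : Op n) :
    otoTrace U α (z • A) (w • B) = z * w * otoTrace U α A B := by
  simp only [otoTrace, Matrix.mul_smul, Matrix.smul_mul, trace_smul, smul_eq_mul]
  ring

theorem otoTrace_eq_trace_configOp_mul (U : Op n) (α : Fin k ↪o Fin (2 * n)) (A B : Op n) :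
    otoTrace U α A B =
      trace ((configOp α)ᴴ * (U * A * Uᴴ * configOp α * (U * B * Uᴴ))) := by
  calc otoTrace U α A B
      = trace (Uᴴ * ((configOp α)ᴴ * U * A * Uᴴ * configOp α * U * B)) := by
        simp only [otoTrace, conjTranspose_mul, conjTranspose_conjTranspose, mul_assoc]
    _ = _ := by
        rw [trace_mul_comm]
        simp only [mul_assoc]

theorem IsModeTransition.otoTrace_self (h : IsModeTransition U u)
    (hU : U ∈ unitaryGroup (Fin n → Fin 2) ℂ) (α : Fin k ↪o Fin (2 * n)) (hA : A * A = 1)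
    (hF : ConjModes A A F) :
    otoTrace U α A A =
      2 ^ n * ((u.submatrix α id * F * (u.submatrix α id)ᵀ).det : ℝ) := by
  have hUU : Uᴴ * U = 1 := mem_unitaryGroup_iff'.1 hU
  set V := U * A * Uᴴ with hV
  have hVV : V * V = 1 := by
    calc V * V = U * (A * (Uᴴ * U) * A) * Uᴴ := by simp only [hV, mul_assoc]
      _ = U * Uᴴ := by rw [hUU, mul_one, hA, mul_one]
      _ = 1 := mem_unitaryGroup_iff.1 hU
  have hmodes : ConjModes V V (u * F * uᵀ) := by
    simpa only [hV, mul_assoc] using (h.conjModes_inv hU).comp (hF.comp h.conjModes)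
  rw [otoTrace_eq_trace_configOp_mul, ← hV, configOp, conj_prod_ofFn hVV hVV, ← configOp]
  simp only [hmodes _]
  exact trace_configOp_mul_prod_modeComb α _

end ModeTransition

section SiteOperators

variable {n : ℕ}

/-- The operator acting as `A` on qubit `s` and as the identity on the other qubits. -/
def onQubit (s : Fin n) (A : Matrix (Fin 2) (Fin 2) ℂ) : Op n :=
  tensor (Function.update (fun _ => 1) s A)

theorem onQubit_mul_tensor_mul (s : Fin n) (A B : Matrix (Fin 2) (Fin 2) ℂ)
    (T : Fin n → Matrix (Fin 2) (Fin 2) ℂ) :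
    onQubit s A * tensor T * onQubit s B = tensor (Function.update T s (A * T s * B)) := by
  rw [onQubit, onQubit, tensor_mul, tensor_mul]
  congr 1
  refine Function.eq_update_iff.2 ⟨by simp only [Function.update_self], fun j hj => ?_⟩
  simp only [Function.update_of_ne hj, one_mul, mul_one]

theorem tensor_mul_onQubit_mul {s : Fin n} {T : Fin n → Matrix (Fin 2) (Fin 2) ℂ}
    (hT : ∀ j, T j * T j = 1) (A : Matrix (Fin 2) (Fin 2) ℂ) :
    tensor T * onQubit s A * tensor T = onQubit s (T s * A * T s) := by
  rw [onQubit, onQubit, tensor_mul, tensor_mul]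
  congr 1
  refine Function.eq_update_iff.2 ⟨by simp only [Function.update_self], fun j hj => ?_⟩
  simp only [Function.update_of_ne hj, mul_one, hT]

theorem onQubit_one (s : Fin n) : onQubit s 1 = 1 := by
  rw [onQubit, Function.update_eq_self_iff.2 rfl, tensor_one]

theorem onQubit_mul (s : Fin n) (A B : Matrix (Fin 2) (Fin 2) ℂ) :
    onQubit s A * onQubit s B = onQubit s (A * B) := by
  rw [onQubit, onQubit, tensor_mul]
  congr 1
  refine Function.eq_update_iff.2 ⟨by simp only [Function.update_self], fun j hj => ?_⟩
  simp only [Function.update_of_ne hj, mul_one]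

theorem onQubit_smul (s : Fin n) (z : ℂ) (A : Matrix (Fin 2) (Fin 2) ℂ) :
    onQubit s (z • A) = z • onQubit s A :=
  tensor_update_smul _ s z A

theorem conjTranspose_onQubit (s : Fin n) (A : Matrix (Fin 2) (Fin 2) ℂ) :
    (onQubit s A)ᴴ = onQubit s Aᴴ := by
  rw [onQubit, onQubit, conjTranspose_tensor]
  congr 1
  refine Function.eq_update_iff.2 ⟨by simp only [Function.update_self], fun j hj => ?_⟩
  simp only [Function.update_of_ne hj, conjTranspose_one]

theorem pauliAt_eq_onQubit (s : Fin n) (a : Fin 3) : pauliAt s a = onQubit s (pauli a) := rfl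

theorem pauliAt_mul_self (s : Fin n) (a : Fin 3) : pauliAt s a * pauliAt s a = 1 := by
  rw [pauliAt_eq_onQubit, onQubit_mul, pauli_mul_self, onQubit_one]

theorem conjTranspose_pauliAt (s : Fin n) (a : Fin 3) : (pauliAt s a)ᴴ = pauliAt s a := by
  rw [pauliAt_eq_onQubit, conjTranspose_onQubit, conjTranspose_pauli]

theorem trace_pauliAt_mul (s : Fin n) (a b : Fin 3) :
    trace (pauliAt s a * pauliAt s b) = if a = b then (2 : ℂ) ^ n else 0 := by
  split_ifs with h
  · rw [h, pauliAt_mul_self, trace_one_op]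
  · refine trace_mul_eq_zero_of_anticomm ?_
    rw [pauliAt_eq_onQubit, pauliAt_eq_onQubit, onQubit_mul, onQubit_mul, pauli_anticomm h,
      ← neg_one_smul ℂ, onQubit_smul, neg_one_smul]

theorem pauli_conj_of_ne {a b : Fin 3} (h : a ≠ b) :
    pauli b * pauli a * pauli b = (-1 : ℂ) • pauli a := by
  rw [pauli_anticomm h.symm, neg_mul, mul_assoc, pauli_mul_self, mul_one, neg_one_smul]

theorem modeX_lt_modeY (s : Fin n) : modeX s < modeY s := Nat.lt_succ_self (2 * s)

theorem lt_modeX_or_eq_or_eq_or_modeY_lt (s : Fin n) (ν : Fin (2 * n)) :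
    ν < modeX s ∨ ν = modeX s ∨ ν = modeY s ∨ modeY s < ν := by
  simp only [modeX, modeY, Fin.ext_iff, Fin.lt_def]
  omega

theorem majoranaFactor_of_lt_modeX {s : Fin n} {ν : Fin (2 * n)} (h : ν < modeX s) :
    majoranaFactor ν s = 1 := by
  simp only [modeX, Fin.lt_def] at h
  exact majoranaFactor_of_gt (by omega)

theorem majoranaFactor_of_modeY_lt {s : Fin n} {ν : Fin (2 * n)} (h : modeY s < ν) :
    majoranaFactor ν s = pauli 2 := by
  simp only [modeY, Fin.lt_def] at h
  exact majoranaFactor_of_lt (by omega)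

theorem majoranaFactor_modeX (s : Fin n) : majoranaFactor (modeX s) s = pauli 0 :=
  majoranaFactor_even s

theorem majoranaFactor_modeY (s : Fin n) : majoranaFactor (modeY s) s = pauli 1 :=
  majoranaFactor_odd s

theorem tensor_update_majoranaFactor {s : Fin n} {μ ν : Fin (2 * n)} (hμ : (μ : ℕ) / 2 = s)
    (hν : (ν : ℕ) / 2 = s) :
    tensor (Function.update (fun j : Fin n => majoranaFactor ν j) s (majoranaFactor μ s)) =
      majorana μ := by
  rw [majorana_eq_tensor]
  congr 1
  symm
  refine Function.eq_update_iff.2 ⟨rfl, fun j hj => ?_⟩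
  have hj' : (j : ℕ) ≠ s := Fin.val_ne_of_ne hj
  simp only [majoranaFactor, hμ, hν, hj', if_false]

theorem tensor_update_planar (s : Fin n) {ν : Fin (2 * n)} (hν : (ν : ℕ) / 2 = s) (x y : ℝ) :
    tensor (Function.update (fun j : Fin n => majoranaFactor ν j) s
      ((x : ℂ) • pauli 0 + (y : ℂ) • pauli 1)) =
      modeComb (Pi.single (modeX s) x + Pi.single (modeY s) y) := by
  rw [tensor_update_add, tensor_update_smul, tensor_update_smul, ← majoranaFactor_modeX s,
    ← majoranaFactor_modeY s, tensor_update_majoranaFactor (by simp only [modeX]; omega) hν,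
    tensor_update_majoranaFactor (by simp only [modeY]; omega) hν, modeComb_add, modeComb_single,
    modeComb_single]

theorem onQubit_mul_majorana_mul (s : Fin n) (A B : Matrix (Fin 2) (Fin 2) ℂ)
    (ν : Fin (2 * n)) :
    onQubit s A * majorana ν * onQubit s B =
      tensor (Function.update (fun j : Fin n => majoranaFactor ν j) s
        (A * majoranaFactor ν s * B)) := by
  rw [majorana_eq_tensor, onQubit_mul_tensor_mul]

theorem onQubit_mul_majorana_mul_eq_smul {s : Fin n} {A B : Matrix (Fin 2) (Fin 2) ℂ}
    {ν : Fin (2 * n)} {z : ℂ} (h : A * majoranaFactor ν s * B = z • majoranaFactor ν s) :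
    onQubit s A * majorana ν * onQubit s B = z • majorana ν := by
  rw [onQubit_mul_majorana_mul, h, tensor_update_smul, Function.update_eq_self_iff.2 rfl,
    majorana_eq_tensor]

theorem reflection_eq_diagonal {m : ℕ} (η : Finset (Fin m)) :
    reflection η = diagonal fun μ => if μ ∈ η then -1 else 1 := by
  rw [reflection, ← diagonal_one, ← diagonal_smul, diagonal_sub]
  congr 1
  funext μ
  split_ifs with h <;> norm_num [h]

theorem conjModes_pauliAt_two (s : Fin n) :
    ConjModes (pauliAt s 2) (pauliAt s 2) (reflection {modeX s, modeY s}) := by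
  rw [reflection_eq_diagonal]
  have hXY := modeX_lt_modeY s
  refine conjModes_diagonal fun ν => onQubit_mul_majorana_mul_eq_smul ?_
  rcases lt_modeX_or_eq_or_eq_or_modeY_lt s ν with hν | rfl | rfl | hν
  · rw [majoranaFactor_of_lt_modeX hν, mul_one, pauli_mul_self]
    simp [hν.ne, (hν.trans hXY).ne]
  · rw [majoranaFactor_modeX, pauli_conj_of_ne (by decide)]
    simp
  · rw [majoranaFactor_modeY, pauli_conj_of_ne (by decide)]
    simp
  · rw [majoranaFactor_of_modeY_lt hν, pauli_mul_self, one_mul]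
    simp [hν.ne', (hXY.trans hν).ne']

/-- The action on the modes of conjugation by `x σ^x_s + y σ^y_s`, for `x ^ 2 + y ^ 2 = 1`. -/
def planarConj (s : Fin n) (x y : ℝ) : Matrix (Fin (2 * n)) (Fin (2 * n)) ℝ :=
  (diagonal fun ν => if ν < modeX s then 1 else if ν = modeX s then x ^ 2 - y ^ 2
    else if ν = modeY s then y ^ 2 - x ^ 2 else -1) +
  (2 * x * y) • (Matrix.single (modeX s) (modeY s) 1 + Matrix.single (modeY s) (modeX s) 1)

/-- The single-qubit matrix `x σ^x + y σ^y`. -/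
def planarPauli (x y : ℝ) : Matrix (Fin 2) (Fin 2) ℂ := (x : ℂ) • pauli 0 + (y : ℂ) • pauli 1

theorem planarPauli_mul_self {x y : ℝ} (h : x ^ 2 + y ^ 2 = 1) :
    planarPauli x y * planarPauli x y = 1 := by
  have h' : (x : ℂ) * x + y * y = 1 := by exact_mod_cast (by linear_combination h)
  calc planarPauli x y * planarPauli x y
      = ((x : ℂ) * x) • (pauli 0 * pauli 0) + ((y : ℂ) * y) • (pauli 1 * pauli 1) +
        ((x : ℂ) * y) • (pauli 0 * pauli 1 + pauli 1 * pauli 0) := by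
        simp only [planarPauli, add_mul, mul_add, Matrix.smul_mul, Matrix.mul_smul]
        module
    _ = 1 := by
        rw [pauli_anticomm (show (0 : Fin 3) ≠ 1 by decide), neg_add_cancel, pauli_mul_self,
          pauli_mul_self, smul_zero, add_zero, ← add_smul, h', one_smul]

theorem planarPauli_conj_zero (x y : ℝ) :
    planarPauli x y * pauli 0 * planarPauli x y =
      ((x ^ 2 - y ^ 2 : ℝ) : ℂ) • pauli 0 + ((2 * x * y : ℝ) : ℂ) • pauli 1 := by
  have hYXY : pauli 1 * pauli 0 * pauli 1 = (-1 : ℂ) • pauli 0 := pauli_conj_of_ne (by decide)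
  have hYXX : pauli 1 * pauli 0 * pauli 0 = pauli 1 := by rw [mul_assoc, pauli_mul_self, mul_one]
  simp only [planarPauli, add_mul, mul_add, Matrix.smul_mul, Matrix.mul_smul, pauli_mul_self,
    one_mul, hYXY, hYXX]
  push_cast
  module

theorem planarPauli_conj_one (x y : ℝ) :
    planarPauli x y * pauli 1 * planarPauli x y =
      ((2 * x * y : ℝ) : ℂ) • pauli 0 + ((y ^ 2 - x ^ 2 : ℝ) : ℂ) • pauli 1 := by
  have hXYX : pauli 0 * pauli 1 * pauli 0 = (-1 : ℂ) • pauli 1 := pauli_conj_of_ne (by decide)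
  have hXYY : pauli 0 * pauli 1 * pauli 1 = pauli 0 := by rw [mul_assoc, pauli_mul_self, mul_one]
  simp only [planarPauli, add_mul, mul_add, Matrix.smul_mul, Matrix.mul_smul, pauli_mul_self,
    one_mul, hXYX, hXYY]
  push_cast
  module

theorem planarPauli_conj_two {x y : ℝ} (h : x ^ 2 + y ^ 2 = 1) :
    planarPauli x y * pauli 2 * planarPauli x y = (-1 : ℂ) • pauli 2 := by
  have hanti : planarPauli x y * pauli 2 = -(pauli 2 * planarPauli x y) := by
    rw [planarPauli, add_mul, mul_add, Matrix.smul_mul, Matrix.smul_mul, pauli_anticomm (by decide),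
      pauli_anticomm (a := 1) (by decide), Matrix.mul_smul, Matrix.mul_smul]
    module
  rw [hanti, neg_mul, mul_assoc, planarPauli_mul_self h, mul_one, neg_one_smul]

theorem row_planarConj_modeX (s : Fin n) (x y : ℝ) : (planarConj s x y).row (modeX s) =
    Pi.single (modeX s) (x ^ 2 - y ^ 2) + Pi.single (modeY s) (2 * x * y) := by
  funext μ
  have hne := (modeX_lt_modeY s).ne'
  simp [planarConj, diagonal_apply, Matrix.single_apply, Pi.single_apply, hne, eq_comm]

theorem row_planarConj_modeY (s : Fin n) (x y : ℝ) : (planarConj s x y).row (modeY s) =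
    Pi.single (modeX s) (2 * x * y) + Pi.single (modeY s) (y ^ 2 - x ^ 2) := by
  funext μ
  have hXY := modeX_lt_modeY s
  simp [planarConj, diagonal_apply, Matrix.single_apply, Pi.single_apply, hXY.ne, hXY.ne',
    hXY.not_gt, eq_comm, add_comm]

theorem row_planarConj_of_lt {s : Fin n} {ν : Fin (2 * n)} (h : ν < modeX s) (x y : ℝ) :
    (planarConj s x y).row ν = Pi.single ν 1 := by
  funext μ
  have hY := h.trans (modeX_lt_modeY s)
  simp [planarConj, diagonal_apply, Pi.single_apply, h, h.ne', hY.ne', eq_comm]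

theorem row_planarConj_of_gt {s : Fin n} {ν : Fin (2 * n)} (h : modeY s < ν) (x y : ℝ) :
    (planarConj s x y).row ν = Pi.single ν (-1) := by
  funext μ
  have hX := (modeX_lt_modeY s).trans h
  simp [planarConj, diagonal_apply, Pi.single_apply, h.ne, h.ne', hX.ne, hX.ne', hX.not_gt,
    eq_comm]

theorem conjModes_planarPauli (s : Fin n) {x y : ℝ} (h : x ^ 2 + y ^ 2 = 1) :
    ConjModes (onQubit s (planarPauli x y)) (onQubit s (planarPauli x y)) (planarConj s x y) := by
  intro ν
  rcases lt_modeX_or_eq_or_eq_or_modeY_lt s ν with hν | rfl | rfl | hν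
  · rw [row_planarConj_of_lt hν, modeComb_single]
    refine onQubit_mul_majorana_mul_eq_smul ?_
    rw [majoranaFactor_of_lt_modeX hν, mul_one, planarPauli_mul_self h, Complex.ofReal_one,
      one_smul]
  · rw [row_planarConj_modeX, onQubit_mul_majorana_mul, majoranaFactor_modeX,
      planarPauli_conj_zero, tensor_update_planar s (by simp only [modeX]; omega)]
  · rw [row_planarConj_modeY, onQubit_mul_majorana_mul, majoranaFactor_modeY,
      planarPauli_conj_one, tensor_update_planar s (by simp only [modeY]; omega)]
  · rw [row_planarConj_of_gt hν, modeComb_single]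
    refine onQubit_mul_majorana_mul_eq_smul ?_
    rw [majoranaFactor_of_modeY_lt hν, planarPauli_conj_two h, Complex.ofReal_neg,
      Complex.ofReal_one]

theorem planarConj_one_zero (s : Fin n) :
    planarConj s 1 0 = -reflection (Finset.univ.filter fun μ => μ ≤ modeX s) := by
  have hXY := modeX_lt_modeY s
  rw [reflection_eq_diagonal, planarConj, mul_zero, zero_smul, add_zero, diagonal_neg]
  congr 1
  funext ν
  rcases lt_modeX_or_eq_or_eq_or_modeY_lt s ν with hν | rfl | rfl | hν
  · simp [hν, hν.le]
  · simp
  · simp [hXY.not_ge, hXY.not_gt, hXY.ne']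
  · have hX := hXY.trans hν
    simp [hX.not_ge, hX.not_gt, hX.ne', hν.ne']

theorem planarConj_zero_one (s : Fin n) :
    planarConj s 0 1 =
      -reflection (Finset.univ.filter fun μ => μ < modeX s ∨ μ = modeY s) := by
  have hXY := modeX_lt_modeY s
  rw [reflection_eq_diagonal, planarConj, mul_zero, zero_mul, zero_smul, add_zero, diagonal_neg]
  congr 1
  funext ν
  rcases lt_modeX_or_eq_or_eq_or_modeY_lt s ν with hν | rfl | rfl | hν
  · simp [hν]
  · simp [hXY.ne]
  · simp [hXY.not_gt, hXY.ne']
  · have hX := hXY.trans hν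
    simp [hX.not_gt, hX.ne', hν.ne']

end SiteOperators

section Parity

variable {n k : ℕ} {U : Op n} {u : Matrix (Fin (2 * n)) (Fin (2 * n)) ℝ}

/-- The parity operator `Z ⊗ ⋯ ⊗ Z`. -/
def parityOp (n : ℕ) : Op n := tensor fun _ => pauli 2

theorem parityOp_mul_self : parityOp n * parityOp n = 1 := by
  simp only [parityOp, tensor_mul, pauli_mul_self, tensor_one]

theorem conjTranspose_parityOp : (parityOp n)ᴴ = parityOp n := by
  simp only [parityOp, conjTranspose_tensor, conjTranspose_pauli]

theorem parityOp_conj_pauliAt (s : Fin n) (a : Fin 3) :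
    parityOp n * pauliAt s a * parityOp n = (if a = 2 then 1 else -1 : ℂ) • pauliAt s a := by
  rw [pauliAt_eq_onQubit, parityOp, tensor_mul_onQubit_mul fun _ => pauli_mul_self 2]
  split_ifs with h
  · rw [h, pauli_mul_self, one_mul, one_smul]
  · rw [pauli_conj_of_ne h, onQubit_smul]

theorem parityOp_mul_majorana (ν : Fin (2 * n)) :
    parityOp n * majorana ν = -(majorana ν * parityOp n) := by
  refine tensor_mul_eq_neg_of_anticomm_at ⟨ν / 2, by omega⟩ (fun j hj => ?_) ?_
  · simp only [Fin.val_ne_of_ne hj, if_false]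
    split_ifs
    exacts [rfl, (Commute.one_right _).eq]
  · simp only [lt_irrefl, if_false, if_true]
    split_ifs <;> exact pauli_anticomm (by decide)

theorem parityOp_mul_modeComb (w : Fin (2 * n) → ℝ) :
    parityOp n * modeComb w = -(modeComb w * parityOp n) := by
  simp only [modeComb, Finset.mul_sum, Finset.sum_mul, Matrix.mul_smul, Matrix.smul_mul,
    parityOp_mul_majorana, smul_neg, Finset.sum_neg_distrib]

theorem IsModeTransition.parityOp_conj (h : IsModeTransition U u)
    (hU : U ∈ unitaryGroup (Fin n → Fin 2) ℂ) (α : Fin k ↪o Fin (2 * n)) :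
    parityOp n * (Uᴴ * configOp α * U) * parityOp n =
      (-1 : ℂ) ^ k • (Uᴴ * configOp α * U) := by
  rw [h.conj_configOp hU, mul_prod_ofFn_of_forall_mul_eq_zsmul (ε := fun _ => -1) fun t => by
    rw [parityOp_mul_modeComb, neg_one_zsmul], smul_mul_assoc, mul_assoc, parityOp_mul_self,
    mul_one, Finset.prod_const, Finset.card_univ, Fintype.card_fin, ← Int.cast_smul_eq_zsmul ℂ,
    Int.cast_pow, Int.cast_neg, Int.cast_one]

theorem IsModeTransition.otoTrace_parity (h : IsModeTransition U u)
    (hU : U ∈ unitaryGroup (Fin n → Fin 2) ℂ) (α : Fin k ↪o Fin (2 * n)) {A B : Op n} {ε δ : ℂ}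
    (hA : parityOp n * A * parityOp n = ε • A) (hB : parityOp n * B * parityOp n = δ • B) :
    otoTrace U α A B = ε * δ * otoTrace U α A B := by
  have hP : parityOp n * parityOp n = 1 := parityOp_mul_self
  set P := parityOp n
  have hO := h.parityOp_conj hU α
  rw [otoTrace]
  set O := Uᴴ * configOp α * U
  have hOH : P * Oᴴ * P = (-1 : ℂ) ^ k • Oᴴ := by
    have hstar := congrArg conjTranspose hO
    rw [conjTranspose_mul, conjTranspose_mul, conjTranspose_smul, conjTranspose_parityOp] at hstar
    simpa only [mul_assoc, star_pow, star_neg, star_one] using hstar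
  calc trace (Oᴴ * A * O * B)
      = trace (P * (P * (Oᴴ * (P * P) * A * (P * P) * O * (P * P) * B))) := by
        simp only [hP, mul_one, ← mul_assoc P P, one_mul]
    _ = trace ((P * Oᴴ * P) * (P * A * P) * (P * O * P) * (P * B * P)) := by
        rw [trace_mul_comm]
        simp only [mul_assoc]
    _ = ε * δ * trace (Oᴴ * A * O * B) := by
        have hsign : (-1 : ℂ) ^ k * (-1) ^ k = 1 := by rw [← mul_pow]; simp
        rw [hOH, hA, hO, hB]
        simp only [Matrix.smul_mul, Matrix.mul_smul, trace_smul, smul_eq_mul]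
        linear_combination ε * δ * trace (Oᴴ * A * O * B) * hsign

theorem IsModeTransition.otoTrace_eq_zero (h : IsModeTransition U u)
    (hU : U ∈ unitaryGroup (Fin n → Fin 2) ℂ) (α : Fin k ↪o Fin (2 * n)) (s : Fin n)
    {a b : Fin 3} (hab : ¬(a = 2 ↔ b = 2)) : otoTrace U α (pauliAt s a) (pauliAt s b) = 0 := by
  have hneg := h.otoTrace_parity hU α (parityOp_conj_pauliAt s a) (parityOp_conj_pauliAt s b)
  by_cases ha : a = 2 <;> by_cases hb : b = 2
  · exact absurd (iff_of_true ha hb) hab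
  · exact self_eq_neg.1 (by simpa [ha, hb] using hneg)
  · exact self_eq_neg.1 (by simpa [ha, hb] using hneg)
  · exact absurd (iff_of_false ha hb) hab

end Parity

section Correlator

variable {n k : ℕ} {U : Op n} {u : Matrix (Fin (2 * n)) (Fin (2 * n)) ℝ}

theorem det_submatrix_neg_reflection (u : Matrix (Fin (2 * n)) (Fin (2 * n)) ℝ)
    (α : Fin k ↪o Fin (2 * n)) (η : Finset (Fin (2 * n))) :
    (u.submatrix α id * -reflection η * (u.submatrix α id)ᵀ).det = (-1) ^ k * reflDet u α η := by
  rw [Matrix.mul_neg, Matrix.neg_mul, det_neg, Fintype.card_fin, reflDet]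

/-- The signs of the modes in the remaining block of `borderedDet`, extended by zero to the two
modes of the qubit `s`. -/
def outerSign (s : Fin n) (ν : Fin (2 * n)) : ℝ :=
  if ν < modeX s then 1 else if ν = modeX s then 0 else if ν = modeY s then 0 else -1

theorem submatrix_otherMode_mul (u : Matrix (Fin (2 * n)) (Fin (2 * n)) ℝ)
    (α : Fin k ↪o Fin (2 * n)) (s : Fin n) :
    (u.submatrix α Subtype.val : Matrix (Fin k) (OtherMode s) ℝ) *
      ((reflection (Finset.univ.filter fun μ => modeY s < μ)).submatrix Subtype.val Subtype.val :
        Matrix (OtherMode s) (OtherMode s) ℝ) *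
      (u.submatrix α Subtype.val : Matrix (Fin k) (OtherMode s) ℝ)ᵀ =
      u.submatrix α id * diagonal (outerSign s) * (u.submatrix α id)ᵀ := by
  have hXY := modeX_lt_modeY s
  rw [reflection_eq_diagonal, submatrix_diagonal _ _ Subtype.val_injective]
  ext t t'
  rw [mul_apply, mul_apply]
  simp only [mul_diagonal, submatrix_apply, transpose_apply, id]
  refine Fintype.sum_of_injective Subtype.val Subtype.val_injective _ _ (fun ν hν => ?_) ?_
  · rcases lt_modeX_or_eq_or_eq_or_modeY_lt s ν with h | rfl | rfl | h
    · exact absurd ⟨⟨ν, h.ne, (h.trans hXY).ne⟩, rfl⟩ hν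
    · simp [outerSign]
    · simp [outerSign, hXY.not_gt, hXY.ne']
    · exact absurd ⟨⟨ν, (hXY.trans h).ne', h.ne'⟩, rfl⟩ hν
  · rintro ⟨ν, hX, hY⟩
    rcases lt_modeX_or_eq_or_eq_or_modeY_lt s ν with h | h | h | h
    · simp [outerSign, h, (h.trans hXY).not_gt]
    · exact absurd h hX
    · exact absurd h hY
    · simp [outerSign, h, hX, hY, (hXY.trans h).not_gt]

theorem borderedDet_eq_det_bordered (u : Matrix (Fin (2 * n)) (Fin (2 * n)) ℝ)
    (α : Fin k ↪o Fin (2 * n)) (s : Fin n) :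
    borderedDet u α s = (bordered (fun t => u (α t) (modeX s)) (fun t => u (α t) (modeY s))
      (u.submatrix α id * diagonal (outerSign s) * (u.submatrix α id)ᵀ)).det := by
  rw [← submatrix_otherMode_mul]
  rfl

theorem planarConj_of_sq_eq (s : Fin n) {x y : ℝ} (h : x ^ 2 = y ^ 2) :
    planarConj s x y = diagonal (outerSign s) +
      (2 * x * y) • (Matrix.single (modeX s) (modeY s) 1 +
        Matrix.single (modeY s) (modeX s) 1) := by
  rw [planarConj, h, sub_self]
  rfl

theorem submatrix_mul_planarConj_mul (u : Matrix (Fin (2 * n)) (Fin (2 * n)) ℝ)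
    (α : Fin k ↪o Fin (2 * n)) (s : Fin n) {x y : ℝ} (h : x ^ 2 = y ^ 2) :
    u.submatrix α id * planarConj s x y * (u.submatrix α id)ᵀ =
      u.submatrix α id * diagonal (outerSign s) * (u.submatrix α id)ᵀ + (2 * x * y) •
        (vecMulVec (fun t => u (α t) (modeX s)) (fun t => u (α t) (modeY s)) +
          vecMulVec (fun t => u (α t) (modeY s)) (fun t => u (α t) (modeX s))) := by
  rw [planarConj_of_sq_eq s h, Matrix.mul_add, Matrix.add_mul, Matrix.mul_smul, Matrix.smul_mul,
    Matrix.mul_add, Matrix.add_mul]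
  congr 3 <;>
  · ext t t'
    simp [mul_apply, vecMulVec_apply, Matrix.single_apply, ite_and]

theorem det_planarConj_sub_det_planarConj (u : Matrix (Fin (2 * n)) (Fin (2 * n)) ℝ)
    (α : Fin k ↪o Fin (2 * n)) (s : Fin n) {r : ℝ} (hr : 2 * r * r = 1) :
    (u.submatrix α id * planarConj s r r * (u.submatrix α id)ᵀ).det -
      (u.submatrix α id * planarConj s r (-r) * (u.submatrix α id)ᵀ).det =
        -4 * borderedDet u α s := by
  rw [submatrix_mul_planarConj_mul u α s rfl, submatrix_mul_planarConj_mul u α s (neg_sq r).symm,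
    mul_neg, hr, one_smul, neg_one_smul, ← sub_eq_add_neg, borderedDet_eq_det_bordered]
  refine det_add_sub_det_sub_eq_bordered ?_ _ _
  rw [transpose_mul, transpose_mul, transpose_transpose, diagonal_transpose, Matrix.mul_assoc]

theorem trace_conjTranspose_lie_mul_lie {ι R : Type*} [Fintype ι] [DecidableEq ι] [CommRing R]
    [StarRing R] {O A B : Matrix ι ι R} (hO : Oᴴ * O = 1) (hA : Aᴴ = A) :
    trace (⁅A, O⁆ᴴ * ⁅B, O⁆) =
      2 * trace (A * B) - (trace (Oᴴ * A * O * B) + trace (Oᴴ * B * O * A)) := by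
  have hO' : O * Oᴴ = 1 := mul_eq_one_comm.1 hO
  have hleft : trace (Oᴴ * A * (B * O)) = trace (A * B) := by
    rw [mul_assoc, trace_mul_comm]
    simp only [mul_assoc, hO', mul_one]
  have hright : trace (A * Oᴴ * (O * B)) = trace (A * B) := by
    rw [mul_assoc, ← mul_assoc Oᴴ, hO, one_mul]
  have hcross : trace (A * Oᴴ * (B * O)) = trace (Oᴴ * B * O * A) := by
    rw [mul_assoc, trace_mul_comm]
    simp only [mul_assoc]
  rw [Ring.lie_def, Ring.lie_def, conjTranspose_sub, conjTranspose_mul, conjTranspose_mul, hA,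
    sub_mul, mul_sub, mul_sub, trace_sub, trace_sub, trace_sub, hleft, hright, hcross,
    ← mul_assoc (Oᴴ * A) O B]
  ring

theorem oto_eq_sum_otoTrace (hU : U ∈ unitaryGroup (Fin n → Fin 2) ℂ) (α : Fin k ↪o Fin (2 * n))
    (s : Fin n) (v : Fin 3 → ℂ) :
    oto U α s v = ∑ a, ∑ b, star (v a) * v b * ((if a = b then 1 / 2 else 0) -
      1 / 2 ^ (n + 2) * (otoTrace U α (pauliAt s a) (pauliAt s b) +
        otoTrace U α (pauliAt s b) (pauliAt s a))) := by
  have hUU : U * Uᴴ = 1 := mem_unitaryGroup_iff.1 hU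
  have hUU' : Uᴴ * U = 1 := mem_unitaryGroup_iff'.1 hU
  set O := Uᴴ * configOp α * U with hO
  have hOO : Oᴴ * O = 1 := by
    calc Oᴴ * O = Uᴴ * (configOp α)ᴴ * (U * Uᴴ) * configOp α * U := by
          simp only [hO, conjTranspose_mul, conjTranspose_conjTranspose, mul_assoc]
      _ = Uᴴ * ((configOp α)ᴴ * configOp α) * U := by
          rw [hUU, mul_one]
          simp only [mul_assoc]
      _ = 1 := by rw [conjTranspose_configOp_mul_self, mul_one, hUU']
  have hlie : ⁅siteOp s v, O⁆ = ∑ a, v a • ⁅pauliAt s a, O⁆ := by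
    simp only [siteOp, Ring.lie_def, Finset.sum_mul, Finset.mul_sum, Matrix.smul_mul,
      Matrix.mul_smul, smul_sub, Finset.sum_sub_distrib]
  have htrace (a b : Fin 3) : trace (⁅pauliAt s a, O⁆ᴴ * ⁅pauliAt s b, O⁆) =
      2 * (if a = b then (2 : ℂ) ^ n else 0) -
        (otoTrace U α (pauliAt s a) (pauliAt s b) + otoTrace U α (pauliAt s b) (pauliAt s a)) := by
    rw [trace_conjTranspose_lie_mul_lie hOO (conjTranspose_pauliAt s a), trace_pauliAt_mul]
    rfl
  have hpow : (2 : ℂ) ^ (n + 2) = 4 * 2 ^ n := by ring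
  simp only [oto, ← hO, hlie, conjTranspose_sum, conjTranspose_smul, Finset.sum_mul, trace_sum,
    Finset.mul_sum, Matrix.smul_mul, Matrix.mul_smul, trace_smul, htrace, smul_eq_mul, hpow]
  rw [Finset.sum_comm]
  refine Finset.sum_congr rfl fun a _ => Finset.sum_congr rfl fun b _ => ?_
  split_ifs <;> field_simp <;> ring

theorem onQubit_planarPauli (s : Fin n) (x y : ℝ) :
    onQubit s (planarPauli x y) = (x : ℂ) • pauliAt s 0 + (y : ℂ) • pauliAt s 1 := by
  rw [pauliAt_eq_onQubit, pauliAt_eq_onQubit, ← onQubit_smul, ← onQubit_smul]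
  exact tensor_update_add _ s _ _

theorem IsModeTransition.otoTrace_planar (h : IsModeTransition U u)
    (hU : U ∈ unitaryGroup (Fin n → Fin 2) ℂ) (α : Fin k ↪o Fin (2 * n)) (s : Fin n) {x y : ℝ}
    (hxy : x ^ 2 + y ^ 2 = 1) :
    otoTrace U α ((x : ℂ) • pauliAt s 0 + (y : ℂ) • pauliAt s 1)
        ((x : ℂ) • pauliAt s 0 + (y : ℂ) • pauliAt s 1) =
      2 ^ n * ((u.submatrix α id * planarConj s x y * (u.submatrix α id)ᵀ).det : ℝ) := by
  rw [← onQubit_planarPauli]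
  refine h.otoTrace_self hU α ?_ (conjModes_planarPauli s hxy)
  rw [onQubit_mul, planarPauli_mul_self hxy, onQubit_one]

theorem IsModeTransition.otoTrace_zero_zero (h : IsModeTransition U u)
    (hU : U ∈ unitaryGroup (Fin n → Fin 2) ℂ) (α : Fin k ↪o Fin (2 * n)) (s : Fin n) :
    otoTrace U α (pauliAt s 0) (pauliAt s 0) =
      2 ^ n * ((-1) ^ k * (reflDet u α (Finset.univ.filter fun μ => μ ≤ modeX s) : ℝ)) := by
  have hX := h.otoTrace_planar hU α s (x := 1) (y := 0) (by norm_num)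
  rw [planarConj_one_zero, det_submatrix_neg_reflection] at hX
  simpa using hX

theorem IsModeTransition.otoTrace_one_one (h : IsModeTransition U u)
    (hU : U ∈ unitaryGroup (Fin n → Fin 2) ℂ) (α : Fin k ↪o Fin (2 * n)) (s : Fin n) :
    otoTrace U α (pauliAt s 1) (pauliAt s 1) = 2 ^ n * ((-1) ^ k *
      (reflDet u α (Finset.univ.filter fun μ => μ < modeX s ∨ μ = modeY s) : ℝ)) := by
  have hY := h.otoTrace_planar hU α s (x := 0) (y := 1) (by norm_num)
  rw [planarConj_zero_one, det_submatrix_neg_reflection] at hY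
  simpa using hY

-- Polarization: the values at `(r, r)` and `(r, -r)` with `2 r ^ 2 = 1` differ by the mixed terms.
theorem IsModeTransition.otoTrace_zero_one_add (h : IsModeTransition U u)
    (hU : U ∈ unitaryGroup (Fin n → Fin 2) ℂ) (α : Fin k ↪o Fin (2 * n)) (s : Fin n) :
    otoTrace U α (pauliAt s 0) (pauliAt s 1) + otoTrace U α (pauliAt s 1) (pauliAt s 0) =
      2 ^ n * (-4 * (borderedDet u α s : ℝ)) := by
  obtain ⟨r, hr⟩ : ∃ r : ℝ, 2 * r * r = 1 := by
    refine ⟨√(1 / 2), ?_⟩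
    rw [mul_assoc, Real.mul_self_sqrt (by norm_num)]
    norm_num
  have hplus := h.otoTrace_planar hU α s (x := r) (y := r) (by linear_combination hr)
  have hminus := h.otoTrace_planar hU α s (x := r) (y := -r) (by linear_combination hr)
  simp only [otoTrace_add_left, otoTrace_add_right, otoTrace_smul_smul] at hplus hminus
  have hdet := congrArg Complex.ofReal (det_planarConj_sub_det_planarConj u α s hr)
  have hr' : 2 * (r : ℂ) * r = 1 := by exact_mod_cast hr
  push_cast at hdet hplus hminus
  rw [← hdet, mul_sub, ← hplus, ← hminus]
  linear_combination -(otoTrace U α (pauliAt s 0) (pauliAt s 1) +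
    otoTrace U α (pauliAt s 1) (pauliAt s 0)) * hr'

theorem IsModeTransition.oto_eq_quadForm (h : IsModeTransition U u)
    (hU : U ∈ unitaryGroup (Fin n → Fin 2) ℂ) (α : Fin k ↪o Fin (2 * n)) (s : Fin n)
    (v : Fin 3 → ℂ) :
    oto U α s v = quadForm ((otoMatrix u α s).map Complex.ofReal) v := by
  have hXX := h.otoTrace_zero_zero hU α s
  have hYY := h.otoTrace_one_one hU α s
  have hZZ : otoTrace U α (pauliAt s 2) (pauliAt s 2) =
      2 ^ n * (reflDet u α {modeX s, modeY s} : ℝ) :=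
    h.otoTrace_self hU α (pauliAt_mul_self s 2) (conjModes_pauliAt_two s)
  have hXY := h.otoTrace_zero_one_add hU α s
  have hYX := (add_comm (otoTrace U α (pauliAt s 1) (pauliAt s 0)) _).trans hXY
  have hmixed {a b : Fin 3} (hab : ¬(a = 2 ↔ b = 2)) := h.otoTrace_eq_zero hU α s hab
  have hpow : (2 : ℂ) ^ (n + 2) = 4 * 2 ^ n := by ring
  rw [oto_eq_sum_otoTrace hU]
  simp only [Fin.sum_univ_three, hXX, hYY, hZZ, hXY, hYX, hmixed (a := 0) (b := 2) (by decide),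
    hmixed (a := 2) (b := 0) (by decide), hmixed (a := 1) (b := 2) (by decide),
    hmixed (a := 2) (b := 1) (by decide), quadForm, dotProduct, mulVec, Pi.star_apply, map_apply,
    otoMatrix, hpow, of_apply, cons_val_zero, cons_val_one, cons_val]
  simp only [RCLike.star_def, ↓reduceIte, zero_ne_one, one_ne_zero, Fin.reduceEq,
    Complex.ofReal_mul, Complex.ofReal_inv, Complex.ofReal_ofNat, Complex.ofReal_sub,
    Complex.ofReal_one, one_div, Complex.ofReal_pow, Complex.ofReal_neg, Complex.ofReal_zero]
  field_simp
  ring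

theorem quadForm_eq_star_inner (M : Matrix (Fin 3) (Fin 3) ℂ) (v : Fin 3 → ℂ) :
    quadForm M v = star (inner ℂ (toEuclideanLin M (WithLp.toLp 2 v)) (WithLp.toLp 2 v)) := by
  rw [toLpLin_toLp, EuclideanSpace.inner_toLp_toLp, dotProduct_star, star_star, quadForm]
  exact dotProduct_comm _ _

theorem quadForm_injective : Function.Injective quadForm := by
  intro M N h
  refine toEuclideanLin.injective ((ext_inner_map _ _).1 fun x => star_injective ?_)
  have hx := congrFun h x.ofLp
  rwa [quadForm_eq_star_inner, quadForm_eq_star_inner] at hx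

theorem IsModeTransition.oto_eq_quadForm_iff (h : IsModeTransition U u)
    (hU : U ∈ unitaryGroup (Fin n → Fin 2) ℂ) (α : Fin k ↪o Fin (2 * n)) (s : Fin n)
    (M : Matrix (Fin 3) (Fin 3) ℂ) :
    (∀ v, oto U α s v = quadForm M v) ↔ M = (otoMatrix u α s).map Complex.ofReal := by
  simp only [h.oto_eq_quadForm hU α s, ← funext_iff, quadForm_injective.eq_iff]
  exact eq_comm

end Correlator

section Embedding

open scoped Kronecker

variable {n : ℕ}

/-- The operator that is `G` on the qubits `i, j` and `T l` on every other qubit `l`. -/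
def embed (T : Fin n → Matrix (Fin 2) (Fin 2) ℂ) (i j : Fin n)
    (G : Matrix (Fin 2 × Fin 2) (Fin 2 × Fin 2) ℂ) : Op n :=
  of fun x y => (∏ l with l ≠ i ∧ l ≠ j, T l (x l) (y l)) * G (x i, x j) (y i, y j)

theorem embed_add (T : Fin n → Matrix (Fin 2) (Fin 2) ℂ) (i j : Fin n)
    (G H : Matrix (Fin 2 × Fin 2) (Fin 2 × Fin 2) ℂ) :
    embed T i j (G + H) = embed T i j G + embed T i j H := by
  ext x y
  simp [embed, mul_add]

theorem embed_smul (T : Fin n → Matrix (Fin 2) (Fin 2) ℂ) (i j : Fin n) (z : ℂ)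
    (G : Matrix (Fin 2 × Fin 2) (Fin 2 × Fin 2) ℂ) :
    embed T i j (z • G) = z • embed T i j G := by
  ext x y
  simp [embed, mul_left_comm]

theorem embed_zero (T : Fin n → Matrix (Fin 2) (Fin 2) ℂ) (i j : Fin n) :
    embed T i j 0 = 0 := by
  ext x y
  simp [embed]

theorem embed_sum {ι : Type*} (S : Finset ι) (T : Fin n → Matrix (Fin 2) (Fin 2) ℂ) (i j : Fin n)
    (G : ι → Matrix (Fin 2 × Fin 2) (Fin 2 × Fin 2) ℂ) :
    embed T i j (∑ r ∈ S, G r) = ∑ r ∈ S, embed T i j (G r) :=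
  map_sum (⟨⟨embed T i j, embed_zero T i j⟩, embed_add T i j⟩ :
    Matrix (Fin 2 × Fin 2) (Fin 2 × Fin 2) ℂ →+ Op n) _ _

theorem conjTranspose_embed (T : Fin n → Matrix (Fin 2) (Fin 2) ℂ) (i j : Fin n)
    (G : Matrix (Fin 2 × Fin 2) (Fin 2 × Fin 2) ℂ) :
    (embed T i j G)ᴴ = embed (fun l => (T l)ᴴ) i j Gᴴ := by
  ext x y
  simp [embed, conjTranspose_apply]

theorem embed_congr {T S : Fin n → Matrix (Fin 2) (Fin 2) ℂ} {i j : Fin n}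
    (h : ∀ l, l ≠ i → l ≠ j → T l = S l) (G : Matrix (Fin 2 × Fin 2) (Fin 2 × Fin 2) ℂ) :
    embed T i j G = embed S i j G := by
  ext x y
  simp only [embed, of_apply]
  congr 1
  refine Finset.prod_congr rfl fun l hl => ?_
  rw [Finset.mem_filter] at hl
  rw [h l hl.2.1 hl.2.2]

theorem embed_kronecker (T : Fin n → Matrix (Fin 2) (Fin 2) ℂ) {i j : Fin n} (hij : i ≠ j)
    (A B : Matrix (Fin 2) (Fin 2) ℂ) :
    embed T i j (A ⊗ₖ B) = tensor (Function.update (Function.update T i A) j B) := by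
  ext x y
  rw [tensor_update_apply, embed, of_apply, kroneckerMap_apply,
    ← Finset.mul_prod_erase _ _ (Finset.mem_erase.2 ⟨hij, Finset.mem_univ i⟩),
    Function.update_self]
  have : (Finset.univ.erase j).erase i = Finset.univ.filter fun l : Fin n => l ≠ i ∧ l ≠ j := by
    ext l; simp
  rw [this, mul_comm, mul_comm (A _ _), mul_assoc]
  congr 2
  refine Finset.prod_congr rfl fun l hl => ?_
  rw [Finset.mem_filter] at hl
  rw [Function.update_of_ne hl.2.1]

theorem tensor_eq_embed (T : Fin n → Matrix (Fin 2) (Fin 2) ℂ) {i j : Fin n} (hij : i ≠ j) :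
    tensor T = embed T i j (T i ⊗ₖ T j) := by
  rw [embed_kronecker T hij, Function.update_eq_self, Function.update_eq_self]

theorem embed_mul (T S : Fin n → Matrix (Fin 2) (Fin 2) ℂ) {i j : Fin n} (hij : i ≠ j)
    (G H : Matrix (Fin 2 × Fin 2) (Fin 2 × Fin 2) ℂ) :
    embed T i j G * embed S i j H = embed (fun l => T l * S l) i j (G * H) := by
  have hkron : ∀ A B C D : Matrix (Fin 2) (Fin 2) ℂ,
      embed T i j (A ⊗ₖ B) * embed S i j (C ⊗ₖ D) =
        embed (fun l => T l * S l) i j (A ⊗ₖ B * C ⊗ₖ D) := by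
    intro A B C D
    rw [← mul_kronecker_mul, embed_kronecker T hij, embed_kronecker S hij,
      embed_kronecker _ hij, tensor_mul]
    congr 1
    funext l
    by_cases hj : l = j
    · subst hj; simp
    · by_cases hi : l = i
      · subst hi; simp [hj]
      · simp [hi, hj]
  have hsingle : ∀ (p q : Fin 2 × Fin 2) (z : ℂ), Matrix.single p q z =
      Matrix.single p.1 q.1 z ⊗ₖ Matrix.single p.2 q.2 (1 : ℂ) := by
    intro p q z
    rw [single_kronecker_single, mul_one]
  induction G using Matrix.induction_on' with
  | h_zero => simp [embed_zero]
  | h_add G G' hG hG' => rw [embed_add, add_mul, hG, hG', add_mul, embed_add]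
  | h_std_basis p q z =>
    induction H using Matrix.induction_on' with
    | h_zero => simp [embed_zero]
    | h_add H H' hH hH' => rw [embed_add, mul_add, hH, hH', mul_add, embed_add]
    | h_std_basis p' q' z' => rw [hsingle, hsingle, hkron]

theorem embed_one_one {i j : Fin n} (hij : i ≠ j) : embed (fun _ => 1) i j 1 = (1 : Op n) := by
  rw [← tensor_one, tensor_eq_embed _ hij, one_kronecker_one]

end Embedding

section TwoQubits

open scoped Kronecker

theorem matchgateMatrix_mul (V W V' W' : Matrix (Fin 2) (Fin 2) ℂ) :
    matchgateMatrix V W * matchgateMatrix V' W' = matchgateMatrix (V * V') (W * W') := by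
  ext ⟨p₁, p₂⟩ ⟨q₁, q₂⟩
  fin_cases p₁ <;> fin_cases p₂ <;> fin_cases q₁ <;> fin_cases q₂ <;>
    simp [matchgateMatrix, mul_apply, Fintype.sum_prod_type, Fin.sum_univ_two]

theorem matchgateMatrix_one : matchgateMatrix 1 1 = 1 := by
  ext ⟨p₁, p₂⟩ ⟨q₁, q₂⟩
  fin_cases p₁ <;> fin_cases p₂ <;> fin_cases q₁ <;> fin_cases q₂ <;>
    simp [matchgateMatrix, one_apply]

theorem conjTranspose_matchgateMatrix (V W : Matrix (Fin 2) (Fin 2) ℂ) :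
    (matchgateMatrix V W)ᴴ = matchgateMatrix Vᴴ Wᴴ := by
  ext ⟨p₁, p₂⟩ ⟨q₁, q₂⟩
  fin_cases p₁ <;> fin_cases p₂ <;> fin_cases q₁ <;> fin_cases q₂ <;>
    simp [matchgateMatrix]

theorem pauli_two_kronecker_pauli_two : pauli 2 ⊗ₖ pauli 2 = matchgateMatrix 1 (-1) := by
  ext ⟨p₁, p₂⟩ ⟨q₁, q₂⟩
  fin_cases p₁ <;> fin_cases p₂ <;> fin_cases q₁ <;> fin_cases q₂ <;>
    simp [matchgateMatrix, pauli]

/-- The hermitian two-qubit operator that exchanges the even states `|00⟩, |11⟩` with the odd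
states `|01⟩, |10⟩`, with block `B` from the even to the odd states. -/
def oddMatrix (B : Matrix (Fin 2) (Fin 2) ℂ) : Matrix (Fin 2 × Fin 2) (Fin 2 × Fin 2) ℂ :=
  of fun p q =>
    if p.1 ≠ p.2 ∧ q.1 = q.2 then B p.1 q.1
    else if p.1 = p.2 ∧ q.1 ≠ q.2 then star (B q.1 p.1)
    else 0

theorem matchgateMatrix_conj_oddMatrix (V W B : Matrix (Fin 2) (Fin 2) ℂ) :
    (matchgateMatrix V W)ᴴ * oddMatrix B * matchgateMatrix V W = oddMatrix (Wᴴ * B * V) := by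
  rw [conjTranspose_matchgateMatrix]
  ext ⟨p₁, p₂⟩ ⟨q₁, q₂⟩
  fin_cases p₁ <;> fin_cases p₂ <;> fin_cases q₁ <;> fin_cases q₂ <;>
    simp [matchgateMatrix, oddMatrix, mul_apply, Fintype.sum_prod_type, Fin.sum_univ_two] <;> ring

theorem oddMatrix_add (B C : Matrix (Fin 2) (Fin 2) ℂ) :
    oddMatrix (B + C) = oddMatrix B + oddMatrix C := by
  ext p q
  simp only [oddMatrix, of_apply, Matrix.add_apply]
  split_ifs <;> simp

theorem oddMatrix_smul (r : ℝ) (B : Matrix (Fin 2) (Fin 2) ℂ) :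
    oddMatrix ((r : ℂ) • B) = (r : ℂ) • oddMatrix B := by
  ext p q
  simp only [oddMatrix, of_apply, Matrix.smul_apply]
  split_ifs <;> simp

/-- The blocks, from even to odd states, of the four Majorana operators of two qubits. -/
def modeBlock : Fin 4 → Matrix (Fin 2) (Fin 2) ℂ :=
  ![pauli 0, pauli 1, pauli 2, Complex.I • 1]

theorem kronecker_eq_oddMatrix_modeBlock (q : Fin 4) :
    ![pauli 0, pauli 1, pauli 2, pauli 2] q ⊗ₖ ![1, 1, pauli 0, pauli 1] q =
      oddMatrix (modeBlock q) := by
  ext ⟨p₁, p₂⟩ ⟨r₁, r₂⟩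
  fin_cases q <;> fin_cases p₁ <;> fin_cases p₂ <;> fin_cases r₁ <;> fin_cases r₂ <;>
    simp [oddMatrix, modeBlock, pauli]

theorem adjugate_modeBlock (q : Fin 4) : adjugate (modeBlock q) = -(modeBlock q)ᴴ := by
  ext i j
  fin_cases q <;> fin_cases i <;> fin_cases j <;>
    simp [modeBlock, pauli, adjugate_fin_two, one_apply]

/-- The real coordinates, with respect to `modeBlock`, of a block `B` with `adjugate B = -Bᴴ`. -/
def blockCoord (B : Matrix (Fin 2) (Fin 2) ℂ) : Fin 4 → ℝ :=
  ![(B 1 0).re, (B 1 0).im, (B 0 0).re, (B 0 0).im]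

theorem sum_blockCoord_smul_modeBlock {B : Matrix (Fin 2) (Fin 2) ℂ} (hB : adjugate B = -Bᴴ) :
    ∑ r, (blockCoord B r : ℂ) • modeBlock r = B := by
  have h01 : B 0 1 = star (B 1 0) := by
    simpa [adjugate_fin_two] using congrFun (congrFun hB 0) 1
  have h11 : B 1 1 = -star (B 0 0) := by
    simpa [adjugate_fin_two] using congrFun (congrFun hB 0) 0
  ext i j
  fin_cases i <;> fin_cases j <;>
    simp [Fin.sum_univ_four, blockCoord, modeBlock, pauli, Complex.ext_iff, h01, h11]

theorem blockCoord_sum_smul (c : Fin 4 → ℝ) (B : Fin 4 → Matrix (Fin 2) (Fin 2) ℂ) (t : Fin 4) :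
    blockCoord (∑ r, (c r : ℂ) • B r) t = ∑ r, c r * blockCoord (B r) t := by
  fin_cases t <;> simp [blockCoord, Matrix.sum_apply]

/-- The transition coefficients of the matchgate `G(V, W)` between its four modes. -/
def gateCoeff (V W : Matrix (Fin 2) (Fin 2) ℂ) : Matrix (Fin 4) (Fin 4) ℝ :=
  of fun q => blockCoord (Wᴴ * modeBlock q * V)

theorem conjTranspose_mul_self_of_specialUnitary (V : specialUnitaryGroup (Fin 2) ℂ) :
    V.1ᴴ * V.1 = 1 :=
  mem_unitaryGroup_iff'.1 (mem_specialUnitaryGroup_iff.1 V.2).1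

theorem adjugate_of_specialUnitary (V : specialUnitaryGroup (Fin 2) ℂ) :
    adjugate V.1 = V.1ᴴ := by
  symm
  calc V.1ᴴ = V.1ᴴ * (V.1 * adjugate V.1) := by
        rw [mul_adjugate, (mem_specialUnitaryGroup_iff.1 V.2).2, one_smul, mul_one]
    _ = adjugate V.1 := by
        rw [← mul_assoc, conjTranspose_mul_self_of_specialUnitary, one_mul]

theorem conj_modeBlock_eq_sum (V W : specialUnitaryGroup (Fin 2) ℂ) (q : Fin 4) :
    W.1ᴴ * modeBlock q * V.1 = ∑ r, (gateCoeff V.1 W.1 q r : ℂ) • modeBlock r := by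
  refine (sum_blockCoord_smul_modeBlock ?_).symm
  rw [adjugate_mul_distrib, adjugate_mul_distrib, ← adjugate_of_specialUnitary W,
    adjugate_modeBlock, adjugate_of_specialUnitary V, adjugate_of_specialUnitary W,
    ← adjugate_conjTranspose, adjugate_of_specialUnitary W, conjTranspose_mul, conjTranspose_mul,
    neg_mul, mul_neg]

theorem gateCoeff_eq_mul (V : Matrix (Fin 2) (Fin 2) ℂ) (W : specialUnitaryGroup (Fin 2) ℂ) :
    gateCoeff V W.1 = gateCoeff 1 W.1 * gateCoeff V 1 := by
  ext q t
  have hW : W.1ᴴ * modeBlock q = ∑ r, (gateCoeff 1 W.1 q r : ℂ) • modeBlock r := by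
    simpa using conj_modeBlock_eq_sum 1 W q
  rw [mul_apply, gateCoeff, of_apply, hW, Finset.sum_mul]
  simp only [Matrix.smul_mul, blockCoord_sum_smul, gateCoeff, of_apply, conjTranspose_one, one_mul]

theorem det_gateCoeff_one_left (W : Matrix (Fin 2) (Fin 2) ℂ) :
    (gateCoeff 1 W).det = Complex.normSq W.det := by
  simp [gateCoeff, blockCoord, modeBlock, pauli, det_succ_row_zero, Fin.sum_univ_succ,
    Fin.succAbove, mul_apply, Complex.normSq_apply]
  ring

theorem det_gateCoeff_one_right (V : Matrix (Fin 2) (Fin 2) ℂ) :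
    (gateCoeff V 1).det = (Complex.normSq (V 0 0) + Complex.normSq (V 1 0)) ^ 2 := by
  simp [gateCoeff, blockCoord, modeBlock, pauli, det_succ_row_zero, Fin.sum_univ_succ,
    Fin.succAbove, mul_apply, Complex.normSq_apply]
  ring

theorem det_gateCoeff (V W : specialUnitaryGroup (Fin 2) ℂ) :
    (gateCoeff V.1 W.1).det = 1 := by
  have hcol : Complex.normSq (V.1 0 0) + Complex.normSq (V.1 1 0) = 1 := by
    have hV := congrArg (fun A => (A 0 0).re) (conjTranspose_mul_self_of_specialUnitary V)
    simpa [mul_apply, Complex.normSq_apply] using hV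
  rw [gateCoeff_eq_mul, det_mul, det_gateCoeff_one_left, det_gateCoeff_one_right, hcol,
    (mem_specialUnitaryGroup_iff.1 W.2).2, map_one, one_pow, one_mul]

end TwoQubits

section Gates

variable {n : ℕ}

/-- The first qubit of a placed matchgate. -/
def Matchgate.left (g : Matchgate n) : Fin n := ⟨g.pos, by have := g.pos_lt; omega⟩

/-- The second qubit of a placed matchgate. -/
def Matchgate.right (g : Matchgate n) : Fin n := ⟨g.pos + 1, g.pos_lt⟩

theorem Matchgate.left_ne_right (g : Matchgate n) : g.left ≠ g.right :=
  Fin.ne_of_val_ne (Nat.succ_ne_self g.pos).symm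

theorem Matchgate.toOp_eq_embed (g : Matchgate n) :
    g.toOp = embed (fun _ => 1) g.left g.right (matchgateMatrix g.V.1 g.W.1) := by
  ext x y
  simp only [Matchgate.toOp, embed, of_apply, one_apply, Finset.prod_ite_zero,
    Finset.prod_const_one, Finset.mem_filter, Finset.mem_univ, true_and, and_imp, ite_mul,
    one_mul, zero_mul]
  rfl

theorem Matchgate.conj_embed (g : Matchgate n) (T : Fin n → Matrix (Fin 2) (Fin 2) ℂ)
    (G : Matrix (Fin 2 × Fin 2) (Fin 2 × Fin 2) ℂ) :
    g.toOpᴴ * embed T g.left g.right G * g.toOp = embed T g.left g.right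
      ((matchgateMatrix g.V.1 g.W.1)ᴴ * G * matchgateMatrix g.V.1 g.W.1) := by
  rw [g.toOp_eq_embed, conjTranspose_embed, embed_mul _ _ g.left_ne_right,
    embed_mul _ _ g.left_ne_right]
  simp only [conjTranspose_one, one_mul, mul_one]

theorem Matchgate.conjTranspose_mul_self (g : Matchgate n) :
    (matchgateMatrix g.V.1 g.W.1)ᴴ * matchgateMatrix g.V.1 g.W.1 = 1 := by
  rw [conjTranspose_matchgateMatrix, matchgateMatrix_mul,
    conjTranspose_mul_self_of_specialUnitary, conjTranspose_mul_self_of_specialUnitary,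
    matchgateMatrix_one]

theorem Matchgate.toOp_mem_unitaryGroup (g : Matchgate n) :
    g.toOp ∈ unitaryGroup (Fin n → Fin 2) ℂ := by
  have hone := g.conj_embed (fun _ => 1) 1
  rwa [mul_one, g.conjTranspose_mul_self, embed_one_one g.left_ne_right, mul_one,
    ← star_eq_conjTranspose, ← mem_unitaryGroup_iff'] at hone

/-- The transition matrix of a matchgate: the block `gateCoeff V W` at the modes
`2 pos, …, 2 pos + 3`, and the identity elsewhere. -/
def Matchgate.transition (g : Matchgate n) : Matrix (Fin (2 * n)) (Fin (2 * n)) ℝ :=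
  of fun μ ν =>
    if h : (2 * g.pos ≤ μ ∧ (μ : ℕ) < 2 * g.pos + 4) ∧
        2 * g.pos ≤ ν ∧ (ν : ℕ) < 2 * g.pos + 4 then
      gateCoeff g.V.1 g.W.1 ⟨μ - 2 * g.pos, by omega⟩ ⟨ν - 2 * g.pos, by omega⟩
    else if μ = ν then 1 else 0

/-- The modes of a placed matchgate. -/
def Matchgate.mode (g : Matchgate n) (q : Fin 4) : Fin (2 * n) :=
  ⟨2 * g.pos + q, by have := g.pos_lt; omega⟩

theorem Matchgate.mode_injective (g : Matchgate n) : Function.Injective g.mode := fun _ _ h =>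
  Fin.ext (Nat.add_left_cancel (congrArg Fin.val h))

theorem Matchgate.mem_range_mode (g : Matchgate n) (μ : Fin (2 * n)) :
    μ ∈ Set.range g.mode ↔ 2 * g.pos ≤ μ ∧ (μ : ℕ) < 2 * g.pos + 4 := by
  constructor
  · rintro ⟨q, rfl⟩
    simp only [mode]
    omega
  · rintro ⟨hle, hlt⟩
    exact ⟨⟨μ - 2 * g.pos, by omega⟩, Fin.ext (by simp only [mode]; omega)⟩

theorem Matchgate.transition_of_notMem (g : Matchgate n) {μ : Fin (2 * n)}
    (h : μ ∉ Set.range g.mode) :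
    g.transition μ = (1 : Matrix (Fin (2 * n)) (Fin (2 * n)) ℝ) μ := by
  rw [g.mem_range_mode] at h
  funext ν
  rw [transition, of_apply, dif_neg fun h' => h h'.1, one_apply]

theorem Matchgate.transition_mode_mode (g : Matchgate n) (q r : Fin 4) :
    g.transition (g.mode q) (g.mode r) = gateCoeff g.V.1 g.W.1 q r := by
  rw [transition, of_apply, dif_pos (by simp only [mode]; omega)]
  simp only [mode, Nat.add_sub_cancel_left, Fin.eta]

theorem Matchgate.transition_mode_of_notMem (g : Matchgate n) (q : Fin 4) {ν : Fin (2 * n)}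
    (h : ν ∉ Set.range g.mode) : g.transition (g.mode q) ν = 0 := by
  have hne : g.mode q ≠ ν := fun hq => h ⟨q, hq⟩
  rw [g.mem_range_mode] at h
  rw [transition, of_apply, dif_neg fun h' => h h'.2, if_neg hne]

theorem Matchgate.det_transition (g : Matchgate n) : g.transition.det = 1 := by
  rw [det_eq_det_submatrix_of_row_eq_one g.transition g.mode_injective
    fun μ hμ => g.transition_of_notMem hμ, ← det_gateCoeff g.V g.W]
  congr 1
  ext q r
  exact g.transition_mode_mode q r

theorem Matchgate.majorana_mode (g : Matchgate n) (q : Fin 4) :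
    majorana (g.mode q) = embed (fun j : Fin n => majoranaFactor (2 * g.pos) j) g.left g.right
      (oddMatrix (modeBlock q)) := by
  rw [majorana_eq_tensor, tensor_eq_embed _ g.left_ne_right,
    embed_congr (S := fun j : Fin n => majoranaFactor (2 * g.pos) j) fun j hl hr => ?_,
    ← kronecker_eq_oddMatrix_modeBlock]
  · congr 1
    fin_cases q
    · exact congrArg₂ _ (majoranaFactor_even g.pos)
        (majoranaFactor_of_gt (show 2 * g.pos / 2 < g.pos + 1 by omega))
    · exact congrArg₂ _ (majoranaFactor_odd g.pos)
        (majoranaFactor_of_gt (show (2 * g.pos + 1) / 2 < g.pos + 1 by omega))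
    · exact congrArg₂ _ (majoranaFactor_of_lt (show g.pos < (2 * g.pos + 2) / 2 by omega))
        (majoranaFactor_even (g.pos + 1))
    · exact congrArg₂ _ (majoranaFactor_of_lt (show g.pos < (2 * g.pos + 3) / 2 by omega))
        (majoranaFactor_odd (g.pos + 1))
  · have hl' : (j : ℕ) ≠ g.pos := fun h => hl (Fin.ext h)
    have hr' : (j : ℕ) ≠ g.pos + 1 := fun h => hr (Fin.ext h)
    simp only [mode]
    rcases Nat.lt_or_ge j g.pos with hlt | hge
    · rw [majoranaFactor_of_lt (by omega), majoranaFactor_of_lt (by omega)]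
    · rw [majoranaFactor_of_gt (by omega), majoranaFactor_of_gt (by omega)]

theorem Matchgate.conj_majorana_mode (g : Matchgate n) (q : Fin 4) :
    g.toOpᴴ * majorana (g.mode q) * g.toOp =
      ∑ r, (gateCoeff g.V.1 g.W.1 q r : ℂ) • majorana (g.mode r) := by
  rw [g.majorana_mode, g.conj_embed, matchgateMatrix_conj_oddMatrix, conj_modeBlock_eq_sum]
  simp only [g.majorana_mode, ← embed_smul, ← embed_sum, ← oddMatrix_smul, Fin.sum_univ_four,
    oddMatrix_add]

theorem Matchgate.conj_majorana_of_notMem (g : Matchgate n) {μ : Fin (2 * n)}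
    (hμ : μ ∉ Set.range g.mode) : g.toOpᴴ * majorana μ * g.toOp = majorana μ := by
  rw [majorana_eq_tensor, tensor_eq_embed _ g.left_ne_right, g.conj_embed]
  rw [g.mem_range_mode] at hμ
  congr 1
  rcases Nat.lt_or_ge (μ : ℕ) (2 * g.pos) with hlt | hge
  · rw [majoranaFactor_of_gt (by simp only [left]; omega),
      majoranaFactor_of_gt (by simp only [right]; omega), one_kronecker_one, mul_one,
      g.conjTranspose_mul_self]
  · rw [majoranaFactor_of_lt (by simp only [left]; omega),
      majoranaFactor_of_lt (by simp only [right]; omega), pauli_two_kronecker_pauli_two,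
      conjTranspose_matchgateMatrix, matchgateMatrix_mul, matchgateMatrix_mul, mul_one, mul_neg,
      mul_one, neg_mul, conjTranspose_mul_self_of_specialUnitary,
      conjTranspose_mul_self_of_specialUnitary]

theorem Matchgate.isModeTransition (g : Matchgate n) : IsModeTransition g.toOp g.transition := by
  intro μ
  by_cases hμ : μ ∈ Set.range g.mode
  · obtain ⟨q, rfl⟩ := hμ
    rw [g.conj_majorana_mode]
    refine Fintype.sum_of_injective g.mode g.mode_injective _ _ (fun ν hν => ?_) fun r => ?_
    · rw [g.transition_mode_of_notMem q hν, Complex.ofReal_zero, zero_smul]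
    · rw [g.transition_mode_mode]
  · rw [g.conj_majorana_of_notMem hμ, g.transition_of_notMem hμ]
    simp [one_apply]

theorem circuitOp_mem_unitaryGroup (L : List (Matchgate n)) :
    circuitOp L ∈ unitaryGroup (Fin n → Fin 2) ℂ := by
  refine Submonoid.list_prod_mem _ fun x hx => ?_
  obtain ⟨g, -, rfl⟩ := List.mem_map.1 hx
  exact g.toOp_mem_unitaryGroup

/-- The mode transition matrix of a circuit. -/
def circuitTransition (L : List (Matchgate n)) : Matrix (Fin (2 * n)) (Fin (2 * n)) ℝ :=
  (L.map Matchgate.transition).prod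

theorem isModeTransition_circuitTransition (L : List (Matchgate n)) :
    IsModeTransition (circuitOp L) (circuitTransition L) := by
  induction L with
  | nil => exact IsModeTransition.one
  | cons g L ih => exact g.isModeTransition.mul ih

theorem det_circuitTransition (L : List (Matchgate n)) : (circuitTransition L).det = 1 := by
  induction L with
  | nil => exact det_one
  | cons g L ih =>
    rw [circuitTransition, List.map_cons, List.prod_cons, det_mul, g.det_transition, one_mul]
    exact ih

theorem circuitTransition_mem_specialOrthogonalGroup (L : List (Matchgate n)) :
    circuitTransition L ∈ specialOrthogonalGroup (Fin (2 * n)) ℝ := by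
  rw [mem_specialOrthogonalGroup_iff, mem_orthogonalGroup_iff]
  exact ⟨(isModeTransition_circuitTransition L).mul_transpose (circuitOp_mem_unitaryGroup L),
    det_circuitTransition L⟩

end Gates

section Memory

variable (m : Memory)

@[simp] theorem Memory.setIdx_idx (r x r' : ℕ) :
    (m.setIdx r x).idx r' = if r' = r then x else m.idx r' :=
  Function.update_apply ..

@[simp] theorem Memory.setIdx_val (r x : ℕ) : (m.setIdx r x).val = m.val := rfl

theorem Memory.set_val_of_ne (c : Cell) (z : ℂ) {a : ℕ} (h : a ≠ c.arr) :
    (m.set c z).val a = m.val a := by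
  funext i j
  exact if_neg fun h' => h h'.1

@[simp] theorem Memory.get_set_self (c : Cell) (z : ℂ) : (m.set c z).get c = z :=
  if_pos ⟨rfl, rfl, rfl⟩

theorem Memory.get_set_of_ne {c d : Cell} (h : c.arr ≠ d.arr) (z : ℂ) :
    (m.set d z).get c = m.get c :=
  congrFun (congrFun (m.set_val_of_ne d z h) _) _

theorem Memory.set_set (c : Cell) (z w : ℂ) : (m.set c z).set c w = m.set c w := by
  simp only [set, mk.injEq, true_and]
  funext a i j
  split_ifs <;> rfl

/-- The memory `m` with the array `a` replaced by `f`. -/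
def Memory.setArr (a : ℕ) (f : ℕ → ℕ → ℂ) : Memory :=
  { m with val := Function.update m.val a f }

@[simp] theorem Memory.setArr_val (a : ℕ) (f : ℕ → ℕ → ℂ) (a' : ℕ) :
    (m.setArr a f).val a' = if a' = a then f else m.val a' :=
  Function.update_apply ..

/-- Copying a cell: the machine has no such instruction. -/
def Program.copy (d c : Cell) : Program := .seq (.putZero d) (.add d d c)

theorem Program.run_copy {c d : Cell} (h : c.arr ≠ d.arr) :
    ((Program.copy d c).run m).1 = m.set d (m.get c) := by
  change (m.set d 0).set d ((m.set d 0).get d + (m.set d 0).get c) = _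
  rw [m.get_set_self, m.get_set_of_ne h, zero_add, m.set_set]

end Memory

section Loops

theorem foldl_range_induction {σ : Type*} {f : σ → ℕ → σ} (P : ℕ → σ → Prop) {N : ℕ} {x : σ}
    (zero : P 0 x) (succ : ∀ t y, t < N → P t y → P (t + 1) (f y t)) :
    P N ((List.range N).foldl f x) := by
  induction N with
  | zero => exact zero
  | succ N ih =>
    rw [List.range_succ, List.foldl_append]
    exact succ N _ N.lt_succ_self (ih fun t y ht => succ t y (ht.trans N.lt_succ_self))

theorem Program.loop_induction (P : ℕ → Memory → Prop) {r b : ℕ} {p : Program} {m : Memory}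
    (zero : P 0 m)
    (succ : ∀ t m', t < m.idx b → P t m' → P (t + 1) (p.run (m'.setIdx r t)).1) :
    P (m.idx b) ((Program.loop r b p).run m).1 :=
  foldl_range_induction (σ := Memory × ℕ) (fun t st => P t st.1) zero fun t y ht hy =>
    succ t y.1 ht hy

end Loops

section StepCount

open Polynomial

/-- A polynomial bound for the number of steps of a program, in terms of a bound for the lengths of
its loops. -/
def Program.cost : Program → Polynomial ℕ
  | .seq p q => p.cost + q.cost
  | .ifLe _ _ p q => p.cost + q.cost + 1
  | .ifZero _ p q => p.cost + q.cost + 1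
  | .loop _ _ p => 1 + X * (p.cost + 1)
  | _ => 1

/-- The loops of the program have their lengths in the registers `B`, and no instruction writes to
these registers. -/
def Program.boundedBy (B : List ℕ) : Program → Bool
  | .putIdx r _ => !B.elem r
  | .addIdx r _ _ => !B.elem r
  | .subIdx r _ _ => !B.elem r
  | .seq p q => p.boundedBy B && q.boundedBy B
  | .ifLe _ _ p q => p.boundedBy B && q.boundedBy B
  | .ifZero _ p q => p.boundedBy B && q.boundedBy B
  | .loop r b p => !B.elem r && B.elem b && p.boundedBy B
  | _ => true

variable {B : List ℕ} {p : Program}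

theorem Program.run_idx_of_boundedBy (hp : p.boundedBy B) {b : ℕ} (hb : b ∈ B) (m : Memory) :
    (p.run m).1.idx b = m.idx b := by
  have hset {m : Memory} {r x : ℕ} (hr : r ∉ B) : (m.setIdx r x).idx b = m.idx b := by
    rw [Memory.setIdx_idx, if_neg (ne_of_mem_of_not_mem hb hr)]
  induction p generalizing m with
  | seq p q ihp ihq =>
    simp only [boundedBy, Bool.and_eq_true] at hp
    exact (ihq hp.2 _).trans (ihp hp.1 m)
  | ifLe a c p q ihp ihq | ifZero a p q ihp ihq =>
    simp only [boundedBy, Bool.and_eq_true] at hp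
    simp only [run]
    split_ifs
    · exact ihp hp.1 m
    · exact ihq hp.2 m
  | loop r c p ih =>
    simp only [boundedBy, Bool.and_eq_true, Bool.not_eq_true', List.elem_eq_mem,
      decide_eq_false_iff_not] at hp
    exact loop_induction (fun _ m' => m'.idx b = m.idx b) rfl fun t m' _ hm' =>
      (ih hp.2 _).trans ((hset hp.1.1).trans hm')
  | putIdx r x | addIdx r x y | subIdx r x y =>
    simp only [boundedBy, Bool.not_eq_true', List.elem_eq_mem, decide_eq_false_iff_not] at hp
    exact hset hp
  | _ => rfl

theorem Program.steps_le {N : ℕ} (hp : p.boundedBy B) {m : Memory} (hm : ∀ b ∈ B, m.idx b ≤ N) :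
    (p.run m).2 ≤ p.cost.eval N := by
  induction p generalizing m with
  | seq p q ihp ihq =>
    simp only [boundedBy, Bool.and_eq_true] at hp
    rw [cost, eval_add]
    exact add_le_add (ihp hp.1 hm) <| ihq hp.2 fun b hb =>
      (run_idx_of_boundedBy hp.1 hb m).trans_le (hm b hb)
  | ifLe a c p q ihp ihq | ifZero a p q ihp ihq =>
    simp only [boundedBy, Bool.and_eq_true] at hp
    have := ihp hp.1 hm
    have := ihq hp.2 hm
    simp only [run, cost, eval_add, eval_one]
    split_ifs <;> omega
  | loop r c p ih =>
    simp only [boundedBy, Bool.and_eq_true, Bool.not_eq_true', List.elem_eq_mem,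
      decide_eq_false_iff_not, decide_eq_true_eq] at hp
    have hrounds : ((Program.loop r c p).run m).2 ≤ 1 + m.idx c * (p.cost.eval N + 1) := by
      refine (foldl_range_induction (σ := Memory × ℕ)
        (fun t st => (∀ b ∈ B, st.1.idx b ≤ N) ∧ st.2 ≤ 1 + t * (p.cost.eval N + 1))
        ⟨hm, by simp⟩ ?_).2
      rintro t ⟨m', steps⟩ - ⟨hm', hsteps⟩
      have hset : ∀ b ∈ B, (m'.setIdx r t).idx b ≤ N := fun b hb => by
        rw [Memory.setIdx_idx, if_neg (ne_of_mem_of_not_mem hb hp.1.1)]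
        exact hm' b hb
      refine ⟨fun b hb => (run_idx_of_boundedBy hp.2 hb _).trans_le (hset b hb), ?_⟩
      have := ih hp.2 hset
      simp only at hsteps ⊢
      rw [Nat.succ_mul]
      omega
    rw [cost, eval_add, eval_one, eval_mul, eval_X, eval_add, eval_one]
    exact hrounds.trans (Nat.add_le_add_left (Nat.mul_le_mul_right _ (hm c hp.1.2)) 1)
  | _ => simp [run, cost]

end StepCount

section Expressions

/-- Binary operations of complex arithmetic. -/
inductive ArithOp
  | add | sub | mul | div

/-- The semantics of a binary operation. -/
@[simp] def ArithOp.eval : ArithOp → ℂ → ℂ → ℂ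
  | add => (· + ·)
  | sub => (· - ·)
  | mul => (· * ·)
  | div => (· / ·)

/-- The machine instruction for a binary operation. -/
def ArithOp.instr : ArithOp → Cell → Cell → Cell → Program
  | add => Program.add
  | sub => Program.sub
  | mul => Program.mul
  | div => Program.div

/-- Arithmetic expressions over the cells of a memory. `sum r b e` is the sum of `e` over the values
of the register `r` below the content of `b`; `bindAdd r b c e` and `bindSub r b c e` evaluate `e`
with `r` set to the sum or the difference of the registers `b` and `c`. -/
inductive ArithExpr
  | zero | one | imag
  | cell (c : Cell)
  | bin (o : ArithOp) (e f : ArithExpr)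
  | conj (e : ArithExpr)
  | sum (r b : ℕ) (e : ArithExpr)
  | bindAdd (r b c : ℕ) (e : ArithExpr)
  | bindSub (r b c : ℕ) (e : ArithExpr)
  | ifLe (b c : ℕ) (e f : ArithExpr)

namespace ArithExpr

/-- The value of an expression in a memory. -/
@[simp] def eval : ArithExpr → Memory → ℂ
  | zero, _ => 0
  | one, _ => 1
  | imag, _ => Complex.I
  | cell c, m => m.get c
  | bin o e f, m => o.eval (e.eval m) (f.eval m)
  | conj e, m => star (e.eval m)
  | sum r b e, m => ∑ t ∈ Finset.range (m.idx b), e.eval (m.setIdx r t)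
  | bindAdd r b c e, m => e.eval (m.setIdx r (m.idx b + m.idx c))
  | bindSub r b c e, m => e.eval (m.setIdx r (m.idx b - m.idx c))
  | ifLe b c e f, m => if m.idx b ≤ m.idx c then e.eval m else f.eval m

/-- The expression reads only the registers below `ρ`, and its bound variables are numbered
consecutively from `ρ` on. It reads only arrays below `32`, and not the array `A`: the arrays from
`32` on serve as scratch memory of compiled code. -/
def wellScoped (A : ℕ) : ℕ → ArithExpr → Bool
  | _, zero | _, one | _, imag => true
  | ρ, cell c => decide (c.row < ρ) && decide (c.col < ρ) && decide (c.arr < 32) &&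
      decide (c.arr ≠ A)
  | ρ, bin _ e f => e.wellScoped A ρ && f.wellScoped A ρ
  | ρ, conj e => e.wellScoped A ρ
  | ρ, sum r b e => decide (r = ρ) && decide (b < ρ) && e.wellScoped A (ρ + 1)
  | ρ, bindAdd r b c e | ρ, bindSub r b c e =>
      decide (r = ρ) && decide (b < ρ) && decide (c < ρ) && e.wellScoped A (ρ + 1)
  | ρ, ifLe b c e f =>
      decide (b < ρ) && decide (c < ρ) && e.wellScoped A ρ && f.wellScoped A ρ

/-- The scratch cell for the value of a subexpression at depth `d`. Its address is taken from
register `0`, which compiled code never changes. -/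
def temp (d : ℕ) : Cell := ⟨32 + d, 0, 0⟩

/-- A program that stores the value of an expression in the cell `temp d`. -/
def compile : ArithExpr → ℕ → Program
  | zero, d => .putZero (temp d)
  | one, d => .putOne (temp d)
  | imag, d => .putI (temp d)
  | cell c, d => .copy (temp d) c
  | bin o e f, d => .seq (e.compile d) (.seq (f.compile (d + 1))
      (o.instr (temp d) (temp d) (temp (d + 1))))
  | conj e, d => .seq (e.compile d) (.conj (temp d) (temp d))
  | sum r b e, d => .seq (.putZero (temp d))
      (.loop r b (.seq (e.compile (d + 1)) (.add (temp d) (temp d) (temp (d + 1)))))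
  | bindAdd r b c e, d => .seq (.addIdx r b c) (e.compile d)
  | bindSub r b c e, d => .seq (.subIdx r b c) (e.compile d)
  | ifLe b c e f, d => .ifLe b c (e.compile d) (f.compile d)

end ArithExpr

/-- Two memories agree on the registers below `ρ` and on the arrays in `S`. -/
structure Memory.AgreeOn (ρ : ℕ) (S : Set ℕ) (m m' : Memory) : Prop where
  idx : ∀ r < ρ, m'.idx r = m.idx r
  val : ∀ a ∈ S, m'.val a = m.val a

namespace Memory.AgreeOn

variable {ρ : ℕ} {S T : Set ℕ} {m m' m'' : Memory}

theorem refl : AgreeOn ρ S m m := ⟨fun _ _ => rfl, fun _ _ => rfl⟩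

theorem trans (h : AgreeOn ρ S m m') (h' : AgreeOn ρ S m' m'') : AgreeOn ρ S m m'' :=
  ⟨fun r hr => (h'.idx r hr).trans (h.idx r hr), fun a ha => (h'.val a ha).trans (h.val a ha)⟩

theorem mono (h : AgreeOn ρ S m m') (hST : T ⊆ S) : AgreeOn ρ T m m' :=
  ⟨h.idx, fun a ha => h.val a (hST ha)⟩

theorem set (h : AgreeOn ρ S m m') {c : Cell} (hc : c.arr ∉ S) (z : ℂ) :
    AgreeOn ρ S m (m'.set c z) :=
  ⟨h.idx, fun a ha => (m'.set_val_of_ne c z (ne_of_mem_of_not_mem ha hc)).trans (h.val a ha)⟩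

theorem setIdx (h : AgreeOn ρ S m m') (x : ℕ) :
    AgreeOn (ρ + 1) S (m.setIdx ρ x) (m'.setIdx ρ x) :=
  ⟨fun r hr => by
    rw [setIdx_idx, setIdx_idx]
    split_ifs with hrρ
    · rfl
    · exact h.idx r (by omega), h.val⟩

theorem of_setIdx {x : ℕ} (h : AgreeOn (ρ + 1) S (m.setIdx ρ x) m') : AgreeOn ρ S m m' :=
  ⟨fun r hr => (h.idx r (by omega)).trans ((m.setIdx_idx ..).trans (if_neg hr.ne)), h.val⟩

theorem get_eq (h : AgreeOn ρ S m m') {c : Cell} (hr : c.row < ρ) (hc : c.col < ρ)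
    (ha : c.arr ∈ S) : m'.get c = m.get c := by
  rw [get, get, h.idx _ hr, h.idx _ hc, h.val _ ha]

end Memory.AgreeOn

namespace ArithExpr

open Memory

theorem eval_congr {A ρ : ℕ} {e : ArithExpr} {m m' : Memory} (he : e.wellScoped A ρ)
    (h : AgreeOn ρ {a | a < 32 ∧ a ≠ A} m m') : e.eval m' = e.eval m := by
  induction e generalizing ρ m m' with
  | zero | one | imag => rfl
  | cell c =>
    simp only [wellScoped, Bool.and_eq_true, decide_eq_true_eq] at he
    exact h.get_eq he.1.1.1 he.1.1.2 ⟨he.1.2, he.2⟩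
  | bin o e f ihe ihf =>
    simp only [wellScoped, Bool.and_eq_true] at he
    rw [eval, eval, ihe he.1 h, ihf he.2 h]
  | conj e ih => exact congrArg star (ih he h)
  | sum r b e ih =>
    simp only [wellScoped, Bool.and_eq_true, decide_eq_true_eq] at he
    obtain ⟨⟨rfl, hb⟩, he⟩ := he
    rw [eval, eval, h.idx b hb]
    exact Finset.sum_congr rfl fun t _ => ih he (h.setIdx t)
  | bindAdd r b c e ih | bindSub r b c e ih =>
    simp only [wellScoped, Bool.and_eq_true, decide_eq_true_eq] at he
    obtain ⟨⟨⟨rfl, hb⟩, hc⟩, he⟩ := he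
    rw [eval, eval, h.idx b hb, h.idx c hc]
    exact ih he (h.setIdx _)
  | ifLe b c e f ihe ihf =>
    simp only [wellScoped, Bool.and_eq_true, decide_eq_true_eq] at he
    obtain ⟨⟨⟨hb, hc⟩, he⟩, hf⟩ := he
    rw [eval, eval, h.idx b hb, h.idx c hc, ihe he h, ihf hf h]

/-- The memory `m'` arises from `m` by storing `z` in `temp d`; registers from `ρ` on and scratch
arrays of greater depth may have been overwritten. -/
structure Stores (ρ d : ℕ) (z : ℂ) (m m' : Memory) : Prop where
  agree : AgreeOn ρ (Set.Iio (32 + d)) m m'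
  get_temp : m'.get (temp d) = z

theorem stores_set {ρ d : ℕ} {m m' : Memory} (h : AgreeOn ρ (Set.Iio (32 + d)) m m') (z : ℂ) :
    Stores ρ d z m (m'.set (temp d) z) :=
  ⟨h.set (c := temp d) (lt_irrefl (32 + d)) z, m'.get_set_self _ z⟩

theorem Stores.get_temp_of_succ {ρ d : ℕ} {z : ℂ} {m m' : Memory} (hρ : 0 < ρ)
    (h : Stores ρ (d + 1) z m m') : m'.get (temp d) = m.get (temp d) :=
  h.agree.get_eq hρ hρ (Nat.lt_succ_self (32 + d))

theorem Stores.agree_of_succ {ρ d : ℕ} {z : ℂ} {m m' : Memory} (h : Stores ρ (d + 1) z m m') :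
    AgreeOn ρ (Set.Iio (32 + d)) m m' :=
  h.agree.mono <| Set.Iio_subset_Iio (by omega)

variable {A ρ : ℕ} {e f : ArithExpr}

theorem eval_of_agreeOn_Iio {d : ℕ} {m m' : Memory} (he : e.wellScoped A ρ)
    (h : AgreeOn ρ (Set.Iio (32 + d)) m m') : e.eval m' = e.eval m :=
  eval_congr he <| h.mono fun _ ha => Nat.lt_add_right d ha.1

theorem compile_sum_stores {b d : ℕ} (hρ : 0 < ρ) (he : e.wellScoped A (ρ + 1))
    (ih : ∀ m, Stores (ρ + 1) (d + 1) (e.eval m) m ((e.compile (d + 1)).run m).1) (m : Memory) :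
    Stores ρ d ((sum ρ b e).eval m) m (((sum ρ b e).compile d).run m).1 := by
  refine Program.loop_induction (r := ρ)
    (p := .seq (e.compile (d + 1)) (.add (temp d) (temp d) (temp (d + 1))))
    (fun T m' => Stores ρ d (∑ t ∈ Finset.range T, e.eval (m.setIdx ρ t)) m m')
    (stores_set .refl 0) fun t m' _ hm' => ?_
  have hrun := ih (m'.setIdx ρ t)
  set m₁ := ((e.compile (d + 1)).run (m'.setIdx ρ t)).1
  have hsum : m₁.get (temp d) + m₁.get (temp (d + 1)) =
      ∑ t ∈ Finset.range (t + 1), e.eval (m.setIdx ρ t) := by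
    rw [Finset.sum_range_succ, ← hm'.get_temp, hrun.get_temp,
      eval_of_agreeOn_Iio he (hm'.agree.setIdx t), hrun.get_temp_of_succ ρ.succ_pos,
      (AgreeOn.of_setIdx (S := Set.univ) .refl).get_eq hρ hρ trivial]
  exact hsum ▸ stores_set (hm'.agree.trans hrun.agree_of_succ.of_setIdx) _

theorem compile_stores (hρ : 0 < ρ) (he : e.wellScoped A ρ) (d : ℕ) (m : Memory) :
    Stores ρ d (e.eval m) m ((e.compile d).run m).1 := by
  induction e generalizing ρ d m with
  | zero | one | imag => exact stores_set .refl _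
  | cell c =>
    simp only [wellScoped, Bool.and_eq_true, decide_eq_true_eq] at he
    rw [compile, Program.run_copy m (by simp only [temp]; omega)]
    exact stores_set .refl _
  | bin o e f ihe ihf =>
    simp only [wellScoped, Bool.and_eq_true] at he
    have hrune := ihe hρ he.1 d m
    have hrunf := ihf hρ he.2 (d + 1) ((e.compile d).run m).1
    have hop (m' : Memory) : ((o.instr (temp d) (temp d) (temp (d + 1))).run m').1 =
        m'.set (temp d) (o.eval (m'.get (temp d)) (m'.get (temp (d + 1)))) := by
      cases o <;> rfl
    change Stores ρ d _ m ((o.instr _ _ _).run _).1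
    rw [hop, hrunf.get_temp, hrunf.get_temp_of_succ hρ, hrune.get_temp,
      eval_of_agreeOn_Iio he.2 hrune.agree]
    exact stores_set (hrune.agree.trans hrunf.agree_of_succ) _
  | conj e ih =>
    have hrun := ih hρ he d m
    rw [eval, ← hrun.get_temp]
    exact stores_set hrun.agree _
  | sum r b e ih =>
    simp only [wellScoped, Bool.and_eq_true, decide_eq_true_eq] at he
    obtain ⟨⟨rfl, -⟩, he⟩ := he
    exact compile_sum_stores hρ he (ih r.succ_pos he (d + 1)) m
  | bindAdd r b c e ih | bindSub r b c e ih =>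
    simp only [wellScoped, Bool.and_eq_true, decide_eq_true_eq] at he
    obtain ⟨⟨⟨rfl, -⟩, -⟩, he⟩ := he
    have hrun (x : ℕ) := ih r.succ_pos he d (m.setIdx r x)
    exact ⟨(hrun _).agree.of_setIdx, (hrun _).get_temp⟩
  | ifLe b c e f ihe ihf =>
    simp only [wellScoped, Bool.and_eq_true] at he
    simp only [compile, Program.run, eval]
    split_ifs
    · exact ihe hρ he.1.2 d m
    · exact ihf hρ he.2 d m

end ArithExpr

end Expressions

section Statements

open Memory

/-- Matrix programs. `assign A b c e` sets the entries `(i, j)` of the array `A` to the values of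
`e`, where `i` and `j` run below the contents of the registers `b` and `c`, and where the
expression finds them in the registers `16` and `17`. -/
inductive Stmt
  | assign (A b c : ℕ) (e : ArithExpr)
  | seq (s t : Stmt)
  | loop (r b : ℕ) (s : Stmt)

namespace Stmt

/-- The effect of a statement, disregarding scratch memory. -/
def den : Stmt → Memory → Memory
  | assign A b c e, m => m.setArr A fun i j =>
      if i < m.idx b ∧ j < m.idx c then e.eval ((m.setIdx 16 i).setIdx 17 j) else m.val A i j
  | seq s t, m => t.den (s.den m)
  | loop r b s, m => (List.range (m.idx b)).foldl (fun m' t => s.den (m'.setIdx r t)) m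

/-- The program that executes a statement. -/
def toProgram : Stmt → Program
  | assign A b c e =>
      .loop 16 b (.loop 17 c (.seq (e.compile 0) (.copy ⟨A, 16, 17⟩ (ArithExpr.temp 0))))
  | seq s t => .seq s.toProgram t.toProgram
  | loop r b s => .loop r b s.toProgram

/-- The code of the statement does not interfere with itself: assignments write below the scratch
arrays, do not read the array they write to, and no loop is bounded by a bound variable. -/
def wellFormed : Stmt → Bool
  | assign A b c e => decide (A < 32) && decide (b < 16) && decide (c < 16) && e.wellScoped A 18
  | seq s t => s.wellFormed && t.wellFormed
  | loop _ b s => decide (b < 16) && s.wellFormed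

/-- The arrays assigned to by a statement. -/
def writes : Stmt → List ℕ
  | assign A _ _ _ => [A]
  | seq s t => s.writes ++ t.writes
  | loop _ _ s => s.writes

/-- The loop counters of a statement. -/
def counters : Stmt → List ℕ
  | assign _ _ _ _ => []
  | seq s t => s.counters ++ t.counters
  | loop r _ s => r :: s.counters

theorem den_val_of_notMem {s : Stmt} {a : ℕ} (ha : a ∉ s.writes) (m : Memory) :
    (s.den m).val a = m.val a := by
  induction s generalizing m with
  | assign A b c e => exact (m.setArr_val ..).trans (if_neg (List.ne_of_not_mem_cons ha))
  | seq s t ihs iht =>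
    simp only [writes, List.mem_append, not_or] at ha
    exact (iht ha.2 _).trans (ihs ha.1 m)
  | loop r b s ih =>
    exact foldl_range_induction (fun _ (m' : Memory) => m'.val a = m.val a) rfl
      fun _ _ _ hm' => (ih ha _).trans hm'

theorem den_idx_of_notMem {s : Stmt} {r : ℕ} (hr : r ∉ s.counters) (m : Memory) :
    (s.den m).idx r = m.idx r := by
  induction s generalizing m with
  | assign A b c e => rfl
  | seq s t ihs iht =>
    simp only [counters, List.mem_append, not_or] at hr
    exact (iht hr.2 _).trans (ihs hr.1 m)
  | loop r' b s ih =>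
    simp only [counters, List.mem_cons, not_or] at hr
    exact foldl_range_induction (fun _ (m' : Memory) => m'.idx r = m.idx r) rfl fun _ _ _ hm' =>
      (ih hr.2 _).trans (((setIdx_idx ..).trans (if_neg hr.1)).trans hm')

end Stmt

namespace Memory

variable (m : Memory) (A N : ℕ) (F : ℕ → ℕ → ℂ)

/-- The memory `m` with the entries of the array `A` that precede `(i, j)` replaced by those of `F`,
where the entries of the rows of length `N` are ordered lexicographically. -/
def fill (i j : ℕ) : Memory :=
  m.setArr A fun i' j' => if i' < i ∧ j' < N ∨ i' = i ∧ j' < j then F i' j' else m.val A i' j'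

theorem fill_zero_zero : m.fill A N F 0 0 = m := by
  simp [fill, setArr]

theorem fill_succ_zero (i : ℕ) : m.fill A N F (i + 1) 0 = m.fill A N F i N := by
  have h (i' j' : ℕ) : i' < i + 1 ∧ j' < N ∨ i' = i + 1 ∧ j' < 0 ↔
      i' < i ∧ j' < N ∨ i' = i ∧ j' < N := by omega
  simp only [fill, h]

theorem fill_set (i j : ℕ) :
    (((m.fill A N F i j).setIdx 16 i).setIdx 17 j).set ⟨A, 16, 17⟩ (F i j) =
      ((m.fill A N F i (j + 1)).setIdx 16 i).setIdx 17 j := by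
  have h (i' j' : ℕ) : i' < i ∧ j' < N ∨ i' = i ∧ j' < j + 1 ↔
      (i' = i ∧ j' = j) ∨ (i' < i ∧ j' < N ∨ i' = i ∧ j' < j) := by omega
  simp only [set, fill, h, setIdx, mk.injEq]
  refine ⟨rfl, ?_⟩
  funext a i' j'
  by_cases ha : a = A <;> by_cases hij : i' = i ∧ j' = j <;> simp [setArr, ha, hij]

namespace AgreeOn

variable {m} {m' : Memory} {ρ : ℕ} {S : Set ℕ}

theorem setArr {A : ℕ} (hA : A ∉ S) (f : ℕ → ℕ → ℂ) : AgreeOn ρ S m (m.setArr A f) :=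
  ⟨fun _ _ => rfl, fun _ ha => (m.setArr_val ..).trans (if_neg (ne_of_mem_of_not_mem ha hA))⟩

theorem setIdx_both (h : AgreeOn ρ S m m') (r x : ℕ) :
    AgreeOn ρ S (m.setIdx r x) (m'.setIdx r x) :=
  ⟨fun r' hr' => by rw [setIdx_idx, setIdx_idx, h.idx r' hr'], h.val⟩

theorem set_both (h : AgreeOn ρ S m m') {c : Cell} (hr : c.row < ρ) (hc : c.col < ρ) (z : ℂ) :
    AgreeOn ρ S (m.set c z) (m'.set c z) :=
  ⟨h.idx, fun a ha => by simp only [Memory.set, h.idx _ hr, h.idx _ hc, h.val a ha]⟩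

end AgreeOn

end Memory

namespace Stmt

variable {m m' : Memory}

theorem assign_entry_agreeOn {A N i j : ℕ} {e : ArithExpr} {F : ℕ → ℕ → ℂ} (hA : A < 32)
    (he : e.wellScoped A 18) (hF : F i j = e.eval ((m.setIdx 16 i).setIdx 17 j))
    (h : AgreeOn 17 (Set.Iio 32) ((m.fill A N F i j).setIdx 16 i) m') :
    AgreeOn 17 (Set.Iio 32) ((m.fill A N F i (j + 1)).setIdx 16 i)
      ((Program.seq (e.compile 0) (.copy ⟨A, 16, 17⟩ (ArithExpr.temp 0))).run
        (m'.setIdx 17 j)).1 := by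
  have hrun := ArithExpr.compile_stores (by norm_num) he 0 (m'.setIdx 17 j)
  have hfill : AgreeOn 18 {a | a < 32 ∧ a ≠ A} ((m.setIdx 16 i).setIdx 17 j) (m'.setIdx 17 j) :=
    AgreeOn.setIdx (((AgreeOn.setArr (fun hA' => hA'.2 rfl) _).setIdx i).trans
      (h.mono fun _ ha => ha.1)) j
  have hval : e.eval (m'.setIdx 17 j) = F i j := (ArithExpr.eval_congr he hfill).trans hF.symm
  change AgreeOn 17 _ _ ((Program.copy _ _).run ((e.compile 0).run _).1).1
  rw [Program.run_copy _ (by simp only [ArithExpr.temp]; omega), hrun.get_temp, hval]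
  refine AgreeOn.of_setIdx (x := j) (m.fill_set A N F i j ▸ ?_)
  exact ((h.setIdx j).trans hrun.agree).set_both (by norm_num) (by norm_num) _

theorem assign_row_agreeOn {A N i c : ℕ} {e : ArithExpr} {F : ℕ → ℕ → ℂ} (hA : A < 32)
    (hc : c < 16) (hN : m.idx c = N) (he : e.wellScoped A 18)
    (hF : ∀ j, F i j = e.eval ((m.setIdx 16 i).setIdx 17 j))
    (h : AgreeOn 16 (Set.Iio 32) (m.fill A N F i 0) m') :
    AgreeOn 16 (Set.Iio 32) (m.fill A N F (i + 1) 0)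
      ((Program.loop 17 c (.seq (e.compile 0) (.copy ⟨A, 16, 17⟩ (ArithExpr.temp 0)))).run
        (m'.setIdx 16 i)).1 := by
  have hbound : (m'.setIdx 16 i).idx c = N := by
    rw [setIdx_idx, if_neg (by omega), h.idx c hc, ← hN]
    rfl
  have hrun := Program.loop_induction (r := 17) (b := c) (m := m'.setIdx 16 i)
    (fun j m₁ => AgreeOn 17 (Set.Iio 32) ((m.fill A N F i j).setIdx 16 i) m₁) (h.setIdx i)
    fun j _ _ hj => assign_entry_agreeOn hA he (hF j) hj
  rw [hbound] at hrun
  exact fill_succ_zero m A N F i ▸ hrun.of_setIdx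

theorem toProgram_agreeOn {s : Stmt} (hs : s.wellFormed) (h : AgreeOn 16 (Set.Iio 32) m m') :
    AgreeOn 16 (Set.Iio 32) (s.den m) (s.toProgram.run m').1 := by
  induction s generalizing m m' with
  | assign A b c e =>
    simp only [wellFormed, Bool.and_eq_true, decide_eq_true_eq] at hs
    obtain ⟨⟨⟨hA, hb⟩, hc⟩, he⟩ := hs
    set F : ℕ → ℕ → ℂ := fun i j => e.eval ((m.setIdx 16 i).setIdx 17 j)
    have hden : (assign A b c e).den m = m.fill A (m.idx c) F (m'.idx b) 0 := by
      simp only [den, fill, h.idx b hb, not_lt_zero, and_false, or_false]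
      rfl
    rw [hden]
    exact Program.loop_induction (fun i m₁ => AgreeOn 16 _ (m.fill A (m.idx c) F i 0) m₁)
      ((m.fill_zero_zero A (m.idx c) F).symm ▸ h)
      fun i _ _ hi => assign_row_agreeOn hA hc rfl he (fun _ => rfl) hi
  | seq s t ihs iht =>
    simp only [wellFormed, Bool.and_eq_true] at hs
    exact iht hs.2 (ihs hs.1 h)
  | loop r b s ih =>
    simp only [wellFormed, Bool.and_eq_true, decide_eq_true_eq] at hs
    have hrun := Program.loop_induction (r := r) (b := b) (p := s.toProgram) (m := m')
      (fun T m₁ => AgreeOn 16 (Set.Iio 32)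
        ((List.range T).foldl (fun m₂ t => s.den (m₂.setIdx r t)) m) m₁) h
      fun t m₁ _ h₁ => by
        rw [List.range_succ, List.foldl_append]
        exact ih hs.2 (h₁.setIdx_both r t)
    rwa [h.idx b hs.1] at hrun

end Stmt

end Statements

section MatrixPrograms

namespace Reg

abbrev qubits : ℕ := 0
abbrev site : ℕ := 1
abbrev gates : ℕ := 2
abbrev modes : ℕ := 3
abbrev modesSucc : ℕ := 4
abbrev modeX : ℕ := 5
abbrev modeY : ℕ := 6
abbrev one : ℕ := 7
abbrev two : ℕ := 8
abbrev three : ℕ := 9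
abbrev four : ℕ := 10
abbrev round : ℕ := 13
abbrev gate : ℕ := 14
abbrev zero : ℕ := 15
abbrev row : ℕ := 16
abbrev col : ℕ := 17

end Reg

-- The registers `18, 19, …` are the bound variables of the expressions. The arrays `0` to `6` are
-- those of the input and output conventions.
namespace Arr

abbrev input : ℕ := 0
abbrev config : ℕ := 1
abbrev vector : ℕ := 2
abbrev gateV : ℕ := 3
abbrev gateW : ℕ := 4
abbrev form : ℕ := 5
abbrev value : ℕ := 6
abbrev transition : ℕ := 7
abbrev matrix : ℕ := 8
abbrev iterate : ℕ := 9
abbrev coeff : ℕ := 10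
abbrev product : ℕ := 11
abbrev minorX : ℕ := 12
abbrev minorY : ℕ := 13
abbrev minorZ : ℕ := 14
abbrev minorXY : ℕ := 15
abbrev gateCoeff : ℕ := 16
abbrev imageColumn : ℕ := 17
abbrev blockColumn : ℕ := 18
abbrev gate : ℕ := 19

end Arr

namespace ArithExpr

instance : Zero ArithExpr := ⟨.zero⟩
instance : One ArithExpr := ⟨.one⟩
instance : Add ArithExpr := ⟨.bin .add⟩
instance : Sub ArithExpr := ⟨.bin .sub⟩
instance : Mul ArithExpr := ⟨.bin .mul⟩
instance : Div ArithExpr := ⟨.bin .div⟩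

/-- The entry of the array `a` at the contents of the registers `r` and `c`. -/
def entry (a r c : ℕ) : ArithExpr := cell ⟨a, r, c⟩

/-- The value of `e` or of `f`, according to whether the registers `b` and `c` are equal. -/
def ifEq (b c : ℕ) (e f : ArithExpr) : ArithExpr := ifLe b c (ifLe c b e f) f

variable (e f : ArithExpr) (m : Memory)

@[simp] theorem eval_zero : (0 : ArithExpr).eval m = 0 := rfl

@[simp] theorem eval_one : (1 : ArithExpr).eval m = 1 := rfl

@[simp] theorem eval_add : (e + f).eval m = e.eval m + f.eval m := rfl

@[simp] theorem eval_sub : (e - f).eval m = e.eval m - f.eval m := rfl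

@[simp] theorem eval_mul : (e * f).eval m = e.eval m * f.eval m := rfl

@[simp] theorem eval_div : (e / f).eval m = e.eval m / f.eval m := rfl

@[simp] theorem eval_entry (a r c : ℕ) : (entry a r c).eval m = m.val a (m.idx r) (m.idx c) := rfl

@[simp] theorem eval_ifEq (b c : ℕ) :
    (ifEq b c e f).eval m = if m.idx b = m.idx c then e.eval m else f.eval m := by
  simp only [ifEq, eval]
  split_ifs <;> first | rfl | omega

end ArithExpr

namespace Memory

/-- The memory in which an assignment evaluates the entry `(i, j)`. -/
abbrev focus (m : Memory) (i j : ℕ) : Memory := (m.setIdx Reg.row i).setIdx Reg.col j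

theorem focus_idx_of_lt (m : Memory) (i j : ℕ) {r : ℕ} (hr : r < 16) :
    (m.focus i j).idx r = m.idx r := by
  rw [setIdx_idx, if_neg (by lia), setIdx_idx, if_neg (by lia)]

/-- The upper left `p` by `q` corner of the array `a`. -/
def corner (m : Memory) (a p q : ℕ) : Matrix (Fin p) (Fin q) ℂ := of fun i j => m.val a i j

@[simp] theorem corner_apply (m : Memory) (a : ℕ) {p q : ℕ} (i : Fin p) (j : Fin q) :
    m.corner a p q i j = m.val a i j := rfl

@[simp] theorem corner_setIdx (m : Memory) (r x a p q : ℕ) :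
    (m.setIdx r x).corner a p q = m.corner a p q := rfl

end Memory

namespace Stmt

variable {m : Memory} {A b c p q : ℕ} {e : ArithExpr}

theorem den_assign_val (hb : m.idx b = p) (hc : m.idx c = q) {i j : ℕ} (hi : i < p) (hj : j < q) :
    ((assign A b c e).den m).val A i j = e.eval (m.focus i j) := by
  subst hb hc
  simp [den, hi, hj]

theorem den_assign_scalar (hb : m.idx b = 1) :
    ((assign A b b e).den m).val A 0 0 = e.eval (m.focus 0 0) :=
  den_assign_val hb hb one_pos one_pos

theorem den_assign_corner (hb : m.idx b = p) (hc : m.idx c = q) :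
    ((assign A b c e).den m).corner A p q = of fun i j : Fin _ => e.eval (m.focus i j) := by
  ext i j
  exact den_assign_val hb hc i.2 j.2

theorem den_corner_of_notMem {s : Stmt} (hA : A ∉ s.writes) :
    (s.den m).corner A p q = m.corner A p q := by
  rw [Memory.corner, den_val_of_notMem hA, Memory.corner]

end Stmt

end MatrixPrograms

section DeterminantProgram

open ArithExpr

variable {m : Memory} {N N₀ : ℕ}

/-- An entry of the product of the `N` by `N` matrices in the arrays `a` and `b`. -/
def mulExpr (N a b : ℕ) : ArithExpr := sum 18 N (entry a Reg.row 18 * entry b 18 Reg.col)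

/-- The trace of the product of the `N` by `N` matrices in the arrays `a` and `b`. -/
def traceMulExpr (N a b : ℕ) : ArithExpr := sum 18 N (sum 19 N (entry a 18 19 * entry b 19 18))

/-- The number of rounds of the loop counted by the register `Reg.round`, including the current
one. -/
def roundsExpr (N : ℕ) : ArithExpr := sum 18 N (ifLe 18 Reg.round 1 0)

theorem mulExpr_eval (a b : ℕ) (hN : m.idx N = N₀) (hlt : N < 16) (i j : Fin N₀) :
    (mulExpr N a b).eval (m.focus i j) = (m.corner a N₀ N₀ * m.corner b N₀ N₀) i j := by
  rw [mulExpr, eval, m.focus_idx_of_lt i j hlt, hN, Finset.sum_range, mul_apply]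
  simp

theorem traceMulExpr_eval (a b : ℕ) (hN : m.idx N = N₀) (hlt : N < 18) :
    (traceMulExpr N a b).eval m = (m.corner a N₀ N₀ * m.corner b N₀ N₀).trace := by
  rw [traceMulExpr, eval, hN, Finset.sum_range, trace]
  refine Finset.sum_congr rfl fun i _ => ?_
  rw [eval, Memory.setIdx_idx, if_neg hlt.ne, hN, Finset.sum_range, diag_apply, mul_apply]
  simp

theorem roundsExpr_eval (h : m.idx Reg.round < m.idx N) :
    (roundsExpr N).eval m = m.idx Reg.round + 1 := by
  have hfilter : (Finset.range (m.idx N)).filter (· ≤ m.idx Reg.round) =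
      Finset.range (m.idx Reg.round + 1) := by
    ext t
    simp only [Finset.mem_filter, Finset.mem_range]
    omega
  calc (roundsExpr N).eval m
      = ∑ t ∈ Finset.range (m.idx N), if t ≤ m.idx Reg.round then (1 : ℂ) else 0 := by
        simp [roundsExpr]
    _ = m.idx Reg.round + 1 := by
        rw [← Finset.sum_filter, Finset.sum_const, hfilter, Finset.card_range, nsmul_one,
          Nat.cast_succ]

/-- One round of the Faddeev–LeVerrier iteration for minus the matrix in array `Arr.matrix`. -/
def faddeevLeVerrierStmt (N : ℕ) : Stmt :=
  .seq (.assign Arr.product N N (ifEq Reg.row Reg.col (entry Arr.coeff Reg.zero Reg.zero) 0 -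
    mulExpr N Arr.matrix Arr.iterate)) <|
  .seq (.assign Arr.iterate N N (entry Arr.product Reg.row Reg.col)) <|
  .assign Arr.coeff Reg.one Reg.one (traceMulExpr N Arr.matrix Arr.iterate / roundsExpr N)

/-- Stores in the array `out` the determinant of the matrix in array `Arr.matrix`, the size of which
is in the register `N`. -/
def detStmt (N out : ℕ) : Stmt :=
  .seq (.assign Arr.iterate N N 0) <| .seq (.assign Arr.coeff Reg.one Reg.one 1) <|
  .seq (.loop Reg.round N (faddeevLeVerrierStmt N))
    (.assign out Reg.one Reg.one (entry Arr.coeff Reg.zero Reg.zero))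

/-- The arrays hold the state of the Faddeev–LeVerrier iteration for `-A` after `t` rounds. -/
structure HoldsIterate (m : Memory) (N : ℕ) (A : Matrix (Fin N₀) (Fin N₀) ℂ) (t : ℕ) : Prop where
  size : m.idx N = N₀
  one : m.idx Reg.one = 1
  zero : m.idx Reg.zero = 0
  matrix : m.corner Arr.matrix N₀ N₀ = A
  iterate : m.corner Arr.iterate N₀ N₀ = (faddeevLeVerrier (-A) t).1
  coeff : m.val Arr.coeff 0 0 = (faddeevLeVerrier (-A) t).2

variable {A : Matrix (Fin N₀) (Fin N₀) ℂ} {t : ℕ}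

theorem HoldsIterate.setIdx_round (h : HoldsIterate m N A t) (hN : N < 13) (x : ℕ) :
    HoldsIterate (m.setIdx Reg.round x) N A t :=
  ⟨by rw [Memory.setIdx_idx, if_neg hN.ne, h.size], h.one, h.zero, h.matrix, h.iterate, h.coeff⟩

theorem HoldsIterate.succ (h : HoldsIterate m N A t) (hN : N < 13) (ht : t < N₀)
    (hround : m.idx Reg.round = t) :
    HoldsIterate ((faddeevLeVerrierStmt N).den m) N A (t + 1) := by
  set m₁ := (Stmt.assign Arr.product N N (ifEq Reg.row Reg.col (entry Arr.coeff Reg.zero Reg.zero) 0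
    - mulExpr N Arr.matrix Arr.iterate)).den m
  set m₂ := (Stmt.assign Arr.iterate N N (entry Arr.product Reg.row Reg.col)).den m₁
  have hmatrix : m₂.corner Arr.matrix N₀ N₀ = A := h.matrix
  have hproduct : m₁.corner Arr.product N₀ N₀ = (faddeevLeVerrier (-A) (t + 1)).1 := by
    rw [Stmt.den_assign_corner h.size h.size, faddeevLeVerrier]
    ext i j
    simp only [of_apply, eval_sub, mulExpr_eval _ _ h.size (by omega : N < 16), h.matrix,
      h.iterate, ← h.coeff]
    simp only [eval_ifEq, Memory.setIdx_idx, OfNat.ofNat_eq_ofNat, Nat.reduceEqDiff, ↓reduceIte,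
      eval_entry, h.zero, Memory.setIdx_val, eval, Matrix.add_apply, Matrix.neg_apply, neg_mul,
      Matrix.smul_apply, one_apply, Fin.ext_iff, smul_eq_mul, mul_ite, mul_one, mul_zero]
    ring
  have hiterate : m₂.corner Arr.iterate N₀ N₀ = (faddeevLeVerrier (-A) (t + 1)).1 := by
    rw [Stmt.den_assign_corner (m := m₁) h.size h.size, ← hproduct]
    ext i j
    simp
  refine ⟨h.size, h.one, h.zero, hmatrix, hiterate, ?_⟩
  have hsize : (m₂.focus 0 0).idx N = N₀ := (m₂.focus_idx_of_lt 0 0 (by omega)).trans h.size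
  have hrounds : (m₂.focus 0 0).idx Reg.round = t :=
    (m₂.focus_idx_of_lt 0 0 (by norm_num)).trans hround
  change ((Stmt.assign _ _ _ _).den m₂).val Arr.coeff 0 0 = _
  rw [Stmt.den_assign_scalar (m := m₂) h.one, eval_div,
    traceMulExpr_eval _ _ hsize (by omega), roundsExpr_eval (hsize ▸ hrounds ▸ ht), hrounds]
  simp only [Memory.corner_setIdx, hmatrix, hiterate]
  have hcoeff : (faddeevLeVerrier (-A) (t + 1)).2 =
      -(-A * (faddeevLeVerrier (-A) (t + 1)).1).trace / (t + 1) := rfl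
  rw [hcoeff, neg_mul, trace_neg, neg_neg]

theorem detStmt_den (out : ℕ) (hN : N < 13) (hsize : m.idx N = N₀) (hone : m.idx Reg.one = 1)
    (hzero : m.idx Reg.zero = 0) (hA : m.corner Arr.matrix N₀ N₀ = A) :
    ((detStmt N out).den m).val out 0 0 = A.det := by
  set m₁ := (Stmt.assign Arr.iterate N N 0).den m
  set m₂ := (Stmt.assign Arr.coeff Reg.one Reg.one 1).den m₁
  have hinit : HoldsIterate m₂ N A 0 := by
    refine ⟨hsize, hone, hzero, hA, ?_,
      Stmt.den_assign_scalar (m := m₁) hone⟩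
    rw [Stmt.den_corner_of_notMem (by decide), Stmt.den_assign_corner hsize hsize]
    rfl
  have hfinal : HoldsIterate ((Stmt.loop Reg.round N (faddeevLeVerrierStmt N)).den m₂) N A N₀ :=
    hsize ▸ foldl_range_induction (fun T m' => HoldsIterate m' N A T) hinit fun t m' ht h =>
      (h.setIdx_round hN t).succ hN (hsize ▸ ht) rfl
  change ((Stmt.assign _ _ _ _).den _).val out 0 0 = _
  rw [Stmt.den_assign_scalar hfinal.one, eval_entry,
    Memory.focus_idx_of_lt _ _ _ (by norm_num), hfinal.zero, Memory.setIdx_val, Memory.setIdx_val,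
    hfinal.coeff, ← faddeevLeVerrier_neg_card, Fintype.card_fin]

end DeterminantProgram

section MaskedMatrices

variable {R : Type*} [CommRing R] {ι κ : Type*}

theorem bordered_submatrix (a b : ι → R) (A : Matrix ι ι R) (f : κ → ι) :
    (bordered a b A).submatrix (Sum.map id f) (Sum.map id f) =
      bordered (a ∘ f) (b ∘ f) (A.submatrix f f) := by
  ext (i | i) (j | j) <;> rfl

theorem bordered_map {S : Type*} [CommRing S] (φ : R →+* S) (a b : ι → R) (A : Matrix ι ι R) :
    (bordered a b A).map φ = bordered (φ ∘ a) (φ ∘ b) (A.map φ) := by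
  ext (i | i) (j | j) <;> simp [bordered]

variable [DecidableEq ι]

/-- The matrix `A` with its rows and columns multiplied by the mask `c`, and with `1 - c` added to
its diagonal. For the indicator function `c` of a set of indices, the determinant is the principal
minor of `A` on this set. -/
def masked (c : ι → R) (A : Matrix ι ι R) : Matrix ι ι R :=
  of fun i j => c i * A i j * c j + if i = j then 1 - c i else 0

theorem masked_bordered (c a b : ι → R) (A : Matrix ι ι R) :
    masked (Sum.elim 1 c) (bordered a b A) = bordered (c * a) (b * c) (masked c A) := by
  ext (i | i) (j | j) <;> simp [masked, bordered]

variable [Fintype ι] [Fintype κ] [DecidableEq κ] {c : ι → R} {f : κ → ι}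

theorem det_masked (hf : Function.Injective f) (hone : ∀ t, c (f t) = 1)
    (hzero : ∀ i ∉ Set.range f, c i = 0) (A : Matrix ι ι R) :
    (masked c A).det = (A.submatrix f f).det := by
  rw [det_eq_det_submatrix_of_row_eq_one _ hf]
  · congr 1
    ext t t'
    simp [masked, hone]
  · intro i hi
    ext j
    simp [masked, hzero i hi, one_apply]

theorem det_bordered_masked (hf : Function.Injective f) (hone : ∀ t, c (f t) = 1)
    (hzero : ∀ i ∉ Set.range f, c i = 0) (a b : ι → R) (A : Matrix ι ι R) :
    (bordered (c * a) (b * c) (masked c A)).det =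
      (bordered (a ∘ f) (b ∘ f) (A.submatrix f f)).det := by
  rw [← masked_bordered, ← bordered_submatrix, det_masked (Function.injective_id.sumMap hf)]
  · rintro (t | t)
    exacts [rfl, hone t]
  · rintro (i | i) hi
    · exact absurd ⟨Sum.inl i, rfl⟩ hi
    · exact hzero i fun ⟨t, ht⟩ => hi ⟨Sum.inr t, congrArg Sum.inr ht⟩

end MaskedMatrices

section CorrelatorProgram

open ArithExpr

/-- The registers hold the constants of a correlator at qubit `s` of `n` qubits. -/
structure HasConstants (m : Memory) (n s : ℕ) : Prop where
  qubits : m.idx Reg.qubits = n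
  modes : m.idx Reg.modes = 2 * n
  modesSucc : m.idx Reg.modesSucc = 2 * n + 1
  modeX : m.idx Reg.modeX = 2 * s
  modeY : m.idx Reg.modeY = 2 * s + 1
  one : m.idx Reg.one = 1
  two : m.idx Reg.two = 2
  three : m.idx Reg.three = 3
  four : m.idx Reg.four = 4
  zero : m.idx Reg.zero = 0

namespace HasConstants

variable {m m' : Memory} {n s : ℕ}

theorem of_eq (h : HasConstants m n s)
    (hidx : ∀ r, r < Reg.round ∨ r = Reg.zero → m'.idx r = m.idx r) : HasConstants m' n s where
  qubits := (hidx _ (by decide)).trans h.qubits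
  modes := (hidx _ (by decide)).trans h.modes
  modesSucc := (hidx _ (by decide)).trans h.modesSucc
  modeX := (hidx _ (by decide)).trans h.modeX
  modeY := (hidx _ (by decide)).trans h.modeY
  one := (hidx _ (by decide)).trans h.one
  two := (hidx _ (by decide)).trans h.two
  three := (hidx _ (by decide)).trans h.three
  four := (hidx _ (by decide)).trans h.four
  zero := (hidx _ (by decide)).trans h.zero

theorem den (h : HasConstants m n s) {S : Stmt}
    (hS : ∀ r ∈ S.counters, Reg.round ≤ r ∧ r ≠ Reg.zero) : HasConstants (S.den m) n s :=
  h.of_eq fun r hr => Stmt.den_idx_of_notMem (fun hmem => by have := hS r hmem; omega) m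

theorem setIdx (h : HasConstants m n s) {r : ℕ} (hr : Reg.round ≤ r ∧ r ≠ Reg.zero) (x : ℕ) :
    HasConstants (m.setIdx r x) n s :=
  h.of_eq fun r' hr' => (Memory.setIdx_idx ..).trans (if_neg (by omega))

theorem focus (h : HasConstants m n s) (i j : ℕ) : HasConstants (m.focus i j) n s :=
  (h.setIdx (by decide) i).setIdx (by decide) j

end HasConstants

variable {n k : ℕ}

/-- The memory holds the transition matrix `u`, the configuration `α` and the vector `v`. -/
structure Ready (m : Memory) (u : Matrix (Fin (2 * n)) (Fin (2 * n)) ℝ)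
    (α : Fin k ↪o Fin (2 * n)) (s : Fin n) (v : Fin 3 → ℂ) : Prop extends
    HasConstants m n s where
  transition : m.corner Arr.transition (2 * n) (2 * n) = u.map Complex.ofRealHom
  config : ∀ j, m.val Arr.config 0 j = configVec α j
  vector : ∀ j, m.val Arr.vector 0 j = padVec v j

variable {u : Matrix (Fin (2 * n)) (Fin (2 * n)) ℝ} {α : Fin k ↪o Fin (2 * n)} {s : Fin n}
  {v : Fin 3 → ℂ} {m : Memory}

theorem Ready.den (h : Ready m u α s v) {S : Stmt}
    (hcounters : ∀ r ∈ S.counters, Reg.round ≤ r ∧ r ≠ Reg.zero)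
    (hwrites : ∀ a ∈ [Arr.transition, Arr.config, Arr.vector], a ∉ S.writes) :
    Ready (S.den m) u α s v where
  toHasConstants := h.toHasConstants.den hcounters
  transition := by rw [Stmt.den_corner_of_notMem (hwrites _ (by decide)), h.transition]
  config := by rw [Stmt.den_val_of_notMem (hwrites _ (by decide))]; exact h.config
  vector := by rw [Stmt.den_val_of_notMem (hwrites _ (by decide))]; exact h.vector

theorem configVec_apply (α : Fin k ↪o Fin (2 * n)) (t : Fin k) : configVec α (α t) = 1 :=
  if_pos ⟨t, rfl⟩

theorem configVec_of_notMem_range {i : Fin (2 * n)} (hi : i ∉ Set.range α) : configVec α i = 0 :=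
  if_neg fun ⟨t, ht⟩ => hi ⟨t, Fin.ext ht⟩

theorem map_mul_diagonal_mul_submatrix (u : Matrix (Fin (2 * n)) (Fin (2 * n)) ℝ)
    (α : Fin k ↪o Fin (2 * n)) (δ : Fin (2 * n) → ℝ) :
    ((u * diagonal δ * uᵀ).map Complex.ofRealHom).submatrix α α =
      (u.submatrix α id * diagonal δ * (u.submatrix α id)ᵀ).map Complex.ofRealHom := rfl

/-- The entry of the matrix `masked c A`, where `c` is the configuration and `e` is the entry of
`A`. -/
def maskedExpr (e : ArithExpr) : ArithExpr :=
  entry Arr.config Reg.zero Reg.row * e * entry Arr.config Reg.zero Reg.col +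
    ifEq Reg.row Reg.col (1 - entry Arr.config Reg.zero Reg.row) 0

/-- The entry of `u D uᵀ`, where `u` is the transition matrix and `D` is the diagonal matrix with
the entries `d`, a function of the register `18`. -/
def conjugatedExpr (d : ArithExpr) : ArithExpr :=
  sum 18 Reg.modes (entry Arr.transition Reg.row 18 * d * entry Arr.transition Reg.col 18)

theorem maskedExpr_conjugatedExpr_eval (h : Ready m u α s v) {d : ArithExpr}
    {δ : Fin (2 * n) → ℝ} {i j : Fin (2 * n)}
    (hd : ∀ l : Fin (2 * n), d.eval ((m.focus i j).setIdx 18 l) = δ l) :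
    (maskedExpr (conjugatedExpr d)).eval (m.focus i j) =
      masked (fun i : Fin (2 * n) => configVec α i)
        ((u * diagonal δ * uᵀ).map Complex.ofRealHom) i j := by
  have htransition (i j : Fin (2 * n)) : m.val Arr.transition i j = u i j :=
    congrFun₂ h.transition i j
  have hconjugated : (conjugatedExpr d).eval (m.focus i j) =
      (u * diagonal δ * uᵀ).map Complex.ofRealHom i j := by
    rw [conjugatedExpr, eval, m.focus_idx_of_lt _ _ (by norm_num), h.modes, Finset.sum_range]
    simp [hd, htransition, Matrix.mul_apply (N := uᵀ)]
  rw [maskedExpr, eval_add, eval_mul, eval_mul, hconjugated]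
  simp [masked, h.zero, h.config, Fin.ext_iff]

/-- Stores in the array `out` the principal minor of `u D uᵀ` with the modes of the configuration,
where `D` is as in `conjugatedExpr`. -/
def minorStmt (d : ArithExpr) (out : ℕ) : Stmt :=
  .seq (.assign Arr.matrix Reg.modes Reg.modes (maskedExpr (conjugatedExpr d)))
    (detStmt Reg.modes out)

theorem minorStmt_den (h : Ready m u α s v) {d : ArithExpr} {δ : Fin (2 * n) → ℝ}
    (hd : ∀ i j l : Fin (2 * n), d.eval ((m.focus i j).setIdx 18 l) = δ l) (out : ℕ) :
    ((minorStmt d out).den m).val out 0 0 =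
      ((u.submatrix α id * diagonal δ * (u.submatrix α id)ᵀ).det : ℝ) := by
  set m₁ := (Stmt.assign Arr.matrix Reg.modes Reg.modes (maskedExpr (conjugatedExpr d))).den m
  have hmatrix : m₁.corner Arr.matrix (2 * n) (2 * n) =
      masked (fun i : Fin (2 * n) => configVec α i)
        ((u * diagonal δ * uᵀ).map Complex.ofRealHom) := by
    rw [Stmt.den_assign_corner h.modes h.modes]
    ext i j
    exact maskedExpr_conjugatedExpr_eval h (hd i j)
  change ((detStmt _ out).den m₁).val out 0 0 = _
  rw [detStmt_den (m := m₁) out (by norm_num) h.modes h.one h.zero hmatrix,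
    det_masked α.injective (configVec_apply α) (fun _ => configVec_of_notMem_range),
    map_mul_diagonal_mul_submatrix]
  exact (RingHom.map_det Complex.ofRealHom _).symm

/-- The diagonal entries `outerSign s`. -/
def outerSignExpr : ArithExpr := ifLe 18 Reg.modeY (ifLe Reg.modeX 18 0 1) (0 - 1)

theorem outerSignExpr_eval (h : HasConstants m n s) {l : Fin (2 * n)} (hl : m.idx 18 = l) :
    outerSignExpr.eval m = outerSign s l := by
  simp only [outerSignExpr, outerSign, modeX, modeY, Fin.lt_def, Fin.ext_iff, eval, eval_sub,
    h.modeX, h.modeY, hl]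
  split_ifs <;> first | omega | simp

/-- The matrix of `borderedDet`, masked by the configuration, with its border in the last row and
column. -/
def borderedExpr : ArithExpr :=
  ifLe Reg.modes Reg.row
    (ifLe Reg.modes Reg.col 0
      (entry Arr.transition Reg.col Reg.modeY * entry Arr.config Reg.zero Reg.col))
    (ifLe Reg.modes Reg.col
      (entry Arr.config Reg.zero Reg.row * entry Arr.transition Reg.row Reg.modeX)
      (maskedExpr (conjugatedExpr outerSignExpr)))

/-- The equivalence moving the border to the last index. -/
def borderEquiv (n : ℕ) : Fin 1 ⊕ Fin n ≃ Fin (n + 1) := (Equiv.sumComm _ _).trans finSumFinEquiv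

theorem borderedExpr_eval (h : Ready m u α s v) :
    (of fun i j : Fin (2 * n + 1) => borderedExpr.eval (m.focus i j)).submatrix
        (borderEquiv _) (borderEquiv _) =
      bordered ((fun i : Fin (2 * n) => configVec α i) * fun i => (u i (modeX s) : ℂ))
        ((fun i => (u i (modeY s) : ℂ)) * fun i : Fin (2 * n) => configVec α i)
        (masked (fun i : Fin (2 * n) => configVec α i)
          ((u * diagonal (outerSign s) * uᵀ).map Complex.ofRealHom)) := by
  have hX (i : Fin (2 * n)) : m.val Arr.transition i (2 * s) = u i (modeX s) :=
    congrFun₂ h.transition i (modeX s)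
  have hY (i : Fin (2 * n)) : m.val Arr.transition i (2 * s + 1) = u i (modeY s) :=
    congrFun₂ h.transition i (modeY s)
  ext (i | i) (j | j)
  · simp [borderEquiv, borderedExpr, bordered, h.modes]
  · simp [borderEquiv, borderedExpr, bordered, h.modes, h.modeY, h.zero, h.config, hY]
  · simp [borderEquiv, borderedExpr, bordered, h.modes, h.modeX, h.zero, h.config, hX]
  · rw [bordered, fromBlocks_apply₂₂, ← maskedExpr_conjugatedExpr_eval h fun l =>
      outerSignExpr_eval ((h.focus i j).setIdx (by decide) l) rfl]
    simp [borderEquiv, borderedExpr, h.modes, i.2.not_ge, j.2.not_ge]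

/-- Stores `borderedDet` in the array `out`. -/
def borderedStmt (out : ℕ) : Stmt :=
  .seq (.assign Arr.matrix Reg.modesSucc Reg.modesSucc borderedExpr) (detStmt Reg.modesSucc out)

theorem borderedStmt_den (h : Ready m u α s v) (out : ℕ) :
    ((borderedStmt out).den m).val out 0 0 = (borderedDet u α s : ℝ) := by
  set m₁ := (Stmt.assign Arr.matrix Reg.modesSucc Reg.modesSucc borderedExpr).den m
  change ((detStmt _ out).den m₁).val out 0 0 = _
  rw [detStmt_den (m := m₁) out (by norm_num) h.modesSucc h.one h.zero
    (Stmt.den_assign_corner h.modesSucc h.modesSucc), ← det_submatrix_equiv_self (borderEquiv _),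
    borderedExpr_eval h,
    det_bordered_masked α.injective (configVec_apply α) (fun _ => configVec_of_notMem_range),
    map_mul_diagonal_mul_submatrix, borderedDet_eq_det_bordered]
  exact (congrArg det (bordered_map Complex.ofRealHom _ _ _)).symm.trans
    (RingHom.map_det Complex.ofRealHom _).symm

/-- The diagonal entries of minus the reflection of the modes up to `modeX s`. -/
def signX : ArithExpr := ifLe 18 Reg.modeX 1 (0 - 1)

/-- The diagonal entries of minus the reflection of the modes below `modeX s` and of `modeY s`. -/
def signY : ArithExpr := ifLe 18 Reg.modeY (ifEq 18 Reg.modeX (0 - 1) 1) (0 - 1)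

/-- The diagonal entries of the reflection of `modeX s` and `modeY s`. -/
def signZ : ArithExpr := ifEq 18 Reg.modeX (0 - 1) (ifEq 18 Reg.modeY (0 - 1) 1)

theorem signX_eval (h : HasConstants m n s) {l : Fin (2 * n)} (hl : m.idx 18 = l) :
    signX.eval m = (-if l ∈ Finset.univ.filter (· ≤ modeX s) then -1 else 1 : ℝ) := by
  simp only [signX, Finset.mem_filter, Finset.mem_univ, true_and, modeX, Fin.le_def, eval,
    eval_sub, h.modeX, hl]
  split_ifs <;> simp

theorem signY_eval (h : HasConstants m n s) {l : Fin (2 * n)} (hl : m.idx 18 = l) :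
    signY.eval m =
      (-if l ∈ Finset.univ.filter (fun μ => μ < modeX s ∨ μ = modeY s) then -1 else 1 : ℝ) := by
  simp only [signY, Finset.mem_filter, Finset.mem_univ, true_and, modeX, modeY, Fin.lt_def,
    Fin.ext_iff, eval, eval_ifEq, eval_sub, h.modeX, h.modeY, hl]
  split_ifs <;> first | omega | simp

theorem signZ_eval (h : HasConstants m n s) {l : Fin (2 * n)} (hl : m.idx 18 = l) :
    signZ.eval m =
      (if l ∈ ({modeX s, modeY s} : Finset (Fin (2 * n))) then -1 else 1 : ℝ) := by
  simp only [signZ, Finset.mem_insert, Finset.mem_singleton, modeX, modeY, Fin.ext_iff,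
    eval_ifEq, eval_sub, eval_zero, eval_one, h.modeX, h.modeY, hl]
  split_ifs <;> first | omega | simp

/-- Stores the four determinants in the entries of the matrix of the form. -/
def minorsStmt : Stmt :=
  .seq (minorStmt signX Arr.minorX) <| .seq (minorStmt signY Arr.minorY) <|
  .seq (minorStmt signZ Arr.minorZ) (borderedStmt Arr.minorXY)

/-- The memory holds the four determinants from which the matrix of the form is computed. -/
structure HoldsMinors (m : Memory) (u : Matrix (Fin (2 * n)) (Fin (2 * n)) ℝ)
    (α : Fin k ↪o Fin (2 * n)) (s : Fin n) : Prop where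
  minorX : m.val Arr.minorX 0 0 =
    ((-1) ^ k * reflDet u α (Finset.univ.filter fun μ => μ ≤ modeX s) : ℝ)
  minorY : m.val Arr.minorY 0 0 =
    ((-1) ^ k * reflDet u α (Finset.univ.filter fun μ => μ < modeX s ∨ μ = modeY s) : ℝ)
  minorZ : m.val Arr.minorZ 0 0 = (reflDet u α {modeX s, modeY s} : ℝ)
  minorXY : m.val Arr.minorXY 0 0 = (borderedDet u α s : ℝ)

theorem minorsStmt_den (h : Ready m u α s v) : HoldsMinors (minorsStmt.den m) u α s := by
  set m₁ := (minorStmt signX Arr.minorX).den m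
  set m₂ := (minorStmt signY Arr.minorY).den m₁
  set m₃ := (minorStmt signZ Arr.minorZ).den m₂
  have h₁ : Ready m₁ u α s v := h.den (by decide) (by decide)
  have h₂ : Ready m₂ u α s v := h₁.den (by decide) (by decide)
  have h₃ : Ready m₃ u α s v := h₂.den (by decide) (by decide)
  have hden : minorsStmt.den m = (borderedStmt Arr.minorXY).den m₃ := rfl
  rw [hden]
  refine ⟨?_, ?_, ?_, borderedStmt_den h₃ _⟩
  · rw [← det_submatrix_neg_reflection, reflection_eq_diagonal, diagonal_neg,
      Stmt.den_val_of_notMem (by decide), Stmt.den_val_of_notMem (by decide),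
      Stmt.den_val_of_notMem (by decide)]
    exact minorStmt_den h (fun i j l => signX_eval ((h.focus i j).setIdx (by decide) l) rfl) _
  · rw [← det_submatrix_neg_reflection, reflection_eq_diagonal, diagonal_neg,
      Stmt.den_val_of_notMem (by decide), Stmt.den_val_of_notMem (by decide)]
    exact minorStmt_den h₁ (fun i j l => signY_eval ((h₁.focus i j).setIdx (by decide) l) rfl) _
  · rw [reflDet, reflection_eq_diagonal, Stmt.den_val_of_notMem (by decide)]
    exact minorStmt_den h₂ (fun i j l => signZ_eval ((h₂.focus i j).setIdx (by decide) l) rfl) _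

/-- The entries of `otoMatrix`, from the four determinants. -/
def formMatrixExpr : ArithExpr :=
  ifEq Reg.row Reg.col
    (ifEq Reg.row Reg.zero ((1 - entry Arr.minorX Reg.zero Reg.zero) / (1 + 1))
      (ifEq Reg.row Reg.one ((1 - entry Arr.minorY Reg.zero Reg.zero) / (1 + 1))
        ((1 - entry Arr.minorZ Reg.zero Reg.zero) / (1 + 1))))
    (ifLe Reg.row Reg.one (ifLe Reg.col Reg.one (entry Arr.minorXY Reg.zero Reg.zero) 0) 0)

theorem formMatrixExpr_eval (h : HasConstants m n s) (hm : HoldsMinors m u α s) (a b : Fin 3) :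
    formMatrixExpr.eval (m.focus a b) = (otoMatrix u α s a b : ℂ) := by
  have hc := h.focus a b
  have hrow : (m.focus a b).idx Reg.row = a := rfl
  have hcol : (m.focus a b).idx Reg.col = b := rfl
  simp only [formMatrixExpr, eval_ifEq, eval, eval_div, eval_sub, eval_entry,
    hrow, hcol, hc.zero, hc.one, Memory.setIdx_val, hm.minorX, hm.minorY, hm.minorZ,
    hm.minorXY, otoMatrix]
  fin_cases a <;> fin_cases b <;> simp <;> ring

/-- The value of the form at the vector in the array `Arr.vector`. -/
def formValueExpr : ArithExpr :=
  sum 18 Reg.three (conj (entry Arr.vector Reg.zero 18) *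
    sum 19 Reg.three (entry Arr.form 18 19 * entry Arr.vector Reg.zero 19))

theorem formValueExpr_eval (h : HasConstants m n s)
    (hv : ∀ j, m.val Arr.vector 0 j = padVec v j) :
    formValueExpr.eval m = quadForm (outMatrix m) v := by
  have hvec (a : Fin 3) : m.val Arr.vector 0 a = v a := (hv a).trans (dif_pos a.2)
  simp [formValueExpr, quadForm, dotProduct, mulVec, outMatrix, Finset.sum_range, h.three, h.zero,
    hvec]

/-- Evaluates `otoMatrix` and its form from the transition matrix. -/
def evalStmt : Stmt :=
  .seq minorsStmt <| .seq (.assign Arr.form Reg.three Reg.three formMatrixExpr)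
    (.assign Arr.value Reg.one Reg.one formValueExpr)

theorem evalStmt_den (h : Ready m u α s v) :
    outMatrix (evalStmt.den m) = (otoMatrix u α s).map Complex.ofReal ∧
      outValue (evalStmt.den m) = quadForm ((otoMatrix u α s).map Complex.ofReal) v := by
  set m₁ := minorsStmt.den m
  set m₂ := (Stmt.assign Arr.form Reg.three Reg.three formMatrixExpr).den m₁
  have h₁ : Ready m₁ u α s v := h.den (by decide) (by decide)
  have h₂ : Ready m₂ u α s v := h₁.den (by decide) (by decide)
  have hmatrix : outMatrix m₂ = (otoMatrix u α s).map Complex.ofReal := by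
    change m₂.corner Arr.form 3 3 = _
    rw [Stmt.den_assign_corner h₁.three h₁.three]
    ext a b
    exact formMatrixExpr_eval h₁.toHasConstants (minorsStmt_den h) a b
  have hden : evalStmt.den m =
    (Stmt.assign Arr.value Reg.one Reg.one formValueExpr).den m₂ := rfl
  rw [hden, ← hmatrix, outValue, Stmt.den_assign_scalar h₂.one,
    formValueExpr_eval (h₂.focus 0 0) h₂.vector]
  exact ⟨Stmt.den_corner_of_notMem (p := 3) (q := 3) (by decide), rfl⟩

end CorrelatorProgram

section CircuitProgram

open ArithExpr

/-- The first column of `modeBlock q * V` in row `q`, where `V` is the current gate matrix. -/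
def blockColumnExpr : ArithExpr :=
  let V00 := entry Arr.gateV Reg.gate Reg.zero
  let V10 := entry Arr.gateV Reg.gate Reg.two
  ifEq Reg.row Reg.zero (ifEq Reg.col Reg.zero V10 V00) <|
  ifEq Reg.row Reg.one (ifEq Reg.col Reg.zero (0 - imag * V10) (imag * V00)) <|
  ifEq Reg.row Reg.two (ifEq Reg.col Reg.zero V00 (0 - V10)) <|
  ifEq Reg.col Reg.zero (imag * V00) (imag * V10)

/-- The first column of `Wᴴ * modeBlock q * V` in row `q`, from `blockColumnExpr`. -/
def imageColumnExpr : ArithExpr :=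
  let B0 := entry Arr.blockColumn Reg.row Reg.zero
  let B1 := entry Arr.blockColumn Reg.row Reg.one
  ifEq Reg.col Reg.zero
    (conj (entry Arr.gateW Reg.gate Reg.zero) * B0 + conj (entry Arr.gateW Reg.gate Reg.two) * B1)
    (conj (entry Arr.gateW Reg.gate Reg.one) * B0 + conj (entry Arr.gateW Reg.gate Reg.three) * B1)

/-- The real part of an expression. -/
def reExpr (e : ArithExpr) : ArithExpr := (e + conj e) / (1 + 1)

/-- The imaginary part of an expression. -/
def imExpr (e : ArithExpr) : ArithExpr := (e - conj e) / ((1 + 1) * imag)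

/-- The entries of `gateCoeff`, from `imageColumnExpr`. -/
def gateCoeffExpr : ArithExpr :=
  ifEq Reg.col Reg.zero (reExpr (entry Arr.imageColumn Reg.row Reg.one)) <|
  ifEq Reg.col Reg.one (imExpr (entry Arr.imageColumn Reg.row Reg.one)) <|
  ifEq Reg.col Reg.two (reExpr (entry Arr.imageColumn Reg.row Reg.zero))
    (imExpr (entry Arr.imageColumn Reg.row Reg.zero))

/-- The entries of the transition matrix of the current gate, where the registers `19` and `20` hold
the first mode of the gate and the first mode after it. -/
def gateEntryExpr : ArithExpr :=
  let δ := ifEq Reg.row Reg.col 1 0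
  ifLe 20 Reg.row δ <| ifLe 20 Reg.col δ <| ifLe 19 Reg.row (ifLe 19 Reg.col
    (bindSub 21 Reg.row 19 (bindSub 22 Reg.col 19 (entry Arr.gateCoeff 21 22))) δ) δ

/-- The entries of the transition matrix of the current gate. The position of the gate is given by a
unit vector, hence the sum over all positions. -/
def gateTransitionExpr : ArithExpr :=
  sum 18 Reg.qubits (entry Arr.input Reg.gate 18 *
    bindAdd 19 18 18 (bindAdd 20 19 Reg.four gateEntryExpr))

/-- Stores the transition matrix of the current gate. -/
def gateTransitionStmt : Stmt :=
  .seq (.assign Arr.blockColumn Reg.four Reg.two blockColumnExpr) <|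
  .seq (.assign Arr.imageColumn Reg.four Reg.two imageColumnExpr) <|
  .seq (.assign Arr.gateCoeff Reg.four Reg.four gateCoeffExpr)
    (.assign Arr.gate Reg.modes Reg.modes gateTransitionExpr)

/-- Multiplies the transition matrix by the one of the current gate. -/
def gateStmt : Stmt :=
  .seq gateTransitionStmt <|
  .seq (.assign Arr.product Reg.modes Reg.modes (mulExpr Reg.modes Arr.transition Arr.gate))
    (.assign Arr.transition Reg.modes Reg.modes (entry Arr.product Reg.row Reg.col))

/-- Stores the transition matrix of the circuit. -/
def circuitStmt : Stmt :=
  .seq (.assign Arr.transition Reg.modes Reg.modes (ifEq Reg.row Reg.col 1 0))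
    (.loop Reg.gate Reg.gates gateStmt)

variable {n s : ℕ} {m : Memory}

theorem reExpr_eval (e : ArithExpr) : (reExpr e).eval m = ((e.eval m).re : ℂ) := by
  simp [reExpr, Complex.re_eq_add_conj, one_add_one_eq_two]

theorem imExpr_eval (e : ArithExpr) : (imExpr e).eval m = ((e.eval m).im : ℂ) := by
  simp [imExpr, Complex.im_eq_sub_conj, one_add_one_eq_two]

/-- The memory holds `g` as the current gate. -/
structure HasGate (m : Memory) (g : Matchgate n) (s : ℕ) : Prop extends HasConstants m n s where
  pos : ∀ j, m.val Arr.input (m.idx Reg.gate) j = if g.pos = j then 1 else 0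
  fst : ∀ j, m.val Arr.gateV (m.idx Reg.gate) j = flatten g.V.1 j
  snd : ∀ j, m.val Arr.gateW (m.idx Reg.gate) j = flatten g.W.1 j

section GateTransition

variable {g : Matchgate n}

theorem HasGate.assign (h : HasGate m g s) {A : ℕ}
    (hA : ∀ a ∈ [Arr.input, Arr.gateV, Arr.gateW], a ≠ A) (b c : ℕ) (e : ArithExpr) :
    HasGate ((Stmt.assign A b c e).den m) g s where
  toHasConstants := h.toHasConstants.den (by simp [Stmt.counters])
  pos j := by
    rw [Stmt.den_val_of_notMem (mt List.mem_singleton.1 (hA _ (by decide)))]; exact h.pos j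
  fst j := by
    rw [Stmt.den_val_of_notMem (mt List.mem_singleton.1 (hA _ (by decide)))]; exact h.fst j
  snd j := by
    rw [Stmt.den_val_of_notMem (mt List.mem_singleton.1 (hA _ (by decide)))]; exact h.snd j

theorem blockColumnExpr_eval (h : HasGate m g s) (q : Fin 4) (i : Fin 2) :
    blockColumnExpr.eval (m.focus q i) = (modeBlock q * g.V.1) i 0 := by
  fin_cases q <;> fin_cases i <;>
    simp [blockColumnExpr, modeBlock, pauli, mul_apply, h.one, h.two, h.zero, h.fst, flatten]

theorem imageColumnExpr_eval (h : HasGate m g s)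
    (hblock : m.corner Arr.blockColumn 4 2 = of fun q i => (modeBlock q * g.V.1) i 0)
    (q : Fin 4) (i : Fin 2) :
    imageColumnExpr.eval (m.focus q i) = (g.W.1ᴴ * modeBlock q * g.V.1) i 0 := by
  have hzero : m.val Arr.blockColumn q 0 = (modeBlock q * g.V.1) 0 0 := congrFun₂ hblock q 0
  have hone : m.val Arr.blockColumn q 1 = (modeBlock q * g.V.1) 1 0 := congrFun₂ hblock q 1
  rw [mul_assoc, mul_apply, Fin.sum_univ_two, ← hzero, ← hone]
  fin_cases i <;>
    simp [imageColumnExpr, h.one, h.two, h.three, h.zero, h.snd, flatten]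

theorem gateCoeffExpr_eval (h : HasGate m g s)
    (himage : m.corner Arr.imageColumn 4 2 = of fun q i => (g.W.1ᴴ * modeBlock q * g.V.1) i 0)
    (q r : Fin 4) :
    gateCoeffExpr.eval (m.focus q r) = gateCoeff g.V.1 g.W.1 q r := by
  have hzero : m.val Arr.imageColumn q 0 = (g.W.1ᴴ * modeBlock q * g.V.1) 0 0 :=
    congrFun₂ himage q 0
  have hone : m.val Arr.imageColumn q 1 = (g.W.1ᴴ * modeBlock q * g.V.1) 1 0 :=
    congrFun₂ himage q 1
  rw [gateCoeff, of_apply]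
  fin_cases r <;>
    simp [gateCoeffExpr, blockCoord, reExpr_eval, imExpr_eval, h.one, h.two, h.zero, hzero, hone]

theorem gateEntryExpr_eval (hfirst : m.idx 19 = 2 * g.pos) (hafter : m.idx 20 = 2 * g.pos + 4)
    (hcoeff : m.corner Arr.gateCoeff 4 4 = (gateCoeff g.V.1 g.W.1).map Complex.ofRealHom)
    {i j : Fin (2 * n)} (hrow : m.idx Reg.row = i) (hcol : m.idx Reg.col = j) :
    gateEntryExpr.eval m = g.transition i j := by
  have hentry (q r : Fin 4) : m.val Arr.gateCoeff q r = gateCoeff g.V.1 g.W.1 q r :=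
    congrFun₂ hcoeff q r
  rw [Matchgate.transition, of_apply]
  by_cases hg : (2 * g.pos ≤ i ∧ (i : ℕ) < 2 * g.pos + 4) ∧
      2 * g.pos ≤ j ∧ (j : ℕ) < 2 * g.pos + 4
  · rw [dif_pos hg, ← hentry, gateEntryExpr]
    simp only [eval, hfirst, hafter, hrow, hcol, hg, not_le.2 hg.1.2, not_le.2 hg.2.2,
      if_true, if_false]
    rw [← hfirst, ← hrow, ← hcol]
    rfl
  · rw [dif_neg hg, gateEntryExpr]
    simp only [eval, eval_ifEq, hfirst, hafter, hrow, hcol, Fin.ext_iff]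
    split_ifs <;> first | omega | simp

theorem gateTransitionExpr_eval (h : HasGate m g s)
    (hcoeff : m.corner Arr.gateCoeff 4 4 = (gateCoeff g.V.1 g.W.1).map Complex.ofRealHom)
    (i j : Fin (2 * n)) :
    gateTransitionExpr.eval (m.focus i j) = g.transition i j := by
  have hpos : g.pos ∈ Finset.range n := Finset.mem_range.2 (by have := g.pos_lt; omega)
  have hqubits : (m.focus i j).idx Reg.qubits = n := h.qubits
  have hinput (t : ℕ) : (entry Arr.input Reg.gate 18).eval ((m.focus i j).setIdx 18 t) =
      if g.pos = t then 1 else 0 := h.pos t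
  rw [gateTransitionExpr, eval, hqubits, Finset.sum_eq_single_of_mem g.pos hpos, eval_mul, hinput,
    if_pos rfl, one_mul]
  · let m₁ := (m.focus i j).setIdx 18 g.pos
    let m₂ := m₁.setIdx 19 (g.pos + g.pos)
    exact gateEntryExpr_eval (m := m₂.setIdx 20 (m₂.idx 19 + m₂.idx Reg.four)) (two_mul _).symm
      (congrArg₂ (· + ·) (two_mul _).symm h.four) hcoeff rfl rfl
  · intro t _ ht
    rw [eval_mul, hinput, if_neg ht.symm, zero_mul]

theorem gateTransitionStmt_den (h : HasGate m g s) :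
    (gateTransitionStmt.den m).corner Arr.gate (2 * n) (2 * n) =
      g.transition.map Complex.ofRealHom := by
  set m₁ := (Stmt.assign Arr.blockColumn Reg.four Reg.two blockColumnExpr).den m
  set m₂ := (Stmt.assign Arr.imageColumn Reg.four Reg.two imageColumnExpr).den m₁
  set m₃ := (Stmt.assign Arr.gateCoeff Reg.four Reg.four gateCoeffExpr).den m₂
  have h₁ : HasGate m₁ g s := h.assign (by decide) _ _ _
  have h₂ : HasGate m₂ g s := h₁.assign (by decide) _ _ _
  have h₃ : HasGate m₃ g s := h₂.assign (by decide) _ _ _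
  have hblock : m₁.corner Arr.blockColumn 4 2 = of fun q i => (modeBlock q * g.V.1) i 0 := by
    rw [Stmt.den_assign_corner h.four h.two]
    ext q i
    exact blockColumnExpr_eval h q i
  have himage : m₂.corner Arr.imageColumn 4 2 =
      of fun q i => (g.W.1ᴴ * modeBlock q * g.V.1) i 0 := by
    rw [Stmt.den_assign_corner h₁.four h₁.two]
    ext q i
    exact imageColumnExpr_eval h₁ hblock q i
  have hcoeff : m₃.corner Arr.gateCoeff 4 4 = (gateCoeff g.V.1 g.W.1).map Complex.ofRealHom := by
    rw [Stmt.den_assign_corner h₂.four h₂.four]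
    ext q r
    exact gateCoeffExpr_eval h₂ himage q r
  have hden : gateTransitionStmt.den m =
    (Stmt.assign Arr.gate Reg.modes Reg.modes gateTransitionExpr).den m₃ := rfl
  rw [hden, Stmt.den_assign_corner h₃.modes h₃.modes]
  ext i j
  exact gateTransitionExpr_eval h₃ hcoeff i j

theorem gateStmt_den (h : HasGate m g s) {u : Matrix (Fin (2 * n)) (Fin (2 * n)) ℝ}
    (hu : m.corner Arr.transition (2 * n) (2 * n) = u.map Complex.ofRealHom) :
    (gateStmt.den m).corner Arr.transition (2 * n) (2 * n) =
      (u * g.transition).map Complex.ofRealHom := by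
  set m₁ := gateTransitionStmt.den m
  set m₂ := (Stmt.assign Arr.product Reg.modes Reg.modes
    (mulExpr Reg.modes Arr.transition Arr.gate)).den m₁
  have hmodes₁ : m₁.idx Reg.modes = 2 * n := h.modes
  have hmodes₂ : m₂.idx Reg.modes = 2 * n := h.modes
  have hproduct : m₂.corner Arr.product (2 * n) (2 * n) =
      (u * g.transition).map Complex.ofRealHom := by
    rw [Stmt.den_assign_corner hmodes₁ hmodes₁, Matrix.map_mul, ← hu, ← gateTransitionStmt_den h]
    ext i j
    exact mulExpr_eval _ _ hmodes₁ (by norm_num) i j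
  have hden : gateStmt.den m = (Stmt.assign Arr.transition Reg.modes Reg.modes
    (entry Arr.product Reg.row Reg.col)).den m₂ := rfl
  rw [hden, Stmt.den_assign_corner hmodes₂ hmodes₂, ← hproduct]
  ext i j
  simp

end GateTransition

/-- The memory holds the circuit `L`. -/
structure HoldsCircuit (m : Memory) (L : List (Matchgate n)) (s : ℕ) : Prop extends
    HasConstants m n s where
  gates : m.idx Reg.gates = L.length
  pos : ∀ (t : ℕ) (ht : t < L.length) j, m.val Arr.input t j = if L[t].pos = j then 1 else 0
  fst : ∀ (t : ℕ) (ht : t < L.length) j, m.val Arr.gateV t j = flatten L[t].V.1 j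
  snd : ∀ (t : ℕ) (ht : t < L.length) j, m.val Arr.gateW t j = flatten L[t].W.1 j

section CircuitTransition

variable {L : List (Matchgate n)}

theorem HoldsCircuit.hasGate (h : HoldsCircuit m L s) {t : ℕ} (ht : t < L.length) :
    HasGate (m.setIdx Reg.gate t) L[t] s where
  toHasConstants := h.toHasConstants.setIdx (by decide) t
  pos := h.pos t ht
  fst := h.fst t ht
  snd := h.snd t ht

theorem HoldsCircuit.setIdx_gate (h : HoldsCircuit m L s) (t : ℕ) :
    HoldsCircuit (m.setIdx Reg.gate t) L s where
  toHasConstants := h.toHasConstants.setIdx (by decide) t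
  gates := h.gates
  pos := h.pos
  fst := h.fst
  snd := h.snd

theorem HoldsCircuit.den (h : HoldsCircuit m L s) {S : Stmt}
    (hcounters : ∀ r ∈ S.counters, Reg.round ≤ r ∧ r ≠ Reg.zero)
    (hwrites : ∀ a ∈ [Arr.input, Arr.gateV, Arr.gateW], a ∉ S.writes) :
    HoldsCircuit (S.den m) L s where
  toHasConstants := h.toHasConstants.den hcounters
  gates := by
    rw [Stmt.den_idx_of_notMem fun hmem => absurd (hcounters _ hmem) (by decide), h.gates]
  pos := by rw [Stmt.den_val_of_notMem (hwrites _ (by decide))]; exact h.pos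
  fst := by rw [Stmt.den_val_of_notMem (hwrites _ (by decide))]; exact h.fst
  snd := by rw [Stmt.den_val_of_notMem (hwrites _ (by decide))]; exact h.snd

theorem circuitTransition_take_succ {t : ℕ} (ht : t < L.length) :
    circuitTransition (L.take (t + 1)) = circuitTransition (L.take t) * L[t].transition := by
  rw [circuitTransition, circuitTransition, List.take_succ_eq_append_getElem ht,
    List.map_append, List.prod_append, List.map_singleton, List.prod_singleton]

theorem circuitStmt_den (h : HoldsCircuit m L s) :
    (circuitStmt.den m).corner Arr.transition (2 * n) (2 * n) =
      (circuitTransition L).map Complex.ofRealHom := by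
  set m₁ := (Stmt.assign Arr.transition Reg.modes Reg.modes (ifEq Reg.row Reg.col 1 0)).den m
  have h₁ : HoldsCircuit m₁ L s := h.den (by decide) (by decide)
  have hinit : m₁.corner Arr.transition (2 * n) (2 * n) =
      (circuitTransition (L.take 0)).map Complex.ofRealHom := by
    rw [Stmt.den_assign_corner h.modes h.modes, List.take_zero, circuitTransition, List.map_nil,
      List.prod_nil, Matrix.map_one _ (map_zero _) (map_one _)]
    ext i j
    simp [one_apply, Fin.ext_iff]
  have hloop := foldl_range_induction (f := fun m' t => gateStmt.den (m'.setIdx Reg.gate t))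
    (fun t m' => HoldsCircuit m' L s ∧ m'.corner Arr.transition (2 * n) (2 * n) =
      (circuitTransition (L.take t)).map Complex.ofRealHom) (N := L.length) ⟨h₁, hinit⟩ <| by
    rintro t m' ht ⟨hm', hu⟩
    refine ⟨(hm'.setIdx_gate t).den (by decide) (by decide), ?_⟩
    rw [gateStmt_den (hm'.hasGate ht) hu, circuitTransition_take_succ ht]
  rw [List.take_length, ← h.gates] at hloop
  exact hloop.2

end CircuitTransition

/-- Sets the constants of a correlator, from the number of qubits and the qubit. -/
def setupProgram : Program :=
  .seq (.addIdx Reg.modes Reg.qubits Reg.qubits) <| .seq (.putIdx Reg.one 1) <|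
  .seq (.addIdx Reg.modesSucc Reg.modes Reg.one) <| .seq (.addIdx Reg.modeX Reg.site Reg.site) <|
  .seq (.addIdx Reg.modeY Reg.modeX Reg.one) <| .seq (.putIdx Reg.two 2) <|
  .seq (.putIdx Reg.three 3) (.putIdx Reg.four 4)

theorem setupProgram_steps (m : Memory) : (setupProgram.run m).2 = 8 := rfl

theorem setupProgram_gates (m : Memory) :
    (setupProgram.run m).1.idx Reg.gates = m.idx Reg.gates := rfl

theorem setupProgram_hasConstants (hm : m.idx Reg.zero = 0) :
    HasConstants (setupProgram.run m).1 (m.idx Reg.qubits) (m.idx Reg.site) where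
  qubits := rfl
  modes := (two_mul _).symm
  modesSucc := congrArg (· + 1) (two_mul _).symm
  modeX := (two_mul _).symm
  modeY := congrArg (· + 1) (two_mul _).symm
  one := rfl
  two := rfl
  three := rfl
  four := rfl
  zero := hm

/-- The registers that bound the loops. -/
def loopRegisters : List ℕ :=
  [Reg.qubits, Reg.gates, Reg.modes, Reg.modesSucc, Reg.one, Reg.two, Reg.three, Reg.four]

theorem exists_program {S : Stmt} (hS : S.wellFormed) (hB : S.toProgram.boundedBy loopRegisters) :
    ∃ (P : Program) (p : Polynomial ℕ), ∀ m : Memory, m.idx Reg.zero = 0 →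
      (P.run m).2 ≤ p.eval (m.idx Reg.qubits + m.idx Reg.gates) ∧
      outMatrix (P.run m).1 = outMatrix (S.den (setupProgram.run m).1) ∧
      outValue (P.run m).1 = outValue (S.den (setupProgram.run m).1) := by
  refine ⟨.seq setupProgram S.toProgram, 8 + S.toProgram.cost.comp (2 * Polynomial.X + 4),
    fun m hm => ?_⟩
  have hconst := setupProgram_hasConstants hm
  have hagree : Memory.AgreeOn 16 (Set.Iio 32) (S.den (setupProgram.run m).1)
      (S.toProgram.run (setupProgram.run m).1).1 :=
    Stmt.toProgram_agreeOn hS ⟨fun _ _ => rfl, fun _ _ => rfl⟩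
  have hsteps : (S.toProgram.run (setupProgram.run m).1).2 ≤
      S.toProgram.cost.eval (2 * (m.idx Reg.qubits + m.idx Reg.gates) + 4) := by
    refine Program.steps_le hB ?_
    simp only [loopRegisters, List.mem_cons, List.not_mem_nil, or_false, forall_eq_or_imp,
      forall_eq, hconst.qubits, setupProgram_gates, hconst.modes, hconst.modesSucc, hconst.one,
      hconst.two, hconst.three, hconst.four]
    omega
  refine ⟨?_, ?_, ?_⟩
  · simpa only [Program.run, setupProgram_steps, Polynomial.eval_add, Polynomial.eval_comp,
      Polynomial.eval_mul, Polynomial.eval_X, Polynomial.eval_ofNat, add_le_add_iff_left]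
      using hsteps
  · rw [outMatrix, outMatrix, ← hagree.val 5 (by simp)]
    rfl
  · rw [outValue, outValue, ← hagree.val 6 (by simp)]
    rfl

theorem exists_matrix_program : ∃ (P : Program) (p : Polynomial ℕ),
    ∀ (n k : ℕ) (u : Matrix (Fin (2 * n)) (Fin (2 * n)) ℝ)
      (α : Fin k ↪o Fin (2 * n)) (s : Fin n) (v : Fin 3 → ℂ),
      let res := P.run (matrixInput u α s v)
      let M := (otoMatrix u α s).map Complex.ofReal
      res.2 ≤ p.eval n ∧ outMatrix res.1 = M ∧ outValue res.1 = quadForm M v := by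
  obtain ⟨P, p, hP⟩ := exists_program (S := .seq (.assign Arr.transition Reg.modes Reg.modes
    (entry Arr.input Reg.row Reg.col)) evalStmt) rfl rfl
  refine ⟨P, p, fun n k u α s v => ?_⟩
  obtain ⟨hsteps, hmatrix, hvalue⟩ := hP (matrixInput u α s v) rfl
  set m := (setupProgram.run (matrixInput u α s v)).1
  have hconst : HasConstants m n s := setupProgram_hasConstants rfl
  have hready : Ready ((Stmt.assign Arr.transition Reg.modes Reg.modes
      (entry Arr.input Reg.row Reg.col)).den m) u α s v :=
    { toHasConstants := hconst.den (by decide)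
      transition := by
        rw [Stmt.den_assign_corner hconst.modes hconst.modes]
        ext i j
        exact dif_pos ⟨i.2, j.2⟩
      config := fun _ => rfl
      vector := fun _ => rfl }
  obtain ⟨hform, hquad⟩ := evalStmt_den hready
  exact ⟨hsteps, hmatrix.trans hform, hvalue.trans hquad⟩

theorem exists_circuit_program : ∃ (P : Program) (p : Polynomial ℕ),
    ∀ (n k : ℕ) (L : List (Matchgate n)) (α : Fin k ↪o Fin (2 * n)) (s : Fin n) (v : Fin 3 → ℂ),
      let res := P.run (circuitInput L α s v)
      let M := (otoMatrix (circuitTransition L) α s).map Complex.ofReal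
      res.2 ≤ p.eval (n + L.length) ∧ outMatrix res.1 = M ∧ outValue res.1 = quadForm M v := by
  obtain ⟨P, p, hP⟩ := exists_program (S := .seq circuitStmt evalStmt) rfl rfl
  refine ⟨P, p, fun n k L α s v => ?_⟩
  obtain ⟨hsteps, hmatrix, hvalue⟩ := hP (circuitInput L α s v) rfl
  set m := (setupProgram.run (circuitInput L α s v)).1
  have hcircuit : HoldsCircuit m L s :=
    { toHasConstants := setupProgram_hasConstants rfl
      gates := rfl
      pos := fun t ht j => dif_pos ht
      fst := fun t ht j => dif_pos ht
      snd := fun t ht j => dif_pos ht }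
  have hready : Ready (circuitStmt.den m) (circuitTransition L) α s v :=
    { toHasConstants := hcircuit.toHasConstants.den (by decide)
      transition := circuitStmt_den hcircuit
      config := fun _ => by rw [Stmt.den_val_of_notMem (by decide)]; rfl
      vector := fun _ => by rw [Stmt.den_val_of_notMem (by decide)]; rfl }
  obtain ⟨hform, hquad⟩ := evalStmt_den hready
  exact ⟨hsteps, hmatrix.trans hform, hvalue.trans hquad⟩

end CircuitProgram

end

end MatchgateOTO

theorem mainTheorem3 :
    -- every matchgate circuit is a unitary with a unique transition matrix, in `SO(2n)`
    (∀ (n : ℕ) (L : List (MatchgateOTO.Matchgate n)),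
      MatchgateOTO.circuitOp L ∈ Matrix.unitaryGroup (Fin n → Fin 2) ℂ ∧
      ∃ u ∈ Matrix.specialOrthogonalGroup (Fin (2 * n)) ℝ,
        MatchgateOTO.IsModeTransition (MatchgateOTO.circuitOp L) u ∧
        ∀ u', MatchgateOTO.IsModeTransition (MatchgateOTO.circuitOp L) u' → u' = u) ∧
    -- the correlator is a quadratic form, and its matrix is the explicit one
    (∀ (n k : ℕ) (U : MatchgateOTO.Op n) (u : Matrix (Fin (2 * n)) (Fin (2 * n)) ℝ)
      (α : Fin k ↪o Fin (2 * n)) (s : Fin n),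
      U ∈ Matrix.unitaryGroup (Fin n → Fin 2) ℂ → MatchgateOTO.IsModeTransition U u →
      ∀ M : Matrix (Fin 3) (Fin 3) ℂ,
        (∀ v, MatchgateOTO.oto U α s v = MatchgateOTO.quadForm M v) ↔
          M = (MatchgateOTO.otoMatrix u α s).map Complex.ofReal) ∧
    -- one program computes matrix and form from the transition matrix in polynomially many steps
    (∃ (P : MatchgateOTO.Program) (p : Polynomial ℕ),
      ∀ (n k : ℕ) (u : Matrix (Fin (2 * n)) (Fin (2 * n)) ℝ)
        (α : Fin k ↪o Fin (2 * n)) (s : Fin n) (v : Fin 3 → ℂ),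
        let res := P.run (MatchgateOTO.matrixInput u α s v)
        let M := (MatchgateOTO.otoMatrix u α s).map Complex.ofReal
        res.2 ≤ p.eval n ∧ MatchgateOTO.outMatrix res.1 = M ∧
          MatchgateOTO.outValue res.1 = MatchgateOTO.quadForm M v) ∧
    -- one program computes matrix and form from the circuit in polynomially many steps
    (∃ (P : MatchgateOTO.Program) (p : Polynomial ℕ),
      ∀ (n k : ℕ) (L : List (MatchgateOTO.Matchgate n))
        (α : Fin k ↪o Fin (2 * n)) (s : Fin n) (v : Fin 3 → ℂ),
        let res := P.run (MatchgateOTO.circuitInput L α s v)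
        res.2 ≤ p.eval (n + L.length) ∧
          (∀ w, MatchgateOTO.oto (MatchgateOTO.circuitOp L) α s w =
            MatchgateOTO.quadForm (MatchgateOTO.outMatrix res.1) w) ∧
          MatchgateOTO.outValue res.1 =
            MatchgateOTO.oto (MatchgateOTO.circuitOp L) α s v) := by
  refine ⟨fun n L => ⟨MatchgateOTO.circuitOp_mem_unitaryGroup L, MatchgateOTO.circuitTransition L,
      MatchgateOTO.circuitTransition_mem_specialOrthogonalGroup L,
      MatchgateOTO.isModeTransition_circuitTransition L,
      fun u' h => (MatchgateOTO.isModeTransition_circuitTransition L).unique h⟩,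
    fun n k U u α s hU h M => h.oto_eq_quadForm_iff hU α s M,
    MatchgateOTO.exists_matrix_program, ?_⟩
  obtain ⟨P, p, hP⟩ := MatchgateOTO.exists_circuit_program
  refine ⟨P, p, fun n k L α s v => ?_⟩
  obtain ⟨hsteps, hmatrix, hvalue⟩ := hP n k L α s v
  have hform := ((MatchgateOTO.isModeTransition_circuitTransition L).oto_eq_quadForm_iff
    (MatchgateOTO.circuitOp_mem_unitaryGroup L) α s _).2 hmatrix
  exact ⟨hsteps, hform, by rw [hvalue, hform, hmatrix]⟩
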